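/- **Setting.** Let $T>0$, let $\Gamma\in C^{1,1}([0,T],\mathbb R^2)$ be a curve parametrized by arclength, and let $s^\pm\in C^{0,1}([0,T])$ be positive. Put $N=(\Gamma')^\perp$ (counterclockwise rotation by $\pi/2$), $\kappa=\Gamma''\cdot N$, $M=\{(s,t):0<t<T,\ -s^-(t)<s<s^+(t)\}$, $\Phi(s,t)=\Gamma(t)+sN(t)$, and $\Omega=\Phi(M)$. Assume that $\Omega$ is a bounded Lipschitz domain and that the open segments $\{\Phi(s,t): -s^-(t)<s<s^+(t)\}$, $t\in[0,T]$, are pairwise disjoint. Let $\kappa_n\in L^2(0,T)$, and let $r=(\gamma',v,n)^T\in W^{1,2}((0,T),SO(3))$ solve $$r'=\begin{pmatrix}0&\kappa&\kappa_n\\-\kappa&0&0\\-\kappa_n&0&0\end{pmatrix}r,\qquad r(0)=\mathrm{Id},\qquad \gamma(t)=\int_0^t\gamma'.$$ Let $u:\Omega\to\mathbb R^3$ be given by $u(\Phi(s,t))=\gamma(t)+s\,v(t)$ (an isometric immersion). The surface $S=u(\Omega)$ is called developable of class $C^{m,1}$ if $u\in C^{m,1}(\overline\Omega,\mathbb R^3)$.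 Maps on $S$ are identified with their compositions with the chart $u$ (if $u$ is not injective, $S$ is read as an immersed surface), and their $C^{m,1}$ norms are those of these compositions on $\Omega$. The $C^{m,1}$ norm is the sum of the suprema of the derivatives of orders $0,\dots,m$ and the Lipschitz constant of the $m$-th derivative. Let $\vec n=\partial_1u\times\partial_2u$ be the unit normal, $\Pi(\tau,\eta)=\eta\cdot\partial_\tau\vec n$ the second fundamental form, and $a_{ij}=\vec n\cdot\partial_i\partial_ju$. For $w:S\to\mathbb R^3$ write $w=w_{tan}+(w\vec n)\vec n$ with $w\vec n=w\cdot\vec n$, and let $w'=(w_{tan}\cdot\partial_1u,\ w_{tan}\cdot\partial_2u):\Omega\to\mathbb R^2$. For a symmetric bilinear form $B$ on the tangent spaces of $S$, consider solutions $w$ of $$\mathrm{sym}\nabla w=\mathrm{sym}\nabla w_{tan}+(w\vec n)\,\Pi=B \quad\text{a.e. on } S,\qquad (1)$$ where $\mathrm{sym}\nabla w_{tan}(\tau,\eta)=\frac12(\partial_\tau w_{tan}\cdot\eta+\partial_\eta w_{tan}\cdot\tau)$, $w_{tan}$ is Hölder continuous (with some exponent in $(0,1)$) and weakly differentiable with integrable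 gradient, and $w\vec n\in L^\infty$. Such a $w$ is called *normalized* if * for a.e. $t\in(0,T)$, $s\mapsto (w\vec n)(\Phi(s,t))$ is continuous on $(-s^-(t),s^+(t))$, and it and its $s$-derivative vanish at $s=0$; * $\int_\Omega w'=0$ and $\int_\Omega(\partial_1w'_2-\partial_2w'_1)=0$. **Proposition.** Let $k\ge1$, let $S$ be developable of class $C^{k+2,1}$, and assume that its mean curvature is bounded away from zero: there is $c>0$ with $|\mathrm{trace}\,[a_{ij}]|\ge c$ on $\Omega$. Then there is a constant $C$, depending only on $S$ (with its chart) and $k$, such that the following holds for all $\phi,\psi\in C^{k+1,1}(S,\mathbb R^3)$. Let $$B=\mathrm{sym}\big((\nabla\phi)^T\nabla\psi\big),\qquad B(\tau,\eta)=\tfrac12\big(\partial_\tau\phi\cdot\partial_\eta\psi+\partial_\eta\phi\cdot\partial_\tau\psi\big).$$ Then (1) has a normalized solution $w$, it is unique (up to equality almost everywhere), and, for its suitable representative, $w_{tan}\in C^{k,1}$, $w\vec n\in C^{k-1,1}$ and $$\|w_{tan}\|_{C^{k,1}}+\|w\vec n\|_{C^{k-1,1}}\le C\,\|\phi\|_{C^{k+1,1}}\,\|\psi\|_{C^{k+1,1}}.$$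 -/

import Mathlib

open MeasureTheory Set
open scoped NNReal ENNReal ContDiff Topology

noncomputable section

namespace DevelopableShell

/-- The Euclidean plane. -/
abbrev E2 : Type := EuclideanSpace ℝ (Fin 2)

/-- Euclidean three-space. -/
abbrev E3 : Type := EuclideanSpace ℝ (Fin 3)

/-- The standard basis vectors of the plane. -/
def e (i : Fin 2) : E2 := EuclideanSpace.single i 1

/-- Counterclockwise rotation by a right angle. -/
def perp (a : E2) : E2 := !₂[-(a 1), a 0]

/-- The vector product in three-space. -/
def cross (a b : E3) : E3 :=
  WithLp.toLp 2 (crossProduct (WithLp.ofLp a) (WithLp.ofLp b))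

/-- Bounded Lipschitz domain in the plane: near each boundary point, in suitable Cartesian
coordinates, the set is the open region above the graph of a Lipschitz function. -/
structure IsLipschitzDomain (Ω : Set E2) : Prop where
  isOpen : IsOpen Ω
  isConnected : IsConnected Ω
  isBounded : Bornology.IsBounded Ω
  boundary : ∀ p ∈ frontier Ω, ∃ (R : E2 ≃ₗᵢ[ℝ] E2) (g : ℝ → ℝ) (K : ℝ≥0),
    LipschitzWith K g ∧ ∀ᶠ y in 𝓝 p, (y ∈ Ω ↔ g (R y 0) < R y 1)

section Holder

variable {F : Type*} [NormedAddCommGroup F] [NormedSpace ℝ F]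

/-- The `C^{k,1}` norm on an open set `Ω`, with value `∞` allowed: the sum of the suprema of the
derivatives of orders `0, …, k` and of the best Lipschitz constant of the `k`-th derivative. -/
def ckNorm (k : ℕ) (Ω : Set E2) (f : E2 → F) : ℝ≥0∞ :=
  (∑ j ∈ Finset.range (k + 1), ⨆ x ∈ Ω, ‖iteratedFDeriv ℝ j f x‖ₑ) +
    ⨆ x ∈ Ω, ⨆ y ∈ Ω,
      edist (iteratedFDeriv ℝ k f x) (iteratedFDeriv ℝ k f y) / edist x y

/-- Membership in `C^{k,1}` of the closure of the open set `Ω`: the map is `k` times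
continuously differentiable in `Ω`, its derivatives up to order `k` are bounded and the `k`-th one
is Lipschitz (on a bounded Lipschitz domain they then all extend to Lipschitz maps on the
closure). -/
def MemCk (k : ℕ) (Ω : Set E2) (f : E2 → F) : Prop :=
  ContDiffOn ℝ k f Ω ∧ ckNorm k Ω f < ⊤

/-- `G` is the weak (distributional) gradient of `W` in `Ω`, and is integrable. -/
structure HasWeakGradient (Ω : Set E2) (W : E2 → F) (G : E2 → E2 →L[ℝ] F) : Prop where
  integrable : IntegrableOn W Ω
  integrable_grad : IntegrableOn G Ω
  by_parts : ∀ η : E2 → ℝ, ContDiff ℝ (⊤ : ℕ∞) η → HasCompactSupport η → tsupport η ⊆ Ω →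
    ∀ ξ : E2, ∫ x in Ω, η x • G x ξ = -∫ x in Ω, fderiv ℝ η x ξ • W x

end Holder

/-- A plane curve `Γ` of class `C^{1,1}` on `[0,T]`, parametrized by arclength, with two positive
Lipschitz functions `s⁻`, `s⁺` on `[0,T]`. -/
structure PlanarChart where
  T : ℝ
  T_pos : 0 < T
  Γ : ℝ → E2
  differentiable_Γ : DifferentiableOn ℝ Γ (Icc 0 T)
  lipschitz_tangent : ∃ K : ℝ≥0, LipschitzOnWith K (derivWithin Γ (Icc 0 T)) (Icc 0 T)
  arclength : ∀ t ∈ Icc 0 T, ‖derivWithin Γ (Icc 0 T) t‖ = 1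
  sMinus : ℝ → ℝ
  sPlus : ℝ → ℝ
  lipschitz_sMinus : ∃ K : ℝ≥0, LipschitzOnWith K sMinus (Icc 0 T)
  lipschitz_sPlus : ∃ K : ℝ≥0, LipschitzOnWith K sPlus (Icc 0 T)
  sMinus_pos : ∀ t ∈ Icc 0 T, 0 < sMinus t
  sPlus_pos : ∀ t ∈ Icc 0 T, 0 < sPlus t

namespace PlanarChart

variable (P : PlanarChart)

/-- The unit tangent `Γ'`. -/
def tangent (t : ℝ) : E2 := derivWithin P.Γ (Icc 0 P.T) t

/-- The unit normal `N = (Γ')^⊥`. -/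
def N (t : ℝ) : E2 := perp (P.tangent t)

/-- The curvature `κ = Γ'' · N`, which is defined for almost every `t`. -/
def κ (t : ℝ) : ℝ := inner ℝ (derivWithin P.tangent (Icc 0 P.T) t) (P.N t)

/-- The map `Φ(s,t) = Γ(t) + s N(t)`. -/
def Φ (s t : ℝ) : E2 := P.Γ t + s • P.N t

/-- The parameter domain: pairs `(s,t)` with `0 < t < T` and `-s⁻(t) < s < s⁺(t)`. -/
def M : Set (ℝ × ℝ) :=
  {q | q.2 ∈ Ioo 0 P.T ∧ q.1 ∈ Ioo (-P.sMinus q.2) (P.sPlus q.2)}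

/-- The open segment through `Γ(t)` in the direction `N(t)`. -/
def segment (t : ℝ) : Set E2 :=
  (fun s => P.Φ s t) '' Ioo (-P.sMinus t) (P.sPlus t)

/-- The planar domain `Ω = Φ(M)`. -/
def Ω : Set E2 := (fun q : ℝ × ℝ => P.Φ q.1 q.2) '' P.M

end PlanarChart

/-- A developable surface `S = u(Ω)`, covered by one line of curvature chart: `Ω = Φ(M)` is a
bounded Lipschitz domain, distinct segments are disjoint, `κₙ` is square integrable, the moving
frame `r = (γ', v, n)ᵀ` takes values in `SO(3)` and is the `W^{1,2}` solution of
`r' = [[0, κ, κₙ], [-κ, 0, 0], [-κₙ, 0, 0]] r`, `r(0) = Id` (in integrated form), and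
`u(Φ(s,t)) = γ(t) + s v(t)` with `γ(t) = ∫₀ᵗ γ'`. The values of `u` outside `Ω` play no role. -/
structure DevelopableSurface extends PlanarChart where
  disjoint_segments : ∀ t₁ ∈ Icc 0 T, ∀ t₂ ∈ Icc 0 T, t₁ ≠ t₂ →
    Disjoint (toPlanarChart.segment t₁) (toPlanarChart.segment t₂)
  lipschitz_domain : IsLipschitzDomain toPlanarChart.Ω
  κn : ℝ → ℝ
  memLp_κn : MemLp κn 2 (volume.restrict (Ioo 0 T))
  r : ℝ → Matrix (Fin 3) (Fin 3) ℝ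
  continuous_r : ContinuousOn r (Icc 0 T)
  r_mem : ∀ t ∈ Icc 0 T, r t ∈ Matrix.specialOrthogonalGroup (Fin 3) ℝ
  frame_eq : ∀ t ∈ Icc 0 T, ∀ i j : Fin 3,
    r t i j = (1 : Matrix (Fin 3) (Fin 3) ℝ) i j +
      ∫ τ in (0 : ℝ)..t,
        ((!![0, toPlanarChart.κ τ, κn τ; -toPlanarChart.κ τ, 0, 0; -κn τ, 0, 0] :
          Matrix (Fin 3) (Fin 3) ℝ) * r τ) i j
  u : E2 → E3
  u_Φ : ∀ q ∈ toPlanarChart.M, u (toPlanarChart.Φ q.1 q.2) =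
    (∫ τ in (0 : ℝ)..q.2, (WithLp.toLp 2 (r τ 0) : E3)) +
      q.1 • (WithLp.toLp 2 (r q.2 1) : E3)

namespace DevelopableSurface

variable (D : DevelopableSurface)

/-- The surface is of class `C^{k,1}` (up to the boundary). -/
def IsOfClass (k : ℕ) : Prop := MemCk k D.Ω D.u

/-- The unit normal, as a function on the chart domain: `∂₁u × ∂₂u`. -/
def normal (x : E2) : E3 := cross (fderiv ℝ D.u x (e 0)) (fderiv ℝ D.u x (e 1))

/-- The second fundamental form `Π(τ,η) = η · ∂_τ n` at `u(x)`, evaluated on the tangent vectors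
`τ = du(x) ξ` and `η = du(x) ζ`. -/
def secondForm (x ξ ζ : E2) : ℝ :=
  inner ℝ (fderiv ℝ D.normal x ξ) (fderiv ℝ D.u x ζ)

/-- The coefficients `a_{ij} = (∂₁u × ∂₂u) · ∂ᵢ∂ⱼu`. -/
def a (i j : Fin 2) (x : E2) : ℝ :=
  inner ℝ (D.normal x) (fderiv ℝ (fderiv ℝ D.u) x (e i) (e j))

/-- The mean curvature, the trace of `[a_{ij}]`, is bounded away from zero on `Ω`. For a surface of
class `C^{2,1}` the `a_{ij}` extend continuously to the compact closure of `Ω`, and this says that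
the trace vanishes nowhere on the closure. -/
def MeanCurvatureAwayFromZero : Prop :=
  ∃ c : ℝ, 0 < c ∧ ∀ x ∈ D.Ω, c ≤ |D.a 0 0 x + D.a 1 1 x|

/- Maps `f` on the surface are represented by their compositions `f ∘ u : Ω → ℝ³` with the chart,
and tangent vectors at `u(x)` by their preimages `ξ` under `du(x)`, so that `∂_τ f` at `u(x)`, for
`τ = du(x) ξ`, is the derivative of `f ∘ u` at `x` in the direction `ξ`. -/

/-- The symmetric form `sym ((∇φ)ᵀ ∇ψ)`, that is
`(τ,η) ↦ ½ (∂_τ φ · ∂_η ψ + ∂_η φ · ∂_τ ψ)`. -/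
def symProd (φ ψ : E2 → E3) (x ξ ζ : E2) : ℝ :=
  (1 / 2) * (inner ℝ (fderiv ℝ φ x ξ) (fderiv ℝ ψ x ζ) +
    inner ℝ (fderiv ℝ φ x ζ) (fderiv ℝ ψ x ξ))

/-- The normal component `w · n`. -/
def normalPart (w : E2 → E3) (x : E2) : ℝ := inner ℝ (w x) (D.normal x)

/-- The tangential component `w_tan = w - (w · n) n`. -/
def tanPart (w : E2 → E3) (x : E2) : E3 := w x - D.normalPart w x • D.normal x

/-- The pull-back `w' = (w_tan)ᵀ ∇u` of the tangential component, a planar vector field. -/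
def pullback (w : E2 → E3) (x : E2) : E2 :=
  !₂[inner ℝ (D.tanPart w x) (fderiv ℝ D.u x (e 0)),
    inner ℝ (D.tanPart w x) (fderiv ℝ D.u x (e 1))]

/-- `w` is a (weak) solution of `sym ∇w = sym ∇w_tan + (w · n) Π = B` on the surface: `w_tan` is
Hölder continuous and weakly differentiable, `w · n` is essentially bounded, and the equation holds
almost everywhere. -/
structure IsWeakSolution (B : E2 → E2 → E2 → ℝ) (w : E2 → E3) : Prop where
  holder : ∃ α : ℝ≥0, 0 < α ∧ α < 1 ∧ ∃ K : ℝ≥0, HolderOnWith K α (D.tanPart w) D.Ω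
  bounded : MemLp (D.normalPart w) ⊤ (volume.restrict D.Ω)
  equation : ∃ G : E2 → E2 →L[ℝ] E3, HasWeakGradient D.Ω (D.tanPart w) G ∧
    ∀ᵐ x ∂(volume.restrict D.Ω), ∀ ξ ζ : E2,
      (1 / 2) * (inner ℝ (G x ξ) (fderiv ℝ D.u x ζ) + inner ℝ (G x ζ) (fderiv ℝ D.u x ξ)) +
        D.normalPart w x * D.secondForm x ξ ζ = B x ξ ζ

/-- The normalization that selects one solution: along (almost) every segment `w · n` is continuous
and vanishes to first order at `s = 0`; the planar field `w'` has mean zero; and the skew-symmetric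
part of the mean of `∇w'` is zero. -/
structure IsNormalized (w : E2 → E3) : Prop where
  initial : ∀ᵐ t ∂(volume.restrict (Ioo 0 D.T)),
    ContinuousOn (fun s => D.normalPart w (D.Φ s t)) (Ioo (-D.sMinus t) (D.sPlus t)) ∧
    D.normalPart w (D.Φ 0 t) = 0 ∧
    HasDerivAt (fun s => D.normalPart w (D.Φ s t)) 0 0
  mean : ∫ x in D.Ω, D.pullback w x = 0
  skew_mean : ∃ H : E2 → E2 →L[ℝ] E2, HasWeakGradient D.Ω (D.pullback w) H ∧
    ∫ x in D.Ω, (H x (e 0) 1 - H x (e 1) 0) = 0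

end DevelopableSurface

end DevelopableShell

end

open DevelopableShell

/-!
Everything is computed in the chart: `x ∈ Ω`, `w' = (w · ∂₁u, w · ∂₂u)`, `f = w · n`. Since `u` is
an isometric immersion of a plane domain (`inner_fderiv_u`), the equation reads `sym ∇w' = B + f a`,
with `a = [a_ij]`, and it is solvable for `w'` when the double curl of the right-hand side vanishes.

*The compatibility condition is an ordinary differential equation.* The normal is constant on the
segments, so `a = (tr a) Γ' ⊗ Γ'` (`a_eq`). By the Codazzi equations the double curl of `f a` is
then `(tr a) ∂²f/∂s²`, with `s` the coordinate along the segments. In the double curl of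
`B = sym ((∇φ)ᵀ ∇ψ)` the third derivatives of `φ` and `ψ` cancel (`curl_curlSymProd`). As `tr a` is bounded
away from zero, `f` is obtained by integrating a function of class `C^{k-1,1}` twice along the
segments, with vanishing initial data (`segSolution`). Then the gradient of the rotation
`(∂₁w'₂ - ∂₂w'₁) / 2` is a known Lipschitz one-form closed almost everywhere, and so, after one integration,
are the gradients of `w'₁` and `w'₂`. Each integration gains one derivative
(`IsRegular.exists_primitive`), and the means are normalized to zero. The outcome is
`IsRegular.exists_solution`.

*Regularity along the segments.* Integration along the segments preserves `C^{k-1,1}` bounds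
because the foot point map is of class `C^{k,1}` (`IsRegular.family_foot`). This is not assumed of
the curve `Γ`; it follows from the regularity of `u`: since the mean curvature does not vanish,
the normal determines the segment through a point, with nondegenerate derivative
(`hasFDerivAt_time`), and the derivative of the foot point map is `a(x) / tr a(foot x)`. The same
relation of the normal to the segments excludes focal points (`jacobian_ne_zero`).

*Estimates.* `CkBound` is a recursive form of the `C^{k,1}` bounds, and `CkFamily` records bounds
that are uniform multiples of given weights; the theorem follows by treating all pairs `(φ, ψ)` as
one family with weights `‖φ‖ ‖ψ‖`. That a bound for the derivative gives a Lipschitz bound is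
where the Lipschitz domain enters (`IsLipschitzDomain.quasiconvex`).

*Uniqueness.* For the difference of two solutions the compatibility condition holds weakly, with
`B = 0`. Testing it with `α(t) β(s)` shows that `f` is affine on almost every segment, hence zero
by the initial conditions (`ae_eq_zero_of_initial`). The gradient of `w'` is then skew-symmetric,
so that `w'` is an infinitesimal rigid displacement, which the two mean conditions annihilate
(`ae_eq_zero_of_skew`).
-/


/-! ### `C^{k,1}` bounds on quasiconvex domains -/

namespace DevelopableShell

section Bounds

variable {F G H : Type} [NormedAddCommGroup F] [NormedSpace ℝ F] [NormedAddCommGroup G]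
  [NormedSpace ℝ G] [NormedAddCommGroup H] [NormedSpace ℝ H]

/-- `CkBound k Ω A f`: on `Ω` the derivatives of `f` of orders `0, …, k` exist and are bounded by
`A`, and the `k`-th one is Lipschitz with constant `A`. The recursion on the order makes product and
chain rules for `C^{k,1}` provable by induction. -/
def CkBound : ∀ (_ : ℕ) {F : Type} [NormedAddCommGroup F] [NormedSpace ℝ F],
    Set E2 → ℝ → (E2 → F) → Prop
  | 0, _, _, _, Ω, A, f =>
      (∀ x ∈ Ω, ‖f x‖ ≤ A) ∧ ∀ x ∈ Ω, ∀ y ∈ Ω, ‖f x - f y‖ ≤ A * ‖x - y‖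
  | k + 1, _, _, _, Ω, A, f =>
      (∀ x ∈ Ω, ‖f x‖ ≤ A) ∧ DifferentiableOn ℝ f Ω ∧ CkBound k Ω A (fderiv ℝ f)

/-- An open set on which a bound `A` for the derivative of a function implies the Lipschitz bound
`L * A`. -/
structure Quasiconvex (L : ℝ) (Ω : Set E2) : Prop where
  isOpen : IsOpen Ω
  one_le : 1 ≤ L
  lipschitz : ∀ (g : E2 → ℝ) (A : ℝ), DifferentiableOn ℝ g Ω → (∀ x ∈ Ω, ‖fderiv ℝ g x‖ ≤ A) →
    ∀ x ∈ Ω, ∀ y ∈ Ω, ‖g x - g y‖ ≤ L * A * ‖x - y‖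

variable {Ω : Set E2} {L A B : ℝ} {k : ℕ} {f : E2 → F} {g : E2 → G}

theorem Quasiconvex.norm_sub_le (hΩ : Quasiconvex L Ω) (hf : DifferentiableOn ℝ f Ω)
    (hA : ∀ x ∈ Ω, ‖fderiv ℝ f x‖ ≤ A) {x y : E2} (hx : x ∈ Ω) (hy : y ∈ Ω) :
    ‖f x - f y‖ ≤ L * A * ‖x - y‖ := by
  obtain ⟨l, hl1, hl2⟩ := exists_dual_vector'' ℝ (f x - f y)
  have hd : ∀ z ∈ Ω, HasFDerivAt (fun z => l (f z)) (l.comp (fderiv ℝ f z)) z := fun z hz =>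
    l.hasFDerivAt.comp z (hf.differentiableAt (hΩ.isOpen.mem_nhds hz)).hasFDerivAt
  have := hΩ.lipschitz (fun z => l (f z)) A
    (fun z hz => (hd z hz).differentiableAt.differentiableWithinAt)
    (fun z hz => by
      rw [(hd z hz).fderiv]
      refine (l.opNorm_comp_le _).trans ?_
      have := hA z hz
      nlinarith [norm_nonneg (fderiv ℝ f z), norm_nonneg l]) x hx y hy
  rw [← map_sub, hl2] at this
  simpa using this

theorem CkBound.norm_le (h : CkBound k Ω A f) {x : E2} (hx : x ∈ Ω) : ‖f x‖ ≤ A := by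
  cases k with
  | zero => exact h.1 x hx
  | succ k => exact h.1 x hx

theorem CkBound.mono (h : CkBound k Ω A f) (hAB : A ≤ B) : CkBound k Ω B f := by
  induction k generalizing F with
  | zero =>
    refine ⟨fun x hx => (h.1 x hx).trans hAB, fun x hx y hy => (h.2 x hx y hy).trans ?_⟩
    gcongr
  | succ k ih => exact ⟨fun x hx => (h.1 x hx).trans hAB, h.2.1, ih h.2.2⟩

theorem CkBound.congr (hΩ : IsOpen Ω) (h : CkBound k Ω A f) {f' : E2 → F} (hf : EqOn f f' Ω) :
    CkBound k Ω A f' := by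
  induction k generalizing F with
  | zero =>
    refine ⟨fun x hx => by rw [← hf hx]; exact h.1 x hx, fun x hx y hy => ?_⟩
    rw [← hf hx, ← hf hy]; exact h.2 x hx y hy
  | succ k ih =>
    refine ⟨fun x hx => by rw [← hf hx]; exact h.1 x hx, h.2.1.congr hf.symm, ih h.2.2 ?_⟩
    intro x hx
    exact Filter.EventuallyEq.fderiv_eq (hf.eventuallyEq_of_mem (hΩ.mem_nhds hx))

theorem CkBound.nonneg (h : CkBound k Ω A f) (hne : Ω.Nonempty) : 0 ≤ A := by
  obtain ⟨x, hx⟩ := hne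
  exact (norm_nonneg _).trans (h.norm_le hx)

/-- Lowering the order costs one factor `L`. -/
theorem CkBound.of_succ (hΩ : Quasiconvex L Ω) (h : CkBound (k + 1) Ω A f) :
    CkBound k Ω (L * A) f := by
  rcases Ω.eq_empty_or_nonempty with rfl | hne
  · clear hΩ
    induction k generalizing F with
    | zero => exact ⟨by simp, by simp⟩
    | succ k ih => exact ⟨by simp, h.2.1, ih h.2.2⟩
  have hA : A ≤ L * A := by nlinarith [h.nonneg hne, hΩ.one_le]
  induction k generalizing F with
  | zero =>
    exact ⟨fun x hx => (h.1 x hx).trans hA, fun x hx y hy =>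
      hΩ.norm_sub_le h.2.1 (fun z hz => h.2.2.1 z hz) hx hy⟩
  | succ k ih => exact ⟨fun x hx => (h.1 x hx).trans hA, h.2.1, ih h.2.2⟩

theorem CkBound.to_zero (hΩ : Quasiconvex L Ω) (h : CkBound k Ω A f) :
    CkBound 0 Ω (L ^ k * A) f := by
  induction k generalizing A with
  | zero => simpa using h
  | succ k ih => rw [pow_succ, mul_assoc]; exact ih (h.of_succ hΩ)

theorem CkBound.lipschitzOnWith (hΩ : Quasiconvex L Ω) (h : CkBound k Ω A f) :
    ∃ K : ℝ≥0, LipschitzOnWith K f Ω := by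
  refine ⟨(L ^ k * A).toNNReal, LipschitzOnWith.of_dist_le_mul fun x hx y hy => ?_⟩
  rw [dist_eq_norm, dist_eq_norm]
  refine ((h.to_zero hΩ).2 x hx y hy).trans ?_
  gcongr
  exact Real.le_coe_toNNReal _

theorem CkBound.continuousOn (hΩ : Quasiconvex L Ω) (h : CkBound k Ω A f) : ContinuousOn f Ω :=
  (h.lipschitzOnWith hΩ).choose_spec.continuousOn

theorem CkBound.add (hΩ : IsOpen Ω) {f g : E2 → F} (hf : CkBound k Ω A f)
    (hg : CkBound k Ω B g) : CkBound k Ω (A + B) (fun x => f x + g x) := by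
  induction k generalizing F with
  | zero =>
    refine ⟨fun x hx => (norm_add_le _ _).trans (add_le_add (hf.1 x hx) (hg.1 x hx)),
      fun x hx y hy => ?_⟩
    rw [add_sub_add_comm, add_mul]
    exact (norm_add_le _ _).trans (add_le_add (hf.2 x hx y hy) (hg.2 x hx y hy))
  | succ k ih =>
    refine ⟨fun x hx => (norm_add_le _ _).trans (add_le_add (hf.1 x hx) (hg.1 x hx)),
      hf.2.1.add hg.2.1, (ih hf.2.2 hg.2.2).congr hΩ fun x hx => ?_⟩
    exact (fderiv_fun_add (hf.2.1.differentiableAt (hΩ.mem_nhds hx))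
      (hg.2.1.differentiableAt (hΩ.mem_nhds hx))).symm

theorem CkBound.clm (hΩ : IsOpen Ω) (T : F →L[ℝ] G) (hA : 0 ≤ A) (hf : CkBound k Ω A f) :
    CkBound k Ω (‖T‖ * A) (fun x => T (f x)) := by
  induction k generalizing F G with
  | zero =>
    refine ⟨fun x hx => (T.le_opNorm _).trans (by gcongr; exact hf.1 x hx), fun x hx y hy => ?_⟩
    rw [← map_sub, mul_assoc]
    exact (T.le_opNorm _).trans (by gcongr; exact hf.2 x hx y hy)
  | succ k ih =>
    refine ⟨fun x hx => (T.le_opNorm _).trans (by gcongr; exact hf.1 x hx),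
      T.differentiable.comp_differentiableOn hf.2.1, ?_⟩
    refine ((ih ((ContinuousLinearMap.compL ℝ E2 F G) T) hf.2.2).congr hΩ fun x hx => ?_).mono ?_
    · exact ((T.hasFDerivAt.comp x
        (hf.2.1.differentiableAt (hΩ.mem_nhds hx)).hasFDerivAt).fderiv).symm
    · gcongr
      exact ContinuousLinearMap.opNorm_le_bound _ (norm_nonneg _)
        fun S => by simpa using T.opNorm_comp_le S

theorem ckBound_const (hΩ : IsOpen Ω) (c : F) : CkBound k Ω ‖c‖ (fun _ => c) := by
  induction k generalizing F with
  | zero => exact ⟨fun x _ => le_rfl, fun x _ y _ => by simp; positivity⟩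
  | succ k ih =>
    refine ⟨fun x _ => le_rfl, differentiableOn_const c, ?_⟩
    have := (ih (0 : E2 →L[ℝ] F)).mono (B := ‖c‖) (by simp)
    refine this.congr hΩ fun x _ => ?_
    simp

theorem norm_bilin_le_of_one_le {c : ℝ} (T : F →L[ℝ] G →L[ℝ] H) (hc : 1 ≤ c) (hA : 0 ≤ A)
    (hB : 0 ≤ B) {v : F} {w : G} (hv : ‖v‖ ≤ A) (hw : ‖w‖ ≤ B) :
    ‖T v w‖ ≤ c * ‖T‖ * A * B := by
  calc ‖T v w‖ ≤ ‖T‖ * ‖v‖ * ‖w‖ := T.le_opNorm₂ v w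
    _ ≤ 1 * (‖T‖ * A * B) := by rw [one_mul]; gcongr
    _ ≤ c * (‖T‖ * A * B) := by gcongr
    _ = _ := by ring

/-- Products: the estimate for a continuous bilinear map. -/
theorem CkBound.bilin (hΩ : Quasiconvex L Ω) (T : F →L[ℝ] G →L[ℝ] H) (hA : 0 ≤ A) (hB : 0 ≤ B)
    (hf : CkBound k Ω A f) (hg : CkBound k Ω B g) :
    CkBound k Ω (2 * (2 * L) ^ k * ‖T‖ * A * B) (fun x => T (f x) (g x)) := by
  have hL := hΩ.one_le
  have hc : ∀ j : ℕ, 1 ≤ 2 * (2 * L) ^ j := fun j => by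
    have : 1 ≤ (2 * L) ^ j := one_le_pow₀ (by linarith)
    linarith
  induction k generalizing F G H A B with
  | zero =>
    refine ⟨fun x hx => norm_bilin_le_of_one_le T (hc 0) hA hB (hf.norm_le hx) (hg.norm_le hx),
      fun x hx y hy => ?_⟩
    have : T (f x) (g x) - T (f y) (g y) = T (f x - f y) (g x) + T (f y) (g x - g y) := by
      simp
    rw [this]
    calc _ ≤ ‖T (f x - f y) (g x)‖ + ‖T (f y) (g x - g y)‖ := norm_add_le _ _
      _ ≤ ‖T‖ * ‖f x - f y‖ * ‖g x‖ + ‖T‖ * ‖f y‖ * ‖g x - g y‖ :=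
        add_le_add (T.le_opNorm₂ _ _) (T.le_opNorm₂ _ _)
      _ ≤ ‖T‖ * (A * ‖x - y‖) * B + ‖T‖ * A * (B * ‖x - y‖) := by
        gcongr
        · exact hf.2 x hx y hy
        · exact hg.1 x hx
        · exact hf.1 y hy
        · exact hg.2 x hx y hy
      _ = _ := by ring
  | succ k ih =>
    have hd : ∀ x ∈ Ω, HasFDerivAt (fun x => T (f x) (g x))
        (T.precompR E2 (f x) (fderiv ℝ g x) + T.precompL E2 (fderiv ℝ f x) (g x)) x :=
      fun x hx => T.hasFDerivAt_of_bilinear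
        (hf.2.1.differentiableAt (hΩ.isOpen.mem_nhds hx)).hasFDerivAt
        (hg.2.1.differentiableAt (hΩ.isOpen.mem_nhds hx)).hasFDerivAt
    refine ⟨fun x hx => norm_bilin_le_of_one_le T (hc _) hA hB (hf.norm_le hx) (hg.norm_le hx),
      fun x hx => (hd x hx).differentiableAt.differentiableWithinAt, ?_⟩
    have h1 := ih (T.precompR E2) (by positivity : 0 ≤ L * A) hB (hf.of_succ hΩ) hg.2.2
    have h2 := ih (T.precompL E2) hA (by positivity : 0 ≤ L * B) hf.2.2 (hg.of_succ hΩ)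
    refine ((h1.add hΩ.isOpen h2).congr hΩ.isOpen fun x hx => (hd x hx).fderiv.symm).mono ?_
    have h3 := T.norm_precompR_le E2
    have h4 := T.norm_precompL_le E2
    calc _ ≤ 2 * (2 * L) ^ k * ‖T‖ * (L * A) * B + 2 * (2 * L) ^ k * ‖T‖ * A * (L * B) := by
          gcongr
      _ = _ := by rw [pow_succ]; ring

end Bounds

end DevelopableShell

namespace DevelopableShell

section Families

variable {F G H : Type} [NormedAddCommGroup F] [NormedSpace ℝ F] [NormedAddCommGroup G]
  [NormedSpace ℝ G] [NormedAddCommGroup H] [NormedSpace ℝ H] {ι : Type}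

/-- A family of functions whose `C^{k,1}` bounds on `Ω` are a common multiple of given weights `N`.
Fixed functions are families with weight `1`, and weights multiply under products, so the calculus
of families keeps track of estimates that are linear in the data. -/
def CkFamily (k : ℕ) (Ω : Set E2) (N : ι → ℝ) (f : ι → E2 → F) : Prop :=
  (∀ i, 0 ≤ N i) ∧ ∃ C, 0 ≤ C ∧ ∀ i, CkBound k Ω (C * N i) (f i)

variable {Ω : Set E2} {L A : ℝ} {k j : ℕ} {N M : ι → ℝ} {f : ι → E2 → F} {g : ι → E2 → G}

theorem CkBound.family {f : E2 → F} (hA : 0 ≤ A) (hf : CkBound k Ω A f) :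
    CkFamily k Ω (fun _ : ι => 1) (fun _ => f) :=
  ⟨fun _ => zero_le_one, A, hA, fun _ => by simpa using hf⟩

theorem CkFamily.congr (hΩ : IsOpen Ω) (hf : CkFamily k Ω N f) {f' : ι → E2 → F}
    (h : ∀ i, EqOn (f i) (f' i) Ω) : CkFamily k Ω N f' :=
  ⟨hf.1, hf.2.imp fun _ hC => ⟨hC.1, fun i => (hC.2 i).congr hΩ (h i)⟩⟩

theorem CkFamily.weight_congr (hf : CkFamily k Ω N f) (h : ∀ i, N i = M i) : CkFamily k Ω M f := by
  rwa [funext h] at hf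

theorem CkFamily.of_le (hΩ : Quasiconvex L Ω) (hf : CkFamily k Ω N f) (hjk : j ≤ k) :
    CkFamily j Ω N f := by
  induction k with
  | zero => rwa [Nat.le_zero.1 hjk]
  | succ k ih =>
    rcases Nat.le_succ_iff.1 hjk with h | rfl
    · obtain ⟨hN, C, hC, hb⟩ := hf
      refine ih ⟨hN, L * C, mul_nonneg (zero_le_one.trans hΩ.one_le) hC, fun i => ?_⟩ h
      rw [mul_assoc]
      exact (hb i).of_succ hΩ
    · exact hf

theorem CkFamily.fderiv (hf : CkFamily (k + 1) Ω N f) :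
    CkFamily k Ω N (fun i => fderiv ℝ (f i)) :=
  ⟨hf.1, hf.2.imp fun _ hC => ⟨hC.1, fun i => (hC.2 i).2.2⟩⟩

theorem CkFamily.differentiableAt (hΩ : IsOpen Ω) (hf : CkFamily (k + 1) Ω N f) (i : ι) {x : E2}
    (hx : x ∈ Ω) : DifferentiableAt ℝ (f i) x :=
  ((hf.2.choose_spec.2 i).2.1).differentiableAt (hΩ.mem_nhds hx)

theorem CkFamily.continuousOn (hΩ : Quasiconvex L Ω) (hf : CkFamily k Ω N f) (i : ι) :
    ContinuousOn (f i) Ω :=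
  (hf.2.choose_spec.2 i).continuousOn hΩ

theorem CkFamily.lipschitzOnWith (hΩ : Quasiconvex L Ω) (hf : CkFamily k Ω N f) (i : ι) :
    ∃ K : ℝ≥0, LipschitzOnWith K (f i) Ω :=
  (hf.2.choose_spec.2 i).lipschitzOnWith hΩ

/-- To raise the order by one it suffices to bound the function and to control its derivative. -/
theorem CkFamily.succ (hΩ : IsOpen Ω) {f' : ι → E2 → E2 →L[ℝ] F}
    (hd : ∀ i, ∀ x ∈ Ω, HasFDerivAt (f i) (f' i x) x) (hf' : CkFamily k Ω N f') {C : ℝ}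
    (hC : ∀ i, ∀ x ∈ Ω, ‖f i x‖ ≤ C * N i) : CkFamily (k + 1) Ω N f := by
  obtain ⟨hN, C', hC', hb⟩ := hf'
  refine ⟨hN, max C C', hC'.trans (le_max_right _ _), fun i => ⟨fun x hx => ?_, fun x hx =>
    (hd i x hx).differentiableAt.differentiableWithinAt, ?_⟩⟩
  · exact (hC i x hx).trans (mul_le_mul_of_nonneg_right (le_max_left _ _) (hN i))
  · refine ((hb i).mono ?_).congr hΩ fun x hx => (hd i x hx).fderiv.symm
    exact mul_le_mul_of_nonneg_right (le_max_right _ _) (hN i)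

theorem CkFamily.add (hΩ : IsOpen Ω) {f g : ι → E2 → F} (hf : CkFamily k Ω N f)
    (hg : CkFamily k Ω N g) : CkFamily k Ω N (fun i x => f i x + g i x) := by
  obtain ⟨hN, C, hC, hb⟩ := hf
  obtain ⟨-, C', hC', hb'⟩ := hg
  refine ⟨hN, C + C', add_nonneg hC hC', fun i => ?_⟩
  rw [add_mul]
  exact (hb i).add hΩ (hb' i)

theorem CkFamily.clm (hΩ : IsOpen Ω) (T : F →L[ℝ] G) (hf : CkFamily k Ω N f) :
    CkFamily k Ω N (fun i x => T (f i x)) := by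
  obtain ⟨hN, C, hC, hb⟩ := hf
  refine ⟨hN, ‖T‖ * C, by positivity, fun i => ?_⟩
  rw [mul_assoc]
  exact (hb i).clm hΩ T (mul_nonneg hC (hN i))

theorem CkFamily.bilin (hΩ : Quasiconvex L Ω) (T : F →L[ℝ] G →L[ℝ] H) (hf : CkFamily k Ω N f)
    (hg : CkFamily k Ω M g) : CkFamily k Ω (fun i => N i * M i) (fun i x => T (f i x) (g i x)) := by
  obtain ⟨hN, C, hC, hb⟩ := hf
  obtain ⟨hM, C', hC', hb'⟩ := hg
  have hL := hΩ.one_le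
  refine ⟨fun i => mul_nonneg (hN i) (hM i), 2 * (2 * L) ^ k * ‖T‖ * C * C', by positivity,
    fun i => ?_⟩
  refine ((hb i).bilin hΩ T (mul_nonneg hC (hN i)) (mul_nonneg hC' (hM i)) (hb' i)).mono ?_
  exact le_of_eq (by ring)

theorem CkFamily.neg (hΩ : IsOpen Ω) (hf : CkFamily k Ω N f) :
    CkFamily k Ω N (fun i x => -f i x) := by
  simpa using hf.clm hΩ (-ContinuousLinearMap.id ℝ F)

theorem CkFamily.sub (hΩ : IsOpen Ω) {f g : ι → E2 → F} (hf : CkFamily k Ω N f)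
    (hg : CkFamily k Ω N g) : CkFamily k Ω N (fun i x => f i x - g i x) := by
  simpa [sub_eq_add_neg] using hf.add hΩ (hg.neg hΩ)

theorem CkFamily.const_smul (hΩ : IsOpen Ω) (c : ℝ) (hf : CkFamily k Ω N f) :
    CkFamily k Ω N (fun i x => c • f i x) := by
  simpa using hf.clm hΩ (c • ContinuousLinearMap.id ℝ F)

theorem CkFamily.smul (hΩ : Quasiconvex L Ω) {c : ι → E2 → ℝ} (hc : CkFamily k Ω N c)
    (hf : CkFamily k Ω M f) : CkFamily k Ω (fun i => N i * M i) (fun i x => c i x • f i x) :=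
  hc.bilin hΩ (ContinuousLinearMap.lsmul ℝ ℝ) hf

theorem CkFamily.mul (hΩ : Quasiconvex L Ω) {c d : ι → E2 → ℝ} (hc : CkFamily k Ω N c)
    (hd : CkFamily k Ω M d) : CkFamily k Ω (fun i => N i * M i) (fun i x => c i x * d i x) :=
  hc.smul hΩ hd

theorem CkFamily.inner {F : Type} [NormedAddCommGroup F] [InnerProductSpace ℝ F]
    {f g : ι → E2 → F} (hΩ : Quasiconvex L Ω) (hf : CkFamily k Ω N f)
    (hg : CkFamily k Ω M g) :
    CkFamily k Ω (fun i => N i * M i) (fun i x => inner ℝ (f i x) (g i x)) :=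
  hf.bilin hΩ (innerSL ℝ) hg

/-- Multiplication by a fixed function does not change the weights. -/
theorem CkFamily.fixed_mul (hΩ : Quasiconvex L Ω) {c d : ι → E2 → ℝ}
    (hc : CkFamily k Ω (fun _ => 1) c) (hd : CkFamily k Ω N d) :
    CkFamily k Ω N (fun i x => c i x * d i x) :=
  (hc.mul hΩ hd).weight_congr fun _ => one_mul _

/-- Composition with a fixed self-map of `Ω`. -/
theorem CkFamily.comp (hΩ : Quasiconvex L Ω) {π : E2 → E2} (hπ : MapsTo π Ω Ω)
    (hπk : CkFamily k Ω (fun _ : ι => 1) (fun _ => π)) (hf : CkFamily k Ω N f) :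
    CkFamily k Ω N (fun i x => f i (π x)) := by
  induction k generalizing F with
  | zero =>
    obtain ⟨hN, C, hC, hb⟩ := hf
    obtain ⟨-, C', hC', hb'⟩ := hπk
    refine ⟨hN, C + C * C', by positivity, fun i => ⟨fun x hx => ?_, fun x hx y hy => ?_⟩⟩
    · refine ((hb i).1 _ (hπ hx)).trans (mul_le_mul_of_nonneg_right ?_ (hN i))
      linarith [mul_nonneg hC hC']
    · have h1 := (hb i).2 _ (hπ hx) _ (hπ hy)
      have h2 := (hb' i).2 _ hx _ hy
      have h3 : 0 ≤ C * N i := mul_nonneg hC (hN i)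
      calc _ ≤ C * N i * ‖π x - π y‖ := h1
        _ ≤ C * N i * (C' * 1 * ‖x - y‖) := by gcongr
        _ ≤ _ := by nlinarith [mul_nonneg h3 (norm_nonneg (x - y))]
  | succ k ih =>
    have h1 := ih (hπk.of_le hΩ k.le_succ) hf.fderiv
    have h2 := (h1.bilin hΩ (ContinuousLinearMap.compL ℝ E2 E2 F) hπk.fderiv).weight_congr
      (M := N) (by simp)
    obtain ⟨C, hC, hb⟩ := hf.2
    exact h2.succ hΩ.isOpen (fun i x hx =>
      (hf.differentiableAt hΩ.isOpen i (hπ hx)).hasFDerivAt.comp x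
        (hπk.differentiableAt hΩ.isOpen i hx).hasFDerivAt) (fun i x hx => (hb i).1 _ (hπ hx))

/-- Reciprocals of a fixed function that is bounded away from zero. -/
theorem CkFamily.inv (hΩ : Quasiconvex L Ω) {c : ℝ} (hc : 0 < c) {q : E2 → ℝ}
    (hq : ∀ x ∈ Ω, c ≤ |q x|) (hqk : CkFamily k Ω (fun _ : ι => 1) (fun _ => q)) :
    CkFamily k Ω (fun _ : ι => 1) (fun _ x => (q x)⁻¹) := by
  have hne : ∀ x ∈ Ω, q x ≠ 0 := fun x hx => abs_pos.1 (hc.trans_le (hq x hx))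
  have hsup : ∀ x ∈ Ω, ‖(q x)⁻¹‖ ≤ c⁻¹ := fun x hx => by
    rw [norm_inv]
    exact inv_anti₀ hc (hq x hx)
  induction k with
  | zero =>
    obtain ⟨hN, C, hC, hb⟩ := hqk
    refine ⟨hN, c⁻¹ + c⁻¹ * C * c⁻¹, by positivity, fun i => ⟨fun x hx => ?_, fun x hx y hy => ?_⟩⟩
    · refine (hsup x hx).trans ?_
      have : 0 ≤ c⁻¹ * C * c⁻¹ := by positivity
      linarith
    · have h1 : (q x)⁻¹ - (q y)⁻¹ = (q x)⁻¹ * (q y - q x) * (q y)⁻¹ := by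
        have := hne x hx
        have := hne y hy
        field_simp
      have h2 := (hb i).2 x hx y hy
      rw [h1, norm_mul, norm_mul, norm_sub_rev]
      calc _ ≤ c⁻¹ * (C * 1 * ‖x - y‖) * c⁻¹ := by
            gcongr
            · exact hsup x hx
            · exact hsup y hy
        _ ≤ _ := by nlinarith [mul_nonneg (inv_nonneg.2 hc.le) (norm_nonneg (x - y))]
  | succ k ih =>
    have h1 := ih (hqk.of_le hΩ k.le_succ)
    have h2 := (((h1.mul hΩ h1).neg hΩ.isOpen).smul hΩ hqk.fderiv).weight_congr
      (M := fun _ => 1) (by simp)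
    refine h2.succ hΩ.isOpen (C := c⁻¹) (fun i x hx => ?_) (fun i x hx => by simpa using hsup x hx)
    have h3 := (hasDerivAt_inv (hne x hx)).comp_hasFDerivAt x
      (hqk.differentiableAt hΩ.isOpen i hx).hasFDerivAt
    exact h3.congr_fderiv (by rw [sq, mul_inv])

end Families

end DevelopableShell

/-! ### Means along the segments of a retraction -/

namespace DevelopableShell

section Rays

variable {F G : Type} [NormedAddCommGroup F] [NormedSpace ℝ F] {ι : Type}

/-- The point at parameter `l` on the segment from `π x` to `x`. -/
def ray (π : E2 → E2) (l : ℝ) (x : E2) : E2 := π x + l • (x - π x)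

/-- The weighted mean of `h` over the segment from `π x` to `x`. -/
noncomputable def rayMean (π : E2 → E2) (w : ℝ → ℝ) (h : E2 → F) (x : E2) : F :=
  ∫ l in (0 : ℝ)..1, w l • h (ray π l x)

variable {Ω : Set E2} {L : ℝ} {k : ℕ} {N : ι → ℝ} {f : ι → E2 → F} {π : E2 → E2}
  {w : ℝ → ℝ} {h : E2 → F}

theorem continuous_ray (π : E2 → E2) (x : E2) : Continuous fun l => ray π l x := by
  unfold ray; fun_prop

theorem continuousOn_rayMean_integrand (hray : ∀ x ∈ Ω, ∀ l ∈ Icc (0 : ℝ) 1, ray π l x ∈ Ω)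
    (hw : Continuous w) (hh : ContinuousOn h Ω) {x : E2} (hx : x ∈ Ω) :
    ContinuousOn (fun l => w l • h (ray π l x)) (Icc 0 1) :=
  hw.continuousOn.smul (hh.comp (continuous_ray π x).continuousOn fun l hl => hray x hx l hl)

theorem intervalIntegrable_rayMean (hray : ∀ x ∈ Ω, ∀ l ∈ Icc (0 : ℝ) 1, ray π l x ∈ Ω)
    (hw : Continuous w) (hh : ContinuousOn h Ω) {x : E2} (hx : x ∈ Ω) :
    IntervalIntegrable (fun l => w l • h (ray π l x)) volume 0 1 :=
  (continuousOn_rayMean_integrand hray hw hh hx).intervalIntegrable_of_Icc zero_le_one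

theorem norm_rayMean_le (hray : ∀ x ∈ Ω, ∀ l ∈ Icc (0 : ℝ) 1, ray π l x ∈ Ω) {W C : ℝ}
    (hW : ∀ l ∈ Icc (0 : ℝ) 1, ‖w l‖ ≤ W) (hC : ∀ x ∈ Ω, ‖h x‖ ≤ C) {x : E2} (hx : x ∈ Ω) :
    ‖rayMean π w h x‖ ≤ W * C := by
  have hW0 : 0 ≤ W := (norm_nonneg _).trans (hW 0 (by simp))
  have := intervalIntegral.norm_integral_le_of_norm_le_const (a := (0 : ℝ)) (b := 1) (C := W * C)
    (f := fun l => w l • h (ray π l x)) fun l hl => by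
      rw [uIoc_of_le zero_le_one] at hl
      have hl' : l ∈ Icc (0 : ℝ) 1 := ⟨hl.1.le, hl.2⟩
      rw [norm_smul]
      gcongr
      · exact hW l hl'
      · exact hC _ (hray x hx l hl')
  simpa [rayMean] using this

/-- The derivative of a ray mean is made of ray means of the derivative. -/
theorem hasFDerivAt_rayMean [CompleteSpace F] (hΩ : IsOpen Ω)
    (hray : ∀ x ∈ Ω, ∀ l ∈ Icc (0 : ℝ) 1, ray π l x ∈ Ω) (hw : Continuous w)
    (hd : DifferentiableOn ℝ h Ω) (hdc : ContinuousOn (fderiv ℝ h) Ω) {C C' : ℝ}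
    (hC : ∀ x ∈ Ω, ‖fderiv ℝ h x‖ ≤ C) (hπ : DifferentiableOn ℝ π Ω)
    (hC' : ∀ x ∈ Ω, ‖fderiv ℝ π x‖ ≤ C') {x : E2} (hx : x ∈ Ω) :
    HasFDerivAt (rayMean π w h)
      ((rayMean π (fun l => w l * (1 - l)) (fderiv ℝ h) x).comp (fderiv ℝ π x) +
        rayMean π (fun l => w l * l) (fderiv ℝ h) x) x := by
  obtain ⟨W, hW⟩ := (isCompact_Icc (a := (0 : ℝ)) (b := 1)).exists_bound_of_continuousOn
    hw.continuousOn
  have hπd : ∀ y ∈ Ω, HasFDerivAt π (fderiv ℝ π y) y := fun y hy =>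
    (hπ.differentiableAt (hΩ.mem_nhds hy)).hasFDerivAt
  have hrd : ∀ l : ℝ, ∀ y ∈ Ω, HasFDerivAt (ray π l)
      (fderiv ℝ π y + l • (ContinuousLinearMap.id ℝ E2 - fderiv ℝ π y)) y := fun l y hy =>
    (hπd y hy).add (((hasFDerivAt_id y).sub (hπd y hy)).const_smul l)
  have key := intervalIntegral.hasFDerivAt_integral_of_dominated_of_fderiv_le (𝕜 := ℝ)
    (μ := volume) (a := 0) (b := 1) (F := fun y l => w l • h (ray π l y)) (x₀ := x) (s := Ω)
    (F' := fun y l => w l • (fderiv ℝ h (ray π l y)).comp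
      (fderiv ℝ π y + l • (ContinuousLinearMap.id ℝ E2 - fderiv ℝ π y)))
    (bound := fun _ => W * (C * (C' + 1 * (1 + C')))) (hΩ.mem_nhds hx) ?_ ?_ ?_ ?_ ?_ ?_
  · refine key.congr_fderiv ?_
    have hi1 := intervalIntegrable_rayMean (w := fun l => w l * (1 - l)) hray (by fun_prop) hdc hx
    have hi2 := intervalIntegrable_rayMean (w := fun l => w l * l) hray (by fun_prop) hdc hx
    let T : (E2 →L[ℝ] F) →L[ℝ] (E2 →L[ℝ] F) :=
      (ContinuousLinearMap.compL ℝ E2 E2 F).flip (fderiv ℝ π x)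
    have h1 : (rayMean π (fun l => w l * (1 - l)) (fderiv ℝ h) x).comp (fderiv ℝ π x) =
        ∫ l in (0 : ℝ)..1, T ((w l * (1 - l)) • fderiv ℝ h (ray π l x)) :=
      (T.intervalIntegral_comp_comm hi1).symm
    rw [h1, rayMean, ← intervalIntegral.integral_add _ hi2]
    · refine intervalIntegral.integral_congr fun l _ => ?_
      ext v
      simp only [T, ContinuousLinearMap.flip_apply, ContinuousLinearMap.compL_apply,
        smul_apply, ContinuousLinearMap.comp_apply,
        add_apply, sub_apply, map_add, map_smul,
        ContinuousLinearMap.id_apply, map_sub]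
      module
    · exact ((T.continuous.comp_continuousOn
        (continuousOn_rayMean_integrand (w := fun l => w l * (1 - l)) hray (by fun_prop)
        hdc hx))).intervalIntegrable_of_Icc zero_le_one
  · filter_upwards [hΩ.mem_nhds hx] with y hy
    rw [uIoc_of_le zero_le_one]
    exact (intervalIntegrable_rayMean hray hw hd.continuousOn hy).1.aestronglyMeasurable
  · exact intervalIntegrable_rayMean hray hw hd.continuousOn hx
  · refine ContinuousOn.aestronglyMeasurable ?_ measurableSet_uIoc
    rw [uIoc_of_le zero_le_one]
    refine ContinuousOn.mono ?_ Ioc_subset_Icc_self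
    refine hw.continuousOn.smul (ContinuousOn.clm_comp ?_ (by fun_prop))
    exact hdc.comp (continuous_ray π x).continuousOn fun l hl => hray x hx l hl
  · refine Filter.Eventually.of_forall fun l hl y hy => ?_
    rw [uIoc_of_le zero_le_one] at hl
    have hl' : l ∈ Icc (0 : ℝ) 1 := ⟨hl.1.le, hl.2⟩
    have hW0 : 0 ≤ W := (norm_nonneg _).trans (hW l hl')
    have hC0 : 0 ≤ C := (norm_nonneg _).trans (hC _ hx)
    rw [norm_smul]
    gcongr
    · exact hW l hl'
    · refine (ContinuousLinearMap.opNorm_comp_le _ _).trans ?_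
      gcongr
      · exact hC _ (hray y hy l hl')
      · refine (norm_add_le _ _).trans ?_
        rw [norm_smul]
        gcongr
        · exact hC' y hy
        · rw [Real.norm_eq_abs, abs_le]
          constructor <;> linarith [hl'.1, hl'.2]
        · refine (norm_sub_le _ _).trans ?_
          gcongr
          · exact ContinuousLinearMap.norm_id_le
          · exact hC' y hy
  · exact intervalIntegrable_const
  · refine Filter.Eventually.of_forall fun l hl y hy => ?_
    rw [uIoc_of_le zero_le_one] at hl
    have hl' : l ∈ Icc (0 : ℝ) 1 := ⟨hl.1.le, hl.2⟩
    exact ((hd.differentiableAt (hΩ.mem_nhds (hray y hy l hl'))).hasFDerivAt.comp y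
      (hrd l y hy)).const_smul (w l)

/-- Ray means inherit `C^{k,1}` estimates: only the regularity of the foot point map enters. -/
theorem CkFamily.mean_along_rays [CompleteSpace F] (hΩ : Quasiconvex L Ω)
    (hray : ∀ x ∈ Ω, ∀ l ∈ Icc (0 : ℝ) 1, ray π l x ∈ Ω)
    (hπ : CkFamily k Ω (fun _ : ι => 1) (fun _ => π)) (hw : Continuous w)
    (hf : CkFamily k Ω N f) : CkFamily k Ω N (fun i => rayMean π w (f i)) := by
  obtain ⟨hN, C, hC, hb⟩ := hf
  induction k generalizing F w C with
  | zero =>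
    obtain ⟨W, hW⟩ := (isCompact_Icc (a := (0 : ℝ)) (b := 1)).exists_bound_of_continuousOn
      hw.continuousOn
    have hW0 : 0 ≤ W := (norm_nonneg _).trans (hW 0 (by simp))
    obtain ⟨-, B, hB, hbπ⟩ := hπ
    refine ⟨hN, W * C * (B + 1), by positivity, fun i => ⟨fun x hx => ?_, fun x hx y hy => ?_⟩⟩
    · refine (norm_rayMean_le hray hW (hb i).1 hx).trans ?_
      have : 0 ≤ W * (C * N i) := mul_nonneg hW0 (mul_nonneg hC (hN i))
      nlinarith [mul_nonneg this hB]
    · have hi := fun {z : E2} (hz : z ∈ Ω) =>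
        intervalIntegrable_rayMean hray hw ((hb i).continuousOn hΩ) hz
      change ‖rayMean π w (f i) x - rayMean π w (f i) y‖ ≤ _
      rw [rayMean, rayMean, ← intervalIntegral.integral_sub (hi hx) (hi hy)]
      have := intervalIntegral.norm_integral_le_of_norm_le_const (a := (0 : ℝ)) (b := 1)
        (C := W * (C * N i * ((B + 1) * ‖x - y‖)))
        (f := fun l => w l • f i (ray π l x) - w l • f i (ray π l y)) fun l hl => by
          rw [uIoc_of_le zero_le_one] at hl
          have hl' : l ∈ Icc (0 : ℝ) 1 := ⟨hl.1.le, hl.2⟩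
          have hCN := mul_nonneg hC (hN i)
          rw [← smul_sub, norm_smul]
          gcongr
          · exact hW l hl'
          · refine ((hb i).2 _ (hray x hx l hl') _ (hray y hy l hl')).trans ?_
            gcongr
            have h1 : ray π l x - ray π l y = (1 - l) • (π x - π y) + l • (x - y) := by
              unfold ray; module
            have h2 := (hbπ i).2 x hx y hy
            have h3 : 0 ≤ B * 1 * ‖x - y‖ := by positivity
            rw [h1]
            refine (norm_add_le _ _).trans ?_
            rw [norm_smul, norm_smul, Real.norm_of_nonneg hl'.1,
              Real.norm_of_nonneg (sub_nonneg.2 hl'.2)]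
            have h4 : (1 - l) * ‖π x - π y‖ ≤ 1 * ‖π x - π y‖ := by
              gcongr; linarith [hl'.1]
            have h5 : l * ‖x - y‖ ≤ 1 * ‖x - y‖ := by gcongr; exact hl'.2
            linarith
      refine this.trans (le_of_eq ?_)
      rw [sub_zero, abs_one]
      ring
  | succ k ih =>
    have hd : CkFamily (k + 1) Ω N f := ⟨hN, C, hC, hb⟩
    have h1 := ih (hπ.of_le hΩ k.le_succ) (w := fun l => w l * (1 - l)) (by fun_prop) C hC
      fun i => (hb i).2.2
    have h2 := ih (hπ.of_le hΩ k.le_succ) (w := fun l => w l * l) (by fun_prop) C hC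
      fun i => (hb i).2.2
    have h3 := ((h1.bilin hΩ (ContinuousLinearMap.compL ℝ E2 E2 F) hπ.fderiv).weight_congr
      (M := N) (by simp)).add hΩ.isOpen h2
    obtain ⟨W, hW⟩ := (isCompact_Icc (a := (0 : ℝ)) (b := 1)).exists_bound_of_continuousOn
      hw.continuousOn
    obtain ⟨-, B, hB, hbπ⟩ := hπ
    exact h3.succ hΩ.isOpen (C := W * C) (fun i x hx => hasFDerivAt_rayMean hΩ.isOpen hray hw
      (hb i).2.1 (hd.fderiv.continuousOn hΩ i) (fun y hy => (hb i).2.2.norm_le hy) (hbπ i).2.1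
      (fun y hy => (hbπ i).2.2.norm_le hy) hx) (fun i x hx => by
        rw [mul_assoc]; exact norm_rayMean_le hray hW (hb i).1 hx)

end Rays

end DevelopableShell

/-! ### Lipschitz domains are quasiconvex -/

namespace DevelopableShell

section LipschitzDomain

variable {Ω : Set E2}

theorem norm_sub_le_of_segment_subset (hΩ : IsOpen Ω) {g : E2 → ℝ} (hg : DifferentiableOn ℝ g Ω)
    (hg1 : ∀ x ∈ Ω, ‖fderiv ℝ g x‖ ≤ 1) {a b : E2} (hab : segment ℝ a b ⊆ Ω) :
    ‖g a - g b‖ ≤ ‖a - b‖ := by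
  have := (convex_segment a b).norm_image_sub_le_of_norm_fderiv_le (f := g) (𝕜 := ℝ) (C := 1)
    (fun x hx => hg.differentiableAt (hΩ.mem_nhds (hab hx))) (fun x hx => hg1 x (hab hx))
    (right_mem_segment ℝ a b) (left_mem_segment ℝ a b)
  simpa using this

/-- Near a boundary point, a pair of points is joined inside the domain by going up by a multiple of
their distance, across, and down. -/
theorem IsLipschitzDomain.local_lipschitz (hΩ : IsLipschitzDomain Ω) {p : E2}
    (hp : p ∈ closure Ω) : ∃ ρ > 0, ∃ C : ℝ, 0 ≤ C ∧ ∀ g : E2 → ℝ, DifferentiableOn ℝ g Ω →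
      (∀ x ∈ Ω, ‖fderiv ℝ g x‖ ≤ 1) → ∀ x ∈ Ω ∩ Metric.ball p ρ, ∀ y ∈ Ω ∩ Metric.ball p ρ,
        ‖g x - g y‖ ≤ C * ‖x - y‖ := by
  by_cases hpΩ : p ∈ Ω
  · obtain ⟨ρ, hρ, hb⟩ := Metric.isOpen_iff.1 hΩ.isOpen p hpΩ
    refine ⟨ρ, hρ, 1, zero_le_one, fun g hg hg1 x hx y hy => ?_⟩
    rw [one_mul]
    exact norm_sub_le_of_segment_subset hΩ.isOpen hg hg1
      (((convex_ball p ρ).segment_subset hx.2 hy.2).trans hb)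
  · have hfr : p ∈ frontier Ω := ⟨hp, fun h => hpΩ (interior_subset h)⟩
    obtain ⟨R, γ, K, hγ, hev⟩ := hΩ.boundary p hfr
    obtain ⟨r, hr, hb⟩ := Metric.eventually_nhds_iff_ball.1 hev
    have hK := K.coe_nonneg
    refine ⟨r / (2 * K + 2), by positivity, 2 * K + 1, by positivity,
      fun g hg hg1 x hx y hy => ?_⟩
    set ρ := r / (2 * K + 2) with hρ
    have hρr : (2 * K + 2) * ρ = r := by rw [hρ]; field_simp
    have hρ0 : 0 < ρ := by positivity
    set h : ℝ := K * ‖x - y‖ with hh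
    have hh0 : 0 ≤ h := by positivity
    set v : E2 := R.symm (e 1) with hv
    have hv1 : ‖v‖ = 1 := by simp [hv, e]
    have hR0 : ∀ (z : E2) (τ : ℝ), R (z + τ • v) 0 = R z 0 := fun z τ => by
      simp [hv, e]
    have hR1 : ∀ (z : E2) (τ : ℝ), R (z + τ • v) 1 = R z 1 + τ := fun z τ => by
      simp [hv, e]
    have hxy : ‖x - y‖ ≤ 2 * ρ := by
      have h1 := mem_ball_iff_norm.1 hx.2
      have h2 := mem_ball_iff_norm.1 hy.2
      have : x - y = (x - p) - (y - p) := by abel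
      rw [this]
      linarith [norm_sub_le (x - p) (y - p)]
    have hhρ : h ≤ 2 * K * ρ := by rw [hh]; nlinarith
    -- raised points stay in the ball where `Ω` is the region above the graph
    have hball : ∀ z ∈ Metric.ball p ρ, ∀ τ ∈ Icc 0 h, z + τ • v ∈ Metric.ball p r := by
      intro z hz τ hτ
      rw [mem_ball_iff_norm] at hz ⊢
      have h1 : z + τ • v - p = (z - p) + τ • v := by abel
      rw [h1]
      refine (norm_add_le _ _).trans_lt ?_
      rw [norm_smul, hv1, Real.norm_of_nonneg hτ.1]
      linarith [hτ.2]
    have hup : ∀ z ∈ Ω ∩ Metric.ball p ρ, segment ℝ z (z + h • v) ⊆ Ω := by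
      intro z hz
      rw [segment_eq_image']
      rintro _ ⟨θ, hθ, rfl⟩
      have h1 : z + θ • (z + h • v - z) = z + (θ * h) • v := by module
      have hθh : θ * h ∈ Icc 0 h := ⟨mul_nonneg hθ.1 hh0, mul_le_of_le_one_left hh0 hθ.2⟩
      have hz' : z ∈ Metric.ball p r := by simpa using hball z hz.2 0 ⟨le_rfl, hh0⟩
      have h2 := (hb z hz').1 hz.1
      simp only [h1]
      rw [hb _ (hball z hz.2 _ hθh), hR0, hR1]
      linarith [hθh.1]
    have hacross : segment ℝ (x + h • v) (y + h • v) ⊆ Ω := by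
      rw [segment_eq_image']
      rintro _ ⟨θ, hθ, rfl⟩
      set z : E2 := x + θ • (y - x) with hz
      have h1 : x + h • v + θ • (y + h • v - (x + h • v)) = z + h • v := by rw [hz]; module
      have hzb : z ∈ Metric.ball p ρ := by
        refine (convex_ball p ρ).segment_subset hx.2 hy.2 ?_
        rw [segment_eq_image']
        exact ⟨θ, hθ, rfl⟩
      simp only [h1]
      rw [hb _ (hball z hzb h ⟨hh0, le_rfl⟩), hR0, hR1]
      have hx' : x ∈ Metric.ball p r := by simpa using hball x hx.2 0 ⟨le_rfl, hh0⟩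
      have hy' : y ∈ Metric.ball p r := by simpa using hball y hy.2 0 ⟨le_rfl, hh0⟩
      have hgx := (hb x hx').1 hx.1
      have hgy := (hb y hy').1 hy.1
      have hz0 : R z 0 = R x 0 + θ * (R y 0 - R x 0) := by simp [hz]
      have hz1 : R z 1 = R x 1 + θ * (R y 1 - R x 1) := by simp [hz]
      have hd : |R x 0 - R y 0| ≤ ‖x - y‖ := by
        have := PiLp.norm_apply_le (R (x - y)) 0
        rw [R.norm_map] at this
        simpa using this
      have e1 := hγ.dist_le_mul (R z 0) (R x 0)
      have e2 := hγ.dist_le_mul (R z 0) (R y 0)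
      rw [Real.dist_eq, Real.dist_eq] at e1 e2
      have f1 : |R z 0 - R x 0| = θ * |R x 0 - R y 0| := by
        rw [hz0, add_sub_cancel_left, abs_mul, abs_of_nonneg hθ.1, abs_sub_comm]
      have f2 : |R z 0 - R y 0| = (1 - θ) * |R x 0 - R y 0| := by
        have : R z 0 - R y 0 = (1 - θ) * (R x 0 - R y 0) := by rw [hz0]; ring
        rw [this, abs_mul, abs_of_nonneg (sub_nonneg.2 hθ.2)]
      rw [f1] at e1
      rw [f2] at e2
      have g1 := (le_abs_self _).trans e1
      have g2 := (le_abs_self _).trans e2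
      have hKd : K * |R x 0 - R y 0| ≤ h := by rw [hh]; gcongr
      have hKd0 : 0 ≤ K * |R x 0 - R y 0| := by positivity
      have hθ' := sub_nonneg.2 hθ.2
      rw [hz1]
      have m1 := mul_le_mul_of_nonneg_left g1 hθ'
      have m2 := mul_le_mul_of_nonneg_left g2 hθ.1
      have m3 : 2 * (θ * (1 - θ)) ≤ 1 := by nlinarith [sq_nonneg (1 - 2 * θ)]
      have m4 := mul_le_mul_of_nonneg_right m3 hKd0
      rcases hθ.1.eq_or_lt with h0 | h0
      · rw [← h0] at m1 ⊢
        nlinarith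
      · nlinarith [mul_pos h0 (sub_pos.2 hgy), mul_nonneg hθ' (sub_pos.2 hgx).le]
    have k1 := norm_sub_le_of_segment_subset hΩ.isOpen hg hg1 (hup x hx)
    have k2 := norm_sub_le_of_segment_subset hΩ.isOpen hg hg1 (hup y hy)
    have k3 := norm_sub_le_of_segment_subset hΩ.isOpen hg hg1 hacross
    have l1 : ∀ z : E2, ‖z - (z + h • v)‖ = h := fun z => by
      rw [sub_add_cancel_left, norm_neg, norm_smul, hv1, mul_one, Real.norm_of_nonneg hh0]
    rw [l1] at k1 k2
    rw [add_sub_add_right_eq_sub] at k3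
    have : g x - g y = (g x - g (x + h • v)) + (g (x + h • v) - g (y + h • v)) -
      (g y - g (y + h • v)) := by ring
    rw [this]
    calc _ ≤ ‖g x - g (x + h • v)‖ + ‖g (x + h • v) - g (y + h • v)‖ +
          ‖g y - g (y + h • v)‖ := (norm_sub_le _ _).trans (by gcongr; exact norm_add_le _ _)
      _ ≤ h + ‖x - y‖ + h := by gcongr
      _ = _ := by rw [hh]; ring

/-- A bounded Lipschitz domain is quasiconvex: locally by its boundary charts, globally by
compactness of the closure and connectedness. -/
theorem IsLipschitzDomain.quasiconvex (hΩ : IsLipschitzDomain Ω) : ∃ L, Quasiconvex L Ω := by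
  choose! ρ hρ C hC hloc using fun p (hp : p ∈ closure Ω) => hΩ.local_lipschitz hp
  have hcomp : IsCompact (closure Ω) := hΩ.isBounded.isCompact_closure
  obtain ⟨t, ht, hcov⟩ := hcomp.elim_nhds_subcover (fun p => Metric.ball p (ρ p))
    fun p hp => Metric.ball_mem_nhds p (hρ p hp)
  obtain ⟨δ, hδ, hleb⟩ := lebesgue_number_lemma_of_metric (ι := t) hcomp
    (c := fun p => Metric.ball (p : E2) (ρ p)) (fun _ => Metric.isOpen_ball)
    (hcov.trans (by
      intro x hx
      simp only [mem_iUnion] at hx ⊢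
      obtain ⟨p, hp, hxp⟩ := hx
      exact ⟨⟨p, hp⟩, hxp⟩))
  obtain ⟨x₀, hx₀⟩ := hΩ.isConnected.nonempty
  -- oscillations from a base point are bounded uniformly in the test function
  let S : Set E2 := {x | x ∈ Ω ∧ ∃ D : ℝ, ∀ g : E2 → ℝ, DifferentiableOn ℝ g Ω →
    (∀ x ∈ Ω, ‖fderiv ℝ g x‖ ≤ 1) → ‖g x - g x₀‖ ≤ D}
  have hstep : ∀ x ∈ Ω, ∀ r > 0, Metric.ball x r ⊆ Ω → ∀ y ∈ Metric.ball x r, ∀ z ∈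
      Metric.ball x r, z ∈ S → y ∈ S := by
    rintro x hx r hr hb y hy z hz ⟨hzΩ, D, hD⟩
    refine ⟨hb hy, D + ‖y - z‖, fun g hg hg1 => ?_⟩
    have h1 := norm_sub_le_of_segment_subset hΩ.isOpen hg hg1
      (((convex_ball x r).segment_subset hy hz).trans hb)
    have h2 := hD g hg hg1
    have : g y - g x₀ = (g y - g z) + (g z - g x₀) := by ring
    rw [this]
    exact (norm_add_le _ _).trans (by linarith)
  have hS : Ω ⊆ S := by
    refine hΩ.isConnected.isPreconnected.subset_of_closure_inter_subset ?_
      ⟨x₀, hx₀, hx₀, 0, fun g _ _ => by simp⟩ ?_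
    · rw [Metric.isOpen_iff]
      intro x hx
      obtain ⟨r, hr, hb⟩ := Metric.isOpen_iff.1 hΩ.isOpen x hx.1
      exact ⟨r, hr, fun y hy => hstep x hx.1 r hr hb y hy x (Metric.mem_ball_self hr) hx⟩
    · rintro x ⟨hxc, hx⟩
      obtain ⟨r, hr, hb⟩ := Metric.isOpen_iff.1 hΩ.isOpen x hx
      obtain ⟨z, hz, hzb⟩ := Metric.mem_closure_iff.1 hxc r hr
      exact hstep x hx r hr hb x (Metric.mem_ball_self hr) z
        (by rwa [Metric.mem_ball, dist_comm]) hz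
  have hball : ∀ p ∈ t, ∃ D : ℝ, 0 ≤ D ∧ ∀ g : E2 → ℝ, DifferentiableOn ℝ g Ω →
      (∀ x ∈ Ω, ‖fderiv ℝ g x‖ ≤ 1) → ∀ x ∈ Ω ∩ Metric.ball p (ρ p), ‖g x - g x₀‖ ≤ D := by
    intro p hp
    rcases (Ω ∩ Metric.ball p (ρ p)).eq_empty_or_nonempty with h | ⟨z, hz⟩
    · exact ⟨0, le_rfl, fun g _ _ x hx => by rw [h] at hx; exact hx.elim⟩
    · obtain ⟨-, D, hD⟩ := hS hz.1
      have hCp := hC p (ht p hp)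
      have hρp := hρ p (ht p hp)
      refine ⟨max 0 (C p * (2 * ρ p) + D), le_max_left _ _, fun g hg hg1 x hx => ?_⟩
      refine le_trans ?_ (le_max_right _ _)
      have h1 := hloc p (ht p hp) g hg hg1 x hx z hz
      have h2 := hD g hg hg1
      have h3 : ‖x - z‖ ≤ 2 * ρ p := by
        have h1 := mem_ball_iff_norm.1 hx.2
        have h2 := mem_ball_iff_norm.1 hz.2
        have : x - z = (x - p) - (z - p) := by abel
        rw [this]
        linarith [norm_sub_le (x - p) (z - p)]
      have : g x - g x₀ = (g x - g z) + (g z - g x₀) := by ring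
      rw [this]
      refine (norm_add_le _ _).trans (add_le_add (h1.trans ?_) h2)
      gcongr
  choose! D hD0 hD using hball
  set D' := ∑ p ∈ t, D p with hD'
  set C' := ∑ p ∈ t, C p with hC'
  have hD'0 : 0 ≤ D' := Finset.sum_nonneg hD0
  have hC'0 : 0 ≤ C' := Finset.sum_nonneg fun p hp => hC p (ht p hp)
  have hbase : ∀ g : E2 → ℝ, DifferentiableOn ℝ g Ω → (∀ x ∈ Ω, ‖fderiv ℝ g x‖ ≤ 1) →
      ∀ x ∈ Ω, ‖g x - g x₀‖ ≤ D' := by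
    intro g hg hg1 x hx
    have hx' := hcov (subset_closure hx)
    simp only [mem_iUnion] at hx'
    obtain ⟨p, hp, hxp⟩ := hx'
    exact (hD p hp g hg hg1 x ⟨hx, hxp⟩).trans (Finset.single_le_sum hD0 hp)
  have hone : ∀ g : E2 → ℝ, DifferentiableOn ℝ g Ω → (∀ x ∈ Ω, ‖fderiv ℝ g x‖ ≤ 1) →
      ∀ x ∈ Ω, ∀ y ∈ Ω, ‖g x - g y‖ ≤ (1 + C' + 2 * D' / δ) * ‖x - y‖ := by
    intro g hg hg1 x hx y hy
    by_cases hxy : dist y x < δ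
    · obtain ⟨⟨p, hp⟩, hsub⟩ := hleb x (subset_closure hx)
      have h1 := hloc p (ht p hp) g hg hg1 x ⟨hx, hsub (Metric.mem_ball_self hδ)⟩ y
        ⟨hy, hsub hxy⟩
      refine h1.trans ?_
      gcongr
      have h2 : C p ≤ C' := Finset.single_le_sum (f := C) (fun p hp => hC p (ht p hp)) hp
      have h3 : 0 ≤ 2 * D' / δ := by positivity
      linarith
    · have h1 := hbase g hg hg1 x hx
      have h2 := hbase g hg hg1 y hy
      have h3 : g x - g y = (g x - g x₀) - (g y - g x₀) := by ring
      have h4 : δ ≤ ‖x - y‖ := by rw [← dist_eq_norm, dist_comm]; exact not_lt.1 hxy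
      calc ‖g x - g y‖ ≤ 2 * D' := by rw [h3]; linarith [norm_sub_le (g x - g x₀) (g y - g x₀)]
        _ = 2 * D' / δ * δ := by field_simp
        _ ≤ 2 * D' / δ * ‖x - y‖ := by gcongr
        _ ≤ _ := by gcongr; linarith
  refine ⟨1 + C' + 2 * D' / δ, hΩ.isOpen, ?_, fun g A hg hA x hx y hy => ?_⟩
  · have : 0 ≤ 2 * D' / δ := by positivity
    linarith
  · have hA0 : 0 ≤ A := (norm_nonneg _).trans (hA x hx)
    refine le_of_forall_pos_le_add fun ε hε => ?_
    set L := 1 + C' + 2 * D' / δ with hL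
    have hL0 : 0 ≤ L := by positivity
    -- a slightly larger bound is positive, so that it can be divided out
    set η := ε / (L * ‖x - y‖ + 1) with hη
    have hη0 : 0 < η := by positivity
    have hd : ∀ z ∈ Ω, HasFDerivAt (fun z => (A + η)⁻¹ * g z) ((A + η)⁻¹ • fderiv ℝ g z) z :=
      fun z hz => (hg.differentiableAt (hΩ.isOpen.mem_nhds hz)).hasFDerivAt.const_mul _
    have h1 := hone (fun z => (A + η)⁻¹ * g z)
      (fun z hz => (hd z hz).differentiableAt.differentiableWithinAt) (fun z hz => by
        rw [(hd z hz).fderiv, norm_smul, norm_inv, Real.norm_of_nonneg (by positivity),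
          inv_mul_le_one₀ (by positivity)]
        linarith [hA z hz]) x hx y hy
    rw [← mul_sub, norm_mul, norm_inv, Real.norm_of_nonneg (by positivity : 0 ≤ A + η),
      inv_mul_le_iff₀ (by positivity)] at h1
    have h2 : η * (L * ‖x - y‖) ≤ ε := by
      rw [hη, div_mul_eq_mul_div, div_le_iff₀ (by positivity)]
      nlinarith
    linarith [h1]

end LipschitzDomain

end DevelopableShell

/-! ### Comparison with the `C^{k,1}` norm, and functions with mean zero -/

namespace DevelopableShell

section Norms

variable {F : Type} [NormedAddCommGroup F] [NormedSpace ℝ F] {Ω : Set E2} {k : ℕ} {f : E2 → F}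
  {A : ℝ}

theorem edist_iteratedFDeriv_succ (k : ℕ) (f : E2 → F) (x y : E2) :
    edist (iteratedFDeriv ℝ (k + 1) f x) (iteratedFDeriv ℝ (k + 1) f y) =
      edist (iteratedFDeriv ℝ k (fderiv ℝ f) x) (iteratedFDeriv ℝ k (fderiv ℝ f) y) := by
  have h : ∀ z, iteratedFDeriv ℝ (k + 1) f z =
      (continuousMultilinearCurryRightEquiv' ℝ k E2 F).symm
        (iteratedFDeriv ℝ k (fderiv ℝ f) z) := fun z => by
    rw [iteratedFDeriv_succ_eq_comp_right]
    rfl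
  rw [h, h]
  exact LinearIsometryEquiv.edist_map _ _ _

theorem ckNorm_succ (k : ℕ) (Ω : Set E2) (f : E2 → F) :
    ckNorm (k + 1) Ω f = (⨆ x ∈ Ω, ‖f x‖ₑ) + ckNorm k Ω (fderiv ℝ f) := by
  have h : ∀ (j : ℕ) (x : E2), ‖iteratedFDeriv ℝ (j + 1) f x‖ₑ =
      ‖iteratedFDeriv ℝ j (fderiv ℝ f) x‖ₑ := fun j x => by
    rw [← ofReal_norm, ← ofReal_norm, norm_iteratedFDeriv_fderiv]
  have h0 : ∀ x : E2, ‖iteratedFDeriv ℝ 0 f x‖ₑ = ‖f x‖ₑ := fun x => by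
    rw [← ofReal_norm, ← ofReal_norm, norm_iteratedFDeriv_zero]
  simp only [ckNorm, edist_iteratedFDeriv_succ]
  rw [Finset.sum_range_succ' _ (k + 1)]
  simp only [h, h0]
  rw [add_comm (∑ j ∈ Finset.range (k + 1), _), add_assoc]

theorem ckNorm_zero (Ω : Set E2) (f : E2 → F) :
    ckNorm 0 Ω f = (⨆ x ∈ Ω, ‖f x‖ₑ) +
      ⨆ x ∈ Ω, ⨆ y ∈ Ω, edist (f x) (f y) / edist x y := by
  have h0 : ∀ x : E2, ‖iteratedFDeriv ℝ 0 f x‖ₑ = ‖f x‖ₑ := fun x => by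
    rw [← ofReal_norm, ← ofReal_norm, norm_iteratedFDeriv_zero]
  have h1 : ∀ x y : E2, edist (iteratedFDeriv ℝ 0 f x) (iteratedFDeriv ℝ 0 f y) =
      edist (f x) (f y) := fun x y => by
    rw [iteratedFDeriv_zero_eq_comp]
    exact (continuousMultilinearCurryFin0 ℝ E2 F).symm.edist_map _ _
  simp only [ckNorm, h1, zero_add, Finset.range_one, Finset.sum_singleton, h0]

/-- The recursive bound controls each of the `k + 2` terms of the norm. -/
theorem CkBound.ckNorm_le (hA : 0 ≤ A) (h : CkBound k Ω A f) :
    ckNorm k Ω f ≤ (k + 2 : ℕ) * ENNReal.ofReal A := by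
  have hsup : ∀ {F : Type} [NormedAddCommGroup F] [NormedSpace ℝ F] {f : E2 → F},
      (∀ x ∈ Ω, ‖f x‖ ≤ A) → ⨆ x ∈ Ω, ‖f x‖ₑ ≤ ENNReal.ofReal A := by
    intro F _ _ f h
    refine iSup₂_le fun x hx => ?_
    rw [← ofReal_norm]
    exact ENNReal.ofReal_le_ofReal (h x hx)
  induction k generalizing F with
  | zero =>
    rw [ckNorm_zero]
    have : ((0 + 2 : ℕ) : ℝ≥0∞) * ENNReal.ofReal A = ENNReal.ofReal A + ENNReal.ofReal A := by
      push_cast; ring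
    rw [this]
    refine add_le_add (hsup h.1) (iSup₂_le fun x hx => iSup₂_le fun y hy => ?_)
    refine ENNReal.div_le_of_le_mul ?_
    rw [edist_dist, edist_dist, ← ENNReal.ofReal_mul hA, dist_eq_norm, dist_eq_norm]
    exact ENNReal.ofReal_le_ofReal (h.2 x hx y hy)
  | succ k ih =>
    rw [ckNorm_succ]
    have : ((k + 1 + 2 : ℕ) : ℝ≥0∞) * ENNReal.ofReal A =
        ENNReal.ofReal A + ((k + 2 : ℕ) : ℝ≥0∞) * ENNReal.ofReal A := by
      push_cast; ring
    rw [this]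
    exact add_le_add (hsup h.1) (ih h.2.2)

theorem CkBound.contDiffOn (hΩ : IsOpen Ω) (hA : 0 ≤ A) (h : CkBound k Ω A f) :
    ContDiffOn ℝ k f Ω := by
  induction k generalizing F with
  | zero =>
    rw [Nat.cast_zero, contDiffOn_zero]
    refine LipschitzOnWith.continuousOn (K := A.toNNReal)
      (LipschitzOnWith.of_dist_le_mul fun x hx y hy => ?_)
    rw [dist_eq_norm, dist_eq_norm, Real.coe_toNNReal A hA]
    exact h.2 x hx y hy
  | succ k ih =>
    rw [Nat.cast_succ, contDiffOn_succ_iff_fderiv_of_isOpen hΩ]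
    exact ⟨h.2.1, by simp, ih h.2.2⟩

theorem CkBound.memCk (hΩ : IsOpen Ω) (hA : 0 ≤ A) (h : CkBound k Ω A f) : MemCk k Ω f :=
  ⟨h.contDiffOn hΩ hA, (h.ckNorm_le hA).trans_lt
    (ENNReal.mul_lt_top (ENNReal.natCast_lt_top _) ENNReal.ofReal_lt_top)⟩

/-- A function of class `C^{k,1}` satisfies the recursive bounds with its norm as the constant. -/
theorem MemCk.ckBound (hΩ : IsOpen Ω) (h : MemCk k Ω f) :
    CkBound k Ω (ckNorm k Ω f).toReal f := by
  suffices H : ∀ A : ℝ≥0∞, A < ⊤ → ContDiffOn ℝ k f Ω → ckNorm k Ω f ≤ A →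
      CkBound k Ω A.toReal f from H _ h.2 h.1 le_rfl
  intro A hA hf hle
  clear h
  have hsup : ∀ {F : Type} [NormedAddCommGroup F] [NormedSpace ℝ F] {f : E2 → F},
      ⨆ x ∈ Ω, ‖f x‖ₑ ≤ A → ∀ x ∈ Ω, ‖f x‖ ≤ A.toReal := by
    intro F _ _ f h x hx
    have := (le_iSup₂ (f := fun x (_ : x ∈ Ω) => ‖f x‖ₑ) x hx).trans h
    rw [← ofReal_norm] at this
    exact (ENNReal.ofReal_le_iff_le_toReal hA.ne).1 this
  induction k generalizing F with
  | zero =>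
    rw [ckNorm_zero] at hle
    refine ⟨hsup (le_self_add.trans hle), fun x hx y hy => ?_⟩
    rcases eq_or_ne x y with rfl | hxy
    · simp
    have h1 : edist (f x) (f y) / edist x y ≤ A :=
      ((le_iSup₂ (f := fun y (_ : y ∈ Ω) => edist (f x) (f y) / edist x y) y hy).trans
        (le_iSup₂ (f := fun x (_ : x ∈ Ω) => ⨆ y ∈ Ω, edist (f x) (f y) / edist x y) x hx)).trans
        (le_add_self.trans hle)
    have h2 : edist (f x) (f y) ≤ A * edist x y :=
      (ENNReal.div_le_iff (edist_pos.2 hxy).ne' (edist_ne_top _ _)).1 h1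
    have h3 := ENNReal.toReal_mono (ENNReal.mul_ne_top hA.ne (edist_ne_top _ _)) h2
    rw [ENNReal.toReal_mul, ← dist_edist, ← dist_edist, dist_eq_norm, dist_eq_norm] at h3
    exact h3
  | succ k ih =>
    rw [ckNorm_succ] at hle
    rw [Nat.cast_succ, contDiffOn_succ_iff_fderiv_of_isOpen hΩ] at hf
    exact ⟨hsup (le_self_add.trans hle), hf.1, ih hf.2.2 (le_add_self.trans hle)⟩

end Norms

section MeanZero

variable {F : Type} [NormedAddCommGroup F] [NormedSpace ℝ F] {Ω : Set E2} {L A R : ℝ}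

/-- A function with mean zero on a bounded quasiconvex domain is bounded by its derivative. -/
theorem Quasiconvex.norm_le_of_integral_eq_zero (hΩ : Quasiconvex L Ω) (hne : Ω.Nonempty)
    (hR : ∀ x ∈ Ω, ∀ y ∈ Ω, ‖x - y‖ ≤ R) (hfin : volume Ω ≠ ⊤) {g : E2 → ℝ}
    (hd : DifferentiableOn ℝ g Ω) (hA : ∀ x ∈ Ω, ‖fderiv ℝ g x‖ ≤ A)
    (hint : ∫ x in Ω, g x = 0) : ∀ x ∈ Ω, ‖g x‖ ≤ L * A * R := by
  intro x hx
  have hA0 : 0 ≤ A := (norm_nonneg _).trans (hA x hx)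
  have hosc : ∀ y ∈ Ω, ‖g x - g y‖ ≤ L * A * R := fun y hy =>
    (hΩ.norm_sub_le hd hA hx hy).trans (by
      have := hΩ.one_le
      gcongr
      exact hR x hx y hy)
  have hpos : 0 < (volume Ω).toReal :=
    ENNReal.toReal_pos (hΩ.isOpen.measure_pos volume hne).ne' hfin
  have hi : IntegrableOn g Ω := by
    refine IntegrableOn.of_bound hfin.lt_top
      (hd.continuousOn.aestronglyMeasurable hΩ.isOpen.measurableSet) (‖g x‖ + L * A * R) ?_
    refine (ae_restrict_iff' hΩ.isOpen.measurableSet).2 (Filter.Eventually.of_forall fun y hy => ?_)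
    have : g y = g x - (g x - g y) := by ring
    rw [this]
    exact (_root_.norm_sub_le _ _).trans (by gcongr; exact hosc y hy)
  have hsub : ∫ y in Ω, (g x - g y) = (volume Ω).toReal * g x := by
    rw [integral_sub (integrableOn_const hfin).integrable hi, hint, sub_zero, setIntegral_const,
      smul_eq_mul, Measure.real]
  have hle := norm_setIntegral_le_of_norm_le_const (μ := volume) (s := Ω) (f := fun y => g x - g y)
    (C := L * A * R) hfin.lt_top hosc
  rw [hsub, norm_mul, Real.norm_of_nonneg hpos.le, Measure.real, mul_comm] at hle
  exact le_of_mul_le_mul_right hle hpos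

end MeanZero

end DevelopableShell

/-! ### Primitives of Lipschitz one-forms that are closed almost everywhere -/

noncomputable section

namespace DevelopableShell

section Mollification

open scoped Convolution
open ContinuousLinearMap (lsmul)

variable {F : Type} [NormedAddCommGroup F] [NormedSpace ℝ F]

theorem hasFDerivAt_mollify {ρ : E2 → ℝ} (hρ : ContDiff ℝ 1 ρ) (hc : HasCompactSupport ρ)
    {g : E2 → F} (hg : LocallyIntegrable g) (x : E2) :
    HasFDerivAt (ρ ⋆[lsmul ℝ ℝ] g) (fderiv ℝ (ρ ⋆[lsmul ℝ ℝ] g) x) x ∧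
    ∀ v, fderiv ℝ (ρ ⋆[lsmul ℝ ℝ] g) x v = ∫ y, fderiv ℝ ρ (x - y) v • g y := by
  have h := hc.hasFDerivAt_convolution_left (lsmul ℝ ℝ : ℝ →L[ℝ] F →L[ℝ] F) hρ hg x
  refine ⟨h.differentiableAt.hasFDerivAt, fun v => ?_⟩
  rw [h.fderiv]
  have hex : ConvolutionExistsAt (fderiv ℝ ρ) g x ((lsmul ℝ ℝ : ℝ →L[ℝ] F →L[ℝ] F).precompL E2) :=
    (hc.fderiv (𝕜 := ℝ)).convolutionExists_left _ (hρ.continuous_fderiv one_ne_zero) hg x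
  rw [convolution, ContinuousLinearMap.integral_apply hex,
    ← integral_sub_left_eq_self (fun y => fderiv ℝ ρ (x - y) v • g y) volume x]
  refine integral_congr_ae (Filter.Eventually.of_forall fun y => ?_)
  simp

/-- The reflected and translated mollifier `y ↦ ρ (x - y)` as a test function. -/
theorem testFunction_of_bump (ρ : ContDiffBump (0 : E2)) (x : E2) :
    ContDiff ℝ (⊤ : ℕ∞) (fun y => ρ.normed volume (x - y)) ∧
    HasCompactSupport (fun y => ρ.normed volume (x - y)) ∧
    tsupport (fun y => ρ.normed volume (x - y)) ⊆ Metric.closedBall x ρ.rOut ∧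
    ∀ y v, fderiv ℝ (fun y => ρ.normed volume (x - y)) y v =
      -fderiv ℝ (ρ.normed volume) (x - y) v := by
  have hs : tsupport (fun y => ρ.normed volume (x - y)) ⊆ Metric.closedBall x ρ.rOut := by
    refine closure_minimal (fun y hy => ?_) Metric.isClosed_closedBall
    have : x - y ∈ tsupport (ρ.normed volume) := subset_tsupport _ hy
    rw [ρ.tsupport_normed_eq, mem_closedBall_zero_iff] at this
    rwa [mem_closedBall_iff_norm, norm_sub_rev]
  refine ⟨ρ.contDiff_normed.comp (contDiff_const.sub contDiff_id),
    HasCompactSupport.of_support_subset_isCompact (isCompact_closedBall x ρ.rOut)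
      ((subset_tsupport _).trans hs), hs, fun y v => ?_⟩
  have h1 : HasFDerivAt (fun y : E2 => x - y) (-ContinuousLinearMap.id ℝ E2) y :=
    (hasFDerivAt_id y).const_sub x
  have h2 : HasFDerivAt (ρ.normed volume) (fderiv ℝ (ρ.normed volume) (x - y)) (x - y) :=
    ((ρ.contDiff_normed (n := 1)).differentiable one_ne_zero _).hasFDerivAt
  have h3 := h2.comp y h1
  have h4 : fderiv ℝ (fun y => ρ.normed volume (x - y)) y = _ := h3.fderiv
  rw [h4]
  simp

/-- A sequence of bump functions at the origin with supports in the ball of radius `ε`, shrinking to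
the origin. -/
def bumpSeq (E : Type) [NormedAddCommGroup E] (ε : ℝ) (hε : 0 < ε) (n : ℕ) :
    ContDiffBump (0 : E) where
  rIn := ε / (n + 2) / 2
  rOut := ε / (n + 2)
  rIn_pos := by positivity
  rIn_lt_rOut := half_lt_self (by positivity)

theorem bumpSeq_rOut_lt {E : Type} [NormedAddCommGroup E] {ε : ℝ} (hε : 0 < ε) (n : ℕ) :
    (bumpSeq E ε hε n).rOut < ε := by
  refine div_lt_self hε ?_
  have : (0 : ℝ) ≤ n := n.cast_nonneg
  linarith

theorem tendsto_bumpSeq_rOut {E : Type} [NormedAddCommGroup E] {ε : ℝ} (hε : 0 < ε) :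
    Filter.Tendsto (fun n => (bumpSeq E ε hε n).rOut) Filter.atTop (𝓝 0) := by
  have : Filter.Tendsto (fun n : ℕ => (n : ℝ) + 2) Filter.atTop Filter.atTop :=
    Filter.tendsto_atTop_add_const_right _ _ tendsto_natCast_atTop_atTop
  exact this.const_div_atTop ε

/-- Mollification moves a Lipschitz function by at most its constant times the radius. -/
theorem norm_mollify_sub_le [CompleteSpace F] {K : ℝ≥0} {g : E2 → F} (hg : LipschitzWith K g)
    (ρ : ContDiffBump (0 : E2)) (x : E2) :
    ‖(ρ.normed volume ⋆[lsmul ℝ ℝ] g) x - g x‖ ≤ K * ρ.rOut := by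
  rw [← dist_eq_norm]
  refine ContDiffBump.dist_normed_convolution_le hg.continuous.aestronglyMeasurable fun y hy => ?_
  refine (hg.dist_le_mul y x).trans ?_
  gcongr
  exact (Metric.mem_ball.1 hy).le

end Mollification

section Primitive

open scoped Convolution
open ContinuousLinearMap (lsmul)

/-- The coordinate forms on the plane. -/
def dx (i : Fin 2) : E2 →L[ℝ] ℝ := EuclideanSpace.proj i

@[simp] theorem dx_apply (i : Fin 2) (v : E2) : dx i v = v i := rfl

/-- The covector with components `p`, `q`. -/
def covec (p q : ℝ) : E2 →L[ℝ] ℝ := p • dx 0 + q • dx 1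

@[simp] theorem covec_apply (p q : ℝ) (v : E2) : covec p q v = p * v 0 + q * v 1 := by
  simp [covec]

theorem norm_dx_le (i : Fin 2) : ‖dx i‖ ≤ 1 :=
  (dx i).opNorm_le_bound zero_le_one fun v => by simpa using PiLp.norm_apply_le v i

theorem norm_covec_le (p q : ℝ) : ‖covec p q‖ ≤ |p| + |q| := by
  refine (norm_add_le _ _).trans ?_
  rw [norm_smul, norm_smul]
  gcongr
  · exact mul_le_of_le_one_right (abs_nonneg p) (norm_dx_le 0)
  · exact mul_le_of_le_one_right (abs_nonneg q) (norm_dx_le 1)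

theorem vec_eq (v : E2) : v = v 0 • e 0 + v 1 • e 1 := by
  ext i
  fin_cases i <;> simp [e]

/-- Integration by parts for a Lipschitz function against a test function. -/
theorem integral_fderiv_mul_of_lipschitzOnWith {Ω : Set E2} (hΩ : IsOpen Ω) {V Vt : E2 → ℝ}
    {K : ℝ≥0} (hVt : LipschitzWith K Vt) (hV : EqOn V Vt Ω) {η : E2 → ℝ}
    (hη : ContDiff ℝ 1 η) (hc : HasCompactSupport η) (hs : tsupport η ⊆ Ω) (v : E2) :
    ∫ x in Ω, fderiv ℝ V x v * η x = -∫ x, fderiv ℝ η x v * Vt x := by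
  obtain ⟨D, hD⟩ := hη.lipschitzWith_of_hasCompactSupport hc one_ne_zero
  have h1 := hVt.integral_lineDeriv_mul_eq (μ := volume) hD hc v
  have h2 : ∫ x, lineDeriv ℝ η x (-v) * Vt x = -∫ x, fderiv ℝ η x v * Vt x := by
    rw [← integral_neg]
    refine integral_congr_ae (Filter.Eventually.of_forall fun x => ?_)
    simp only
    rw [((hη.differentiable one_ne_zero) x).lineDeriv_eq_fderiv, map_neg, neg_mul]
  rw [← h2, ← h1]
  rw [setIntegral_eq_integral_of_forall_compl_eq_zero (s := Ω)]
  · refine integral_congr_ae ?_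
    filter_upwards [hVt.ae_differentiableAt] with x hx
    by_cases hxs : x ∈ Ω
    · have : V =ᶠ[𝓝 x] Vt := hV.eventuallyEq_of_mem (hΩ.mem_nhds hxs)
      rw [this.fderiv_eq, hx.lineDeriv_eq_fderiv]
    · rw [image_eq_zero_of_notMem_tsupport fun h => hxs (hs h), mul_zero, mul_zero]
  · intro x hx
    rw [image_eq_zero_of_notMem_tsupport fun h => hx (hs h), mul_zero]

/-- A Lipschitz one-form which is closed almost everywhere has a primitive on convex sets: its
mollifications are closed, and their primitives converge. -/
theorem exists_primitive_of_convex {Ω U : Set E2} (hΩ : IsOpen Ω) (hU : IsOpen U)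
    (hconv : Convex ℝ U) (hne : U.Nonempty) {ε R : ℝ} (hε : 0 < ε)
    (hball : ∀ x ∈ U, Metric.ball x ε ⊆ Ω) (hR : ∀ x ∈ U, ∀ y ∈ U, ‖x - y‖ ≤ R)
    {V W : E2 → ℝ} {KV KW : ℝ≥0}
    (hV : LipschitzOnWith KV V Ω) (hW : LipschitzOnWith KW W Ω)
    (hcl : ∀ᵐ x ∂(volume.restrict Ω), fderiv ℝ W x (e 0) = fderiv ℝ V x (e 1)) :
    ∃ v : E2 → ℝ, ∀ x ∈ U, HasFDerivAt v (covec (V x) (W x)) x := by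
  obtain ⟨Vt, hVt, hVe⟩ := hV.extend_real
  obtain ⟨Wt, hWt, hWe⟩ := hW.extend_real
  have hUΩ : U ⊆ Ω := fun x hx => hball x hx (Metric.mem_ball_self hε)
  set ρ := bumpSeq E2 ε hε with hρ
  set Vn : ℕ → E2 → ℝ := fun n => (ρ n).normed volume ⋆[lsmul ℝ ℝ] Vt with hVn
  set Wn : ℕ → E2 → ℝ := fun n => (ρ n).normed volume ⋆[lsmul ℝ ℝ] Wt with hWn
  have hVl : LocallyIntegrable Vt := hVt.continuous.locallyIntegrable
  have hWl : LocallyIntegrable Wt := hWt.continuous.locallyIntegrable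
  have hdV := fun n x => hasFDerivAt_mollify ((ρ n).contDiff_normed (μ := volume) (n := 1))
    (ρ n).hasCompactSupport_normed hVl x
  have hdW := fun n x => hasFDerivAt_mollify ((ρ n).contDiff_normed (μ := volume) (n := 1))
    (ρ n).hasCompactSupport_normed hWl x
  have hclosed : ∀ n, ∀ x ∈ U, fderiv ℝ (Wn n) x (e 0) = fderiv ℝ (Vn n) x (e 1) := by
    intro n x hx
    rw [(hdV n x).2, (hdW n x).2]
    obtain ⟨h1, h2, h3, h4⟩ := testFunction_of_bump (ρ n) x
    have h5 : tsupport (fun y => (ρ n).normed volume (x - y)) ⊆ Ω :=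
      h3.trans ((Metric.closedBall_subset_ball (bumpSeq_rOut_lt hε n)).trans (hball x hx))
    have i1 := integral_fderiv_mul_of_lipschitzOnWith hΩ hWt hWe (h1.of_le (by simp)) h2 h5 (e 0)
    have i2 := integral_fderiv_mul_of_lipschitzOnWith hΩ hVt hVe (h1.of_le (by simp)) h2 h5 (e 1)
    have i3 : ∫ y in Ω, fderiv ℝ W y (e 0) * (ρ n).normed volume (x - y) =
        ∫ y in Ω, fderiv ℝ V y (e 1) * (ρ n).normed volume (x - y) := by
      refine integral_congr_ae ?_
      filter_upwards [hcl] with y hy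
      rw [hy]
    rw [i1, i2] at i3
    simp only [h4, neg_mul, integral_neg, neg_neg] at i3
    simpa [smul_eq_mul] using i3
  have hdω : ∀ n x, HasFDerivAt (fun x => covec (Vn n x) (Wn n x))
      ((fderiv ℝ (Vn n) x).smulRight (dx 0) + (fderiv ℝ (Wn n) x).smulRight (dx 1)) x := fun n x =>
    ((hdV n x).1.smul_const (dx 0)).add ((hdW n x).1.smul_const (dx 1))
  have hprim : ∀ n, ∃ f : E2 → ℝ, ∀ x ∈ U, HasFDerivAt f (covec (Vn n x) (Wn n x)) x := by
    intro n
    refine hconv.exists_forall_hasFDerivAt_of_fderiv_symmetric hU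
      (fun x _ => (hdω n x).differentiableAt.differentiableWithinAt) fun x hx a b => ?_
    have hA : ∀ (A : E2 →L[ℝ] ℝ) (v : E2), A v = v 0 * A (e 0) + v 1 * A (e 1) := fun A v => by
      conv_lhs => rw [vec_eq v]
      simp
    rw [(hdω n x).fderiv]
    simp only [add_apply, ContinuousLinearMap.smulRight_apply, smul_apply, dx_apply, smul_eq_mul]
    rw [hA (fderiv ℝ (Vn n) x) a, hA (fderiv ℝ (Vn n) x) b, hA (fderiv ℝ (Wn n) x) a,
      hA (fderiv ℝ (Wn n) x) b, hclosed n x hx]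
    ring
  choose f hf using hprim
  obtain ⟨p, hp⟩ := hne
  have hunif : ∀ n x, ‖covec (Vn n x) (Wn n x) - covec (Vt x) (Wt x)‖ ≤
      (KV + KW) * (ρ n).rOut := by
    intro n x
    have : covec (Vn n x) (Wn n x) - covec (Vt x) (Wt x) =
        covec (Vn n x - Vt x) (Wn n x - Wt x) := by
      simp only [covec]; module
    rw [this, add_mul]
    exact (norm_covec_le _ _).trans (add_le_add (norm_mollify_sub_le hVt (ρ n) x)
      (norm_mollify_sub_le hWt (ρ n) x))
  have hsmall : Filter.Tendsto (fun n => (KV + KW : ℝ) * (ρ n).rOut) Filter.atTop (𝓝 0) := by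
    simpa using (tendsto_bumpSeq_rOut hε).const_mul (KV + KW : ℝ)
  have hU' : TendstoUniformlyOn (fun n x => covec (Vn n x) (Wn n x))
      (fun x => covec (Vt x) (Wt x)) Filter.atTop U := by
    rw [Metric.tendstoUniformlyOn_iff]
    intro δ hδ
    filter_upwards [hsmall.eventually (gt_mem_nhds hδ)] with n hn x _
    rw [dist_comm, dist_eq_norm]
    exact (hunif n x).trans_lt hn
  -- primitives normalized at `p` form a Cauchy sequence at every point
  have hcauchy : ∀ x ∈ U, CauchySeq fun n => f n x - f n p := by
    intro x hx
    rw [Metric.cauchySeq_iff']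
    intro δ hδ
    have hR0 : 0 ≤ R := (norm_nonneg _).trans (hR x hx p hp)
    have h1 : Filter.Tendsto (fun n => (KV + KW : ℝ) * (ρ n).rOut * R) Filter.atTop (𝓝 0) := by
      simpa using hsmall.mul_const R
    obtain ⟨n₀, hn₀⟩ := Filter.eventually_atTop.1 (h1.eventually (gt_mem_nhds (half_pos hδ)))
    refine ⟨n₀, fun n hn => ?_⟩
    have h2 := hconv.norm_image_sub_le_of_norm_hasFDerivWithin_le (f := fun y => f n y - f n₀ y)
      (C := (KV + KW) * (ρ n).rOut + (KV + KW) * (ρ n₀).rOut)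
      (fun y hy => ((hf n y hy).sub (hf n₀ y hy)).hasFDerivWithinAt) (fun y hy => by
        have : covec (Vn n y) (Wn n y) - covec (Vn n₀ y) (Wn n₀ y) =
          (covec (Vn n y) (Wn n y) - covec (Vt y) (Wt y)) -
          (covec (Vn n₀ y) (Wn n₀ y) - covec (Vt y) (Wt y)) := by abel
        rw [this]
        exact (norm_sub_le _ _).trans (add_le_add (hunif n y) (hunif n₀ y))) hp hx
    rw [dist_eq_norm]
    have h3 : f n x - f n p - (f n₀ x - f n₀ p) = f n x - f n₀ x - (f n p - f n₀ p) := by ring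
    rw [h3]
    refine h2.trans_lt ?_
    have h4 := hn₀ n hn
    have h5 := hn₀ n₀ le_rfl
    have h6 : 0 ≤ (KV + KW : ℝ) * (ρ n).rOut + (KV + KW) * (ρ n₀).rOut := by
      have := (ρ n).rOut_pos
      have := (ρ n₀).rOut_pos
      positivity
    calc _ ≤ ((KV + KW : ℝ) * (ρ n).rOut + (KV + KW) * (ρ n₀).rOut) * R := by
          gcongr
          exact hR x hx p hp
      _ < δ := by rw [add_mul]; linarith
  have hlim : ∀ x, ∃ l, x ∈ U → Filter.Tendsto (fun n => f n x - f n p) Filter.atTop (𝓝 l) := by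
    intro x
    by_cases hx : x ∈ U
    · exact (cauchySeq_tendsto_of_complete (hcauchy x hx)).imp fun l hl _ => hl
    · exact ⟨0, fun h => absurd h hx⟩
  choose v hv using hlim
  refine ⟨v, fun x hx => ?_⟩
  have := hasFDerivAt_of_tendstoUniformlyOn hU hU'
    (fun n x hx => (hf n x hx).sub_const (f n p)) (fun x hx => hv x hx) hx
  rwa [← hVe (hUΩ hx), ← hWe (hUΩ hx)] at this

end Primitive

end DevelopableShell

end

noncomputable section

namespace DevelopableShell

section GlobalPrimitive

variable {Ω : Set E2} {π : E2 → E2}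

/-- The integral of a one-form along a segment, in terms of a primitive. -/
theorem integral_ray_eq_sub {U : Set E2} (hconv : Convex ℝ U) {V W : E2 → ℝ}
    (hV : ContinuousOn V U) (hW : ContinuousOn W U) {v : E2 → ℝ}
    (hv : ∀ x ∈ U, HasFDerivAt v (covec (V x) (W x)) x) {x : E2} (hx : x ∈ U) (hπx : π x ∈ U) :
    ∫ l in (0 : ℝ)..1, covec (V (ray π l x)) (W (ray π l x)) (x - π x) = v x - v (π x) := by
  have hmem : ∀ l ∈ Icc (0 : ℝ) 1, ray π l x ∈ U := fun l hl =>
    hconv.add_smul_sub_mem hπx hx hl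
  have hmaps : MapsTo (fun l => ray π l x) (Icc (0 : ℝ) 1) U := hmem
  have hc : ContinuousOn (fun l => covec (V (ray π l x)) (W (ray π l x)) (x - π x))
      (Icc (0 : ℝ) 1) := by
    simp only [covec_apply]
    exact ((hV.comp (continuous_ray π x).continuousOn hmaps).mul continuousOn_const).add
      ((hW.comp (continuous_ray π x).continuousOn hmaps).mul continuousOn_const)
  have hd : ∀ l ∈ uIcc (0 : ℝ) 1, HasDerivAt (fun l => v (ray π l x))
      (covec (V (ray π l x)) (W (ray π l x)) (x - π x)) l := fun l hl => by
    rw [uIcc_of_le zero_le_one] at hl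
    have h1 : HasDerivAt (fun l : ℝ => ray π l x) (x - π x) l := by
      simpa [ray] using ((hasDerivAt_id l).smul_const (x - π x)).const_add (π x)
    exact (hv _ (hmem l hl)).comp_hasDerivAt l h1
  have := intervalIntegral.integral_eq_sub_of_hasDerivAt hd
    (hc.intervalIntegrable_of_Icc zero_le_one)
  rw [this]
  simp [ray]

/-- A Lipschitz one-form closed almost everywhere has a primitive on a domain which is ruled by
segments issuing from a curve: integrate along the curve, then along the segments. A tube around
each segment is convex, so there the result differs from a local primitive by a constant. -/
theorem exists_primitive_of_ruled (hΩ : IsOpen Ω)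
    (hb : ∃ R, ∀ x ∈ Ω, ∀ y ∈ Ω, ‖x - y‖ ≤ R)
    (hray : ∀ x ∈ Ω, ∀ l ∈ Icc (0 : ℝ) 1, ray π l x ∈ Ω) (hπc : ContinuousOn π Ω)
    {t : E2 → ℝ} {T : ℝ} {Γ Γ' : ℝ → E2} (htc : ContinuousOn t Ω)
    (ht : ∀ x ∈ Ω, t x ∈ Ioo 0 T) (hπ : ∀ x ∈ Ω, π x = Γ (t x))
    (hΓ : ∀ τ ∈ Ioo 0 T, Γ τ ∈ Ω) (hΓd : ∀ τ ∈ Ioo 0 T, HasDerivAt Γ (Γ' τ) τ)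
    (hΓ' : ContinuousOn Γ' (Ioo 0 T)) {V W : E2 → ℝ} {KV KW : ℝ≥0}
    (hV : LipschitzOnWith KV V Ω) (hW : LipschitzOnWith KW W Ω)
    (hcl : ∀ᵐ x ∂(volume.restrict Ω), fderiv ℝ W x (e 0) = fderiv ℝ V x (e 1)) :
    ∃ v : E2 → ℝ, ∀ x ∈ Ω, HasFDerivAt v (covec (V x) (W x)) x := by
  obtain ⟨R, hR⟩ := hb
  set I : ℝ → ℝ := fun τ => covec (V (Γ τ)) (W (Γ τ)) (Γ' τ) with hI
  have hΓc : ContinuousOn Γ (Ioo 0 T) := fun τ hτ => (hΓd τ hτ).continuousAt.continuousWithinAt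
  have hIc : ContinuousOn I (Ioo 0 T) := by
    have hp : ∀ i : Fin 2, ContinuousOn (fun τ => Γ' τ i) (Ioo 0 T) := fun i =>
      (EuclideanSpace.proj (𝕜 := ℝ) i).continuous.comp_continuousOn hΓ'
    simp only [hI, covec_apply]
    exact ((hV.continuousOn.comp hΓc hΓ).mul (hp 0)).add ((hW.continuousOn.comp hΓc hΓ).mul (hp 1))
  have hsub : ∀ a ∈ Ioo 0 T, ∀ b ∈ Ioo 0 T, uIcc a b ⊆ Ioo 0 T := fun a ha b hb =>
    ordConnected_Ioo.uIcc_subset ha hb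
  have hIi : ∀ a ∈ Ioo 0 T, ∀ b ∈ Ioo 0 T, IntervalIntegrable I volume a b := fun a ha b hb =>
    (hIc.mono (hsub a ha b hb)).intervalIntegrable
  refine ⟨fun x => (∫ τ in (T / 2)..(t x), I τ) +
    ∫ l in (0 : ℝ)..1, covec (V (ray π l x)) (W (ray π l x)) (x - π x), fun x₀ hx₀ => ?_⟩
  have hT : T / 2 ∈ Ioo 0 T := by
    have := ht x₀ hx₀
    constructor <;> linarith [this.1, this.2]
  set S : Set E2 := segment ℝ (π x₀) x₀ with hS
  have hScomp : IsCompact S := by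
    rw [hS, segment_eq_image']
    exact isCompact_Icc.image (by fun_prop)
  have hSΩ : S ⊆ Ω := by
    rw [hS, segment_eq_image']
    rintro _ ⟨l, hl, rfl⟩
    exact hray x₀ hx₀ l hl
  obtain ⟨δ, hδ, hδΩ⟩ := hScomp.exists_thickening_subset_open hΩ hSΩ
  set U := Metric.thickening (δ / 2) S with hU
  have hUo : IsOpen U := Metric.isOpen_thickening
  have hUc : Convex ℝ U := (convex_segment _ _).thickening _
  have hxU : x₀ ∈ U := Metric.self_subset_thickening (half_pos hδ) S (right_mem_segment ℝ _ _)
  have hπU : π x₀ ∈ U := Metric.self_subset_thickening (half_pos hδ) S (left_mem_segment ℝ _ _)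
  have hballU : ∀ x ∈ U, Metric.ball x (δ / 2) ⊆ Ω := by
    intro x hx y hy
    refine hδΩ ?_
    obtain ⟨z, hz, hxz⟩ := Metric.mem_thickening_iff.1 hx
    refine Metric.mem_thickening_iff.2 ⟨z, hz, ?_⟩
    linarith [dist_triangle y x z, Metric.mem_ball.1 hy]
  have hUΩ : U ⊆ Ω := fun x hx => hballU x hx (Metric.mem_ball_self (half_pos hδ))
  obtain ⟨v, hv⟩ := exists_primitive_of_convex hΩ hUo hUc ⟨x₀, hxU⟩ (half_pos hδ) hballU
    (fun x hx y hy => hR x (hUΩ hx) y (hUΩ hy)) hV hW hcl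
  have ht₀ := ht x₀ hx₀
  have hΓU : ∀ᶠ τ in 𝓝 (t x₀), Γ τ ∈ U := by
    refine (hΓd _ ht₀).continuousAt.eventually (hUo.mem_nhds ?_)
    rwa [← hπ x₀ hx₀]
  obtain ⟨r, hr, hrb⟩ := Metric.eventually_nhds_iff_ball.1
    (hΓU.and (isOpen_Ioo.mem_nhds ht₀))
  have hev : ∀ᶠ x in 𝓝 x₀, x ∈ U ∧ π x ∈ U ∧ t x ∈ Metric.ball (t x₀) r ∧ x ∈ Ω :=
    (hUo.eventually_mem hxU).and (((hπc.continuousAt (hΩ.mem_nhds hx₀)).eventually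
      (hUo.mem_nhds hπU)).and (((htc.continuousAt (hΩ.mem_nhds hx₀)).eventually
      (Metric.ball_mem_nhds _ hr)).and (hΩ.eventually_mem hx₀)))
  have hVU := hV.continuousOn.mono hUΩ
  have hWU := hW.continuousOn.mono hUΩ
  refine ((hv x₀ hxU).add_const
    ((∫ τ in (T / 2)..(t x₀), I τ) - v (π x₀))).congr_of_eventuallyEq ?_
  filter_upwards [hev] with x hx
  obtain ⟨hx1, hx2, hx3, hx4⟩ := hx
  rw [integral_ray_eq_sub hUc hVU hWU hv hx1 hx2]
  have hball : uIcc (t x₀) (t x) ⊆ Metric.ball (t x₀) r := by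
    rw [Real.ball_eq_Ioo] at hx3 ⊢
    exact ordConnected_Ioo.uIcc_subset ⟨by linarith, by linarith⟩ hx3
  have hcurve : ∫ τ in (t x₀)..(t x), I τ = v (Γ (t x)) - v (Γ (t x₀)) := by
    refine intervalIntegral.integral_eq_sub_of_hasDerivAt (f := fun τ => v (Γ τ))
      (fun τ hτ => ?_) (hIi _ ht₀ _ (ht x hx4))
    have := hrb τ (hball hτ)
    exact (hv _ this.1).comp_hasDerivAt τ (hΓd τ this.2)
  have hadd := intervalIntegral.integral_add_adjacent_intervals (hIi _ hT _ ht₀)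
    (hIi _ ht₀ _ (ht x hx4))
  rw [← hadd, hcurve, hπ x hx4, hπ x₀ hx₀]
  ring

end GlobalPrimitive

section WeakGradient

open scoped Convolution
open ContinuousLinearMap (lsmul)

variable {F : Type} [NormedAddCommGroup F] [NormedSpace ℝ F] [CompleteSpace F] {Ω : Set E2}
  {W : E2 → F}

/-- On a ball, a function with vanishing weak gradient is the limit of its mollifications, which are
constant. -/
theorem ae_const_on_ball (hW : IntegrableOn W Ω)
    (hz : ∀ η : E2 → ℝ, ContDiff ℝ (⊤ : ℕ∞) η → HasCompactSupport η → tsupport η ⊆ Ω →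
      ∀ ξ : E2, ∫ x in Ω, fderiv ℝ η x ξ • W x = 0) {x₀ : E2} {r : ℝ} (hr : 0 < r)
    (hball : Metric.ball x₀ (2 * r) ⊆ Ω) (hΩ : MeasurableSet Ω) :
    ∃ c, ∀ᵐ x ∂(volume.restrict (Metric.ball x₀ r)), W x = c := by
  set g : E2 → F := Ω.indicator W with hg
  have hgi : Integrable g := hW.integrable_indicator hΩ
  have hgl : LocallyIntegrable g := hgi.locallyIntegrable
  set ρ := bumpSeq E2 r hr with hρ
  have hconst : ∀ n, ∀ x ∈ Metric.ball x₀ r, ∀ y ∈ Metric.ball x₀ r,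
      ((ρ n).normed volume ⋆[lsmul ℝ ℝ] g) x = ((ρ n).normed volume ⋆[lsmul ℝ ℝ] g) y := by
    intro n x hx y hy
    have hd := fun x => hasFDerivAt_mollify ((ρ n).contDiff_normed (μ := volume) (n := 1))
      (ρ n).hasCompactSupport_normed hgl x
    refine Metric.isOpen_ball.is_const_of_fderiv_eq_zero (𝕜 := ℝ)
      (convex_ball x₀ r).isPreconnected
      (fun z _ => (hd z).1.differentiableAt.differentiableWithinAt) (fun z hz' => ?_) hx hy
    ext ξ
    rw [(hd z).2]
    obtain ⟨h1, h2, h3, h4⟩ := testFunction_of_bump (ρ n) z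
    have h5 : tsupport (fun y => (ρ n).normed volume (z - y)) ⊆ Ω := by
      refine h3.trans (fun w hw => hball ?_)
      have hw' := Metric.mem_closedBall.1 hw
      have := bumpSeq_rOut_lt (E := E2) hr n
      have := Metric.mem_ball.1 hz'
      rw [Metric.mem_ball]
      linarith [dist_triangle w z x₀]
    have h6 := hz _ h1 h2 h5 ξ
    simp only [h4, neg_smul, integral_neg, neg_eq_zero] at h6
    rw [← integral_indicator hΩ] at h6
    simp only [Pi.zero_apply, zero_apply]
    rw [← h6]
    refine integral_congr_ae (Filter.Eventually.of_forall fun y => ?_)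
    by_cases hy : y ∈ Ω <;> simp [hg, hy]
  have hlim := ContDiffBump.ae_convolution_tendsto_right_of_locallyIntegrable (μ := volume)
    (φ := ρ) (l := Filter.atTop) (K := 2) (tendsto_bumpSeq_rOut hr)
    (Filter.Eventually.of_forall fun n => by
      change r / (n + 2) ≤ 2 * (r / (n + 2) / 2)
      linarith) hgl
  have hpos : volume (Metric.ball x₀ r) ≠ 0 := (Metric.measure_ball_pos volume x₀ hr).ne'
  obtain ⟨z, hzb, hzl⟩ : ∃ z ∈ Metric.ball x₀ r, Filter.Tendsto
      (fun n => ((ρ n).normed volume ⋆[lsmul ℝ ℝ] g) z) Filter.atTop (𝓝 (g z)) := by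
    by_contra hcon
    push Not at hcon
    exact hpos (measure_mono_null (fun z hz' => hcon z hz') hlim)
  refine ⟨g z, (ae_restrict_iff' Metric.isOpen_ball.measurableSet).2 ?_⟩
  filter_upwards [hlim] with x hx hxb
  have hxΩ : x ∈ Ω := hball (Metric.ball_subset_ball (by linarith) hxb)
  have h1 : g x = W x := by simp [hg, hxΩ]
  rw [← h1]
  refine tendsto_nhds_unique hx (hzl.congr fun n => hconst n z hzb x hxb)

/-- A function with vanishing weak gradient on a connected open set is constant. -/
theorem ae_const_of_weak_gradient_zero (hΩ : IsOpen Ω) (hconn : IsConnected Ω)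
    (hW : IntegrableOn W Ω)
    (hz : ∀ η : E2 → ℝ, ContDiff ℝ (⊤ : ℕ∞) η → HasCompactSupport η → tsupport η ⊆ Ω →
      ∀ ξ : E2, ∫ x in Ω, fderiv ℝ η x ξ • W x = 0) :
    ∃ c, ∀ᵐ x ∂(volume.restrict Ω), W x = c := by
  have hloc : ∀ x ∈ Ω, ∃ r > 0, ∃ c, Metric.ball x r ⊆ Ω ∧
      ∀ᵐ y ∂(volume.restrict (Metric.ball x r)), W y = c := by
    intro x hx
    obtain ⟨r, hr, hb⟩ := Metric.isOpen_iff.1 hΩ x hx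
    obtain ⟨c, hc⟩ := ae_const_on_ball (x₀ := x) (r := r / 2) hW hz (by positivity)
      (by rwa [mul_div_cancel₀ _ two_ne_zero]) hΩ.measurableSet
    exact ⟨r / 2, by positivity, c, (Metric.ball_subset_ball (by linarith)).trans hb, hc⟩
  obtain ⟨x₀, hx₀⟩ := hconn.nonempty
  obtain ⟨r₀, hr₀, c, hb₀, hc⟩ := hloc x₀ hx₀
  let S : Set E2 := {x | ∃ r > 0, ∀ᵐ y ∂(volume.restrict (Metric.ball x r)), W y = c}
  have hS : Ω ⊆ S := by
    refine hconn.isPreconnected.subset_of_closure_inter_subset ?_ ⟨x₀, hx₀, r₀, hr₀, hc⟩ ?_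
    · rw [Metric.isOpen_iff]
      rintro x ⟨r, hr, hx⟩
      refine ⟨r, hr, fun y hy => ?_⟩
      obtain ⟨s, hs, hsb⟩ := Metric.isOpen_iff.1 Metric.isOpen_ball y hy
      exact ⟨s, hs, ae_restrict_of_ae_restrict_of_subset hsb hx⟩
    · rintro x ⟨hxc, hx⟩
      obtain ⟨r, hr, c', -, hc'⟩ := hloc x hx
      obtain ⟨z, ⟨s, hs, hzs⟩, hxz⟩ := Metric.mem_closure_iff.1 hxc r hr
      rw [dist_comm] at hxz
      obtain ⟨q, hq, hqb⟩ := Metric.isOpen_iff.1 (Metric.isOpen_ball.inter Metric.isOpen_ball) z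
        (show z ∈ Metric.ball x r ∩ Metric.ball z s from ⟨hxz, Metric.mem_ball_self hs⟩)
      have h1 := ae_restrict_of_ae_restrict_of_subset (hqb.trans inter_subset_left) hc'
      have h2 := ae_restrict_of_ae_restrict_of_subset (hqb.trans inter_subset_right) hzs
      have h3 : (volume.restrict (Metric.ball z q)) ≠ 0 := by
        rw [Ne, Measure.restrict_eq_zero]
        exact (Metric.measure_ball_pos volume z hq).ne'
      have : (ae (volume.restrict (Metric.ball z q))).NeBot := ae_neBot.2 h3
      obtain ⟨y, hy1, hy2⟩ := (h1.and h2).exists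
      have : c' = c := hy1.symm.trans hy2
      exact ⟨r, hr, by rwa [← this]⟩
  refine ⟨c, ?_⟩
  rw [ae_restrict_iff' hΩ.measurableSet, ae_iff]
  refine measure_null_of_locally_null _ fun x hx => ?_
  simp only [mem_ofPred_eq, Classical.not_imp] at hx
  obtain ⟨r, hr, h⟩ := hS hx.1
  refine ⟨_, inter_mem_nhdsWithin _ (Metric.ball_mem_nhds x hr), ?_⟩
  rw [ae_restrict_iff' Metric.isOpen_ball.measurableSet, ae_iff] at h
  refine measure_mono_null ?_ h
  rintro y ⟨hy, hyb⟩
  simp only [mem_ofPred_eq, Classical.not_imp] at hy ⊢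
  exact ⟨hyb, hy.2⟩

end WeakGradient

end DevelopableShell

end

/-! ### The chart is an isometric immersion -/

noncomputable section

namespace DevelopableShell

section Plane

/-- Rotation by a right angle as a linear map. -/
def perpL : E2 →L[ℝ] E2 :=
  LinearMap.toContinuousLinearMap
    { toFun := perp
      map_add' := fun a b => by ext i; fin_cases i <;> simp [perp]; ring
      map_smul' := fun c a => by ext i; fin_cases i <;> simp [perp] }

@[simp] theorem perpL_apply (a : E2) : perpL a = perp a := rfl

@[simp] theorem perp_zero_apply (a : E2) : perp a 0 = -a 1 := rfl

@[simp] theorem perp_one_apply (a : E2) : perp a 1 = a 0 := rfl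

theorem inner_e2 (a b : E2) : inner ℝ a b = a 0 * b 0 + a 1 * b 1 := by
  simp [PiLp.inner_apply, Fin.sum_univ_two, mul_comm]

theorem norm_sq_e2 (a : E2) : ‖a‖ ^ 2 = a 0 ^ 2 + a 1 ^ 2 := by
  rw [← real_inner_self_eq_norm_sq, inner_e2]; ring

theorem norm_perp (a : E2) : ‖perp a‖ = ‖a‖ := by
  rw [← sq_eq_sq₀ (norm_nonneg _) (norm_nonneg _), norm_sq_e2, norm_sq_e2]
  simp; ring

theorem inner_perp_self (a : E2) : inner ℝ a (perp a) = 0 := by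
  rw [inner_e2]; simp; ring

/-- Expansion in the orthonormal basis `a`, `perp a`. -/
theorem eq_smul_add_smul_perp {a : E2} (ha : ‖a‖ = 1) (v : E2) :
    v = (inner ℝ v a : ℝ) • a + (inner ℝ v (perp a) : ℝ) • perp a := by
  have h : a 0 ^ 2 + a 1 ^ 2 = 1 := by rw [← norm_sq_e2, ha, one_pow]
  ext i
  fin_cases i
  · simp [inner_e2]; linear_combination -(v 0) * h
  · simp [inner_e2]; linear_combination -(v 1) * h

@[simp] theorem e_zero_zero : e 0 0 = 1 := by simp [e]
@[simp] theorem e_zero_one : e 0 1 = 0 := by simp [e]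
@[simp] theorem e_one_zero : e 1 0 = 0 := by simp [e]
@[simp] theorem e_one_one : e 1 1 = 1 := by simp [e]

end Plane

namespace PlanarChart

variable (P : PlanarChart)

theorem Icc_mem_nhds {t : ℝ} (ht : t ∈ Ioo 0 P.T) : Icc 0 P.T ∈ 𝓝 t := _root_.Icc_mem_nhds ht.1 ht.2

theorem hasDerivAt_Γ {t : ℝ} (ht : t ∈ Ioo 0 P.T) : HasDerivAt P.Γ (P.tangent t) t :=
  (P.differentiable_Γ t (Ioo_subset_Icc_self ht)).hasDerivWithinAt.hasDerivAt (P.Icc_mem_nhds ht)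

theorem continuousOn_tangent : ContinuousOn P.tangent (Icc 0 P.T) :=
  P.lipschitz_tangent.choose_spec.continuousOn

theorem continuousOn_N : ContinuousOn P.N (Icc 0 P.T) :=
  perpL.continuous.comp_continuousOn P.continuousOn_tangent

theorem continuousOn_Γ : ContinuousOn P.Γ (Icc 0 P.T) := P.differentiable_Γ.continuousOn

theorem norm_tangent {t : ℝ} (ht : t ∈ Icc 0 P.T) : ‖P.tangent t‖ = 1 := P.arclength t ht

theorem norm_N {t : ℝ} (ht : t ∈ Icc 0 P.T) : ‖P.N t‖ = 1 := by
  rw [N, norm_perp, P.norm_tangent ht]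

theorem inner_tangent_N (t : ℝ) : inner ℝ (P.tangent t) (P.N t) = 0 := inner_perp_self _

theorem Φ_zero (t : ℝ) : P.Φ 0 t = P.Γ t := by simp [Φ]

theorem zero_mem_M {t : ℝ} (ht : t ∈ Ioo 0 P.T) : ((0 : ℝ), t) ∈ P.M := by
  have ht' := Ioo_subset_Icc_self ht
  exact ⟨ht, by simpa using P.sMinus_pos t ht', P.sPlus_pos t ht'⟩

theorem Φ_mem {s t : ℝ} (h : (s, t) ∈ P.M) : P.Φ s t ∈ P.Ω := ⟨(s, t), h, rfl⟩

theorem continuousOn_sMinus : ContinuousOn P.sMinus (Icc 0 P.T) :=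
  P.lipschitz_sMinus.choose_spec.continuousOn

theorem continuousOn_sPlus : ContinuousOn P.sPlus (Icc 0 P.T) :=
  P.lipschitz_sPlus.choose_spec.continuousOn

theorem isOpen_M : IsOpen P.M := by
  rw [isOpen_iff_mem_nhds]
  rintro ⟨s, t⟩ ⟨ht, hs⟩
  simp only at ht hs
  have h1 : ContinuousAt (fun q : ℝ × ℝ => -P.sMinus q.2 - q.1) (s, t) :=
    (((P.continuousOn_sMinus.continuousAt (P.Icc_mem_nhds ht)).comp
      continuousAt_snd).neg).sub continuousAt_fst
  have h2 : ContinuousAt (fun q : ℝ × ℝ => P.sPlus q.2 - q.1) (s, t) :=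
    ((P.continuousOn_sPlus.continuousAt (P.Icc_mem_nhds ht)).comp
      continuousAt_snd).sub continuousAt_fst
  filter_upwards [continuousAt_snd.eventually (isOpen_Ioo.mem_nhds ht),
    h1.eventually (gt_mem_nhds (sub_neg.2 hs.1)), h2.eventually (lt_mem_nhds (sub_pos.2 hs.2))]
    with q hq1 hq2 hq3
  exact ⟨hq1, sub_neg.1 hq2, sub_pos.1 hq3⟩

theorem eventually_mem_M {s t : ℝ} (h : (s, t) ∈ P.M) : ∀ᶠ τ in 𝓝 t, (s, τ) ∈ P.M :=
  (Continuous.prodMk_right s).continuousAt.eventually (P.isOpen_M.mem_nhds h)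

theorem continuousOn_Φ_right (s : ℝ) : ContinuousOn (fun t => P.Φ s t) (Icc 0 P.T) :=
  P.continuousOn_Γ.add (P.continuousOn_N.const_smul s)

theorem hasDerivAt_Φ_left (s t : ℝ) : HasDerivAt (fun σ => P.Φ σ t) (P.N t) s := by
  simpa [Φ] using ((hasDerivAt_id s).smul_const (P.N t)).const_add (P.Γ t)

/-- Where the tangent is differentiable, its derivative is `κ N`. -/
theorem hasDerivAt_tangent_of_differentiableAt {t : ℝ} (ht : t ∈ Ioo 0 P.T)
    (hd : DifferentiableAt ℝ P.tangent t) : HasDerivAt P.tangent (P.κ t • P.N t) t := by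
  have h := hd.hasDerivAt
  have horth : inner ℝ (deriv P.tangent t) (P.tangent t) = 0 := by
    have h1 : HasDerivAt (fun τ => (inner ℝ (P.tangent τ) (P.tangent τ) : ℝ))
        (inner ℝ (P.tangent t) (deriv P.tangent t) + inner ℝ (deriv P.tangent t) (P.tangent t)) t :=
      h.inner ℝ h
    have h2 : HasDerivAt (fun τ => (inner ℝ (P.tangent τ) (P.tangent τ) : ℝ)) 0 t := by
      refine (hasDerivAt_const t (1 : ℝ)).congr_of_eventuallyEq ?_
      filter_upwards [P.Icc_mem_nhds ht] with τ hτ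
      rw [real_inner_self_eq_norm_sq, P.norm_tangent hτ, one_pow]
    have h3 := h1.unique h2
    rw [real_inner_comm] at h3
    linarith
  have hκ : P.κ t = inner ℝ (deriv P.tangent t) (P.N t) := by
    rw [κ, derivWithin_of_mem_nhds (P.Icc_mem_nhds ht)]
  have : deriv P.tangent t = P.κ t • P.N t := by
    rw [eq_smul_add_smul_perp (P.norm_tangent (Ioo_subset_Icc_self ht)) (deriv P.tangent t),
      horth, hκ]
    simp [N]
  rwa [this] at h

theorem perp_N (t : ℝ) : perp (P.N t) = -P.tangent t := by
  ext i
  fin_cases i <;> simp [N]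

theorem hasDerivAt_N {t : ℝ} (h : HasDerivAt P.tangent (P.κ t • P.N t) t) :
    HasDerivAt P.N (-P.κ t • P.tangent t) t := by
  have := perpL.hasFDerivAt.comp_hasDerivAt t h
  have h2 : perpL (P.κ t • P.N t) = -P.κ t • P.tangent t := by
    rw [map_smul, perpL_apply, perp_N]; simp
  rwa [h2] at this

theorem hasDerivAt_Φ_right {s t : ℝ} (ht : t ∈ Ioo 0 P.T)
    (h : HasDerivAt P.tangent (P.κ t • P.N t) t) :
    HasDerivAt (fun τ => P.Φ s τ) ((1 - s * P.κ t) • P.tangent t) t := by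
  have := (P.hasDerivAt_Γ ht).add ((P.hasDerivAt_N h).const_smul s)
  have h2 : P.tangent t + s • (-P.κ t • P.tangent t) = (1 - s * P.κ t) • P.tangent t := by module
  rwa [h2] at this

theorem ae_hasDerivAt_tangent :
    ∀ᵐ t, t ∈ Ioo 0 P.T → HasDerivAt P.tangent (P.κ t • P.N t) t := by
  obtain ⟨K, hK⟩ := P.lipschitz_tangent
  have h : LipschitzOnWith K P.tangent (Icc 0 P.T) := hK
  filter_upwards [h.ae_differentiableWithinAt_of_mem] with t ht htI
  exact P.hasDerivAt_tangent_of_differentiableAt htI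
    ((ht (Ioo_subset_Icc_self htI)).differentiableAt (P.Icc_mem_nhds htI))

theorem integrable_κ_mul {g : ℝ → ℝ} (hg : ContinuousOn g (Icc 0 P.T)) :
    IntervalIntegrable (fun t => -P.κ t * g t) volume 0 P.T := by
  obtain ⟨K, hK⟩ := P.lipschitz_tangent
  have hKt : LipschitzOnWith K P.tangent (Icc 0 P.T) := hK
  rw [intervalIntegrable_iff_integrableOn_Ioo_of_le P.T_pos.le]
  obtain ⟨G, hG⟩ := isCompact_Icc.exists_bound_of_continuousOn hg
  have hmeas : AEStronglyMeasurable (fun t => -P.κ t * g t) (volume.restrict (Ioo 0 P.T)) := by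
    have h1 : AEStronglyMeasurable (fun t => -(inner ℝ (deriv P.tangent t) (P.N t)) * g t)
        (volume.restrict (Ioo 0 P.T)) := by
      refine AEStronglyMeasurable.mul (AEStronglyMeasurable.neg ?_)
        ((hg.mono Ioo_subset_Icc_self).aestronglyMeasurable measurableSet_Ioo)
      exact (aestronglyMeasurable_deriv _ _).inner
        ((P.continuousOn_N.mono Ioo_subset_Icc_self).aestronglyMeasurable measurableSet_Ioo)
    refine h1.congr ?_
    filter_upwards [ae_restrict_mem measurableSet_Ioo] with t ht
    rw [κ, derivWithin_of_mem_nhds (P.Icc_mem_nhds ht)]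
  refine IntegrableOn.of_bound measure_Ioo_lt_top hmeas (K * G) ?_
  filter_upwards [ae_restrict_mem measurableSet_Ioo] with t ht
  have ht' := Ioo_subset_Icc_self ht
  rw [norm_mul, norm_neg, κ, derivWithin_of_mem_nhds (P.Icc_mem_nhds ht)]
  gcongr
  · refine (norm_inner_le_norm _ _).trans ?_
    rw [P.norm_N ht', mul_one]
    exact norm_deriv_le_of_lipschitzOn (P.Icc_mem_nhds ht) hKt
  · exact hG t ht'

end PlanarChart

namespace DevelopableSurface

variable (D : DevelopableSurface)

/-- The rows of the moving frame as vectors. -/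
def row (i : Fin 3) (t : ℝ) : E3 := WithLp.toLp 2 (D.r t i)

theorem continuousOn_row_apply (i j : Fin 3) : ContinuousOn (fun t => D.r t i j) (Icc 0 D.T) :=
  (continuous_apply_apply i j).comp_continuousOn D.continuous_r

theorem continuousOn_row (i : Fin 3) : ContinuousOn (D.row i) (Icc 0 D.T) :=
  (PiLp.continuous_toLp 2 _).comp_continuousOn
    ((continuous_apply i).comp_continuousOn D.continuous_r)

theorem inner_row {t : ℝ} (ht : t ∈ Icc 0 D.T) (i j : Fin 3) :
    inner ℝ (D.row i t) (D.row j t) = if i = j then 1 else 0 := by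
  have h := (Matrix.mem_specialOrthogonalGroup_iff.1 (D.r_mem t ht)).1
  have h1 := (Matrix.mem_orthogonalGroup_iff (Fin 3) ℝ).1 h
  have h2 := congrFun (congrFun h1 i) j
  rw [Matrix.mul_apply, Matrix.one_apply] at h2
  rw [← h2]
  simp [row, PiLp.inner_apply, mul_comm]

/-- The second row of the frame equation, at Lebesgue points. -/
theorem ae_hasDerivAt_row_one :
    ∀ᵐ t, t ∈ Ioo 0 D.T → HasDerivAt (D.row 1) (-D.κ t • D.row 0 t) t := by
  have hcomp : ∀ j : Fin 3, ∀ᵐ t, t ∈ Ioo 0 D.T →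
      HasDerivAt (fun τ => D.r τ 1 j) (-D.κ t * D.r t 0 j) t := by
    intro j
    have hi := D.integrable_κ_mul (D.continuousOn_row_apply 0 j)
    filter_upwards [hi.ae_hasDerivAt_integral] with t ht htI
    have htc : t ∈ uIcc 0 D.T := by
      rw [uIcc_of_le D.T_pos.le]; exact Ioo_subset_Icc_self htI
    have h := (ht htc 0 left_mem_uIcc).const_add ((1 : Matrix (Fin 3) (Fin 3) ℝ) 1 j)
    refine h.congr_of_eventuallyEq ?_
    filter_upwards [D.Icc_mem_nhds htI] with τ hτ
    rw [D.frame_eq τ hτ 1 j]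
    congr 1
    refine intervalIntegral.integral_congr fun σ _ => ?_
    simp [Matrix.mul_apply, Fin.sum_univ_three]
  have hall := ae_all_iff.2 hcomp
  filter_upwards [hall] with t ht htI
  have : HasDerivAt (fun τ => (D.r τ 1 : Fin 3 → ℝ)) (fun j => -D.κ t * D.r t 0 j) t :=
    hasDerivAt_pi.2 fun j => ht j htI
  have h2 := (PiLp.continuousLinearEquiv 2 ℝ (fun _ : Fin 3 => ℝ)).symm.hasFDerivAt.comp_hasDerivAt
    t this
  refine h2.congr_deriv ?_
  ext j
  simp [row]

/-- The curve `γ`. -/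
def γ (t : ℝ) : E3 := ∫ τ in (0 : ℝ)..t, D.row 0 τ

theorem hasDerivAt_γ {t : ℝ} (ht : t ∈ Ioo 0 D.T) : HasDerivAt D.γ (D.row 0 t) t := by
  refine intervalIntegral.integral_hasDerivAt_right ?_ ?_ ?_
  · refine ((D.continuousOn_row 0).mono ?_).intervalIntegrable
    rw [uIcc_of_le ht.1.le]
    exact Icc_subset_Icc_right ht.2.le
  · exact ((D.continuousOn_row 0).mono Ioo_subset_Icc_self).stronglyMeasurableAtFilter
      isOpen_Ioo t ht
  · exact (D.continuousOn_row 0).continuousAt (D.Icc_mem_nhds ht)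

theorem u_eq {s t : ℝ} (h : (s, t) ∈ D.M) : D.u (D.Φ s t) = D.γ t + s • D.row 1 t := D.u_Φ (s, t) h

variable {D}

/-- The chart maps the segments to straight lines, at unit speed. -/
theorem fderiv_u_N (hu : DifferentiableOn ℝ D.u D.Ω) {s t : ℝ} (h : (s, t) ∈ D.M) :
    fderiv ℝ D.u (D.Φ s t) (D.N t) = D.row 1 t := by
  have hd := (hu.differentiableAt (D.lipschitz_domain.isOpen.mem_nhds (D.Φ_mem h))).hasFDerivAt
  have h1 := hd.comp_hasDerivAt s (D.hasDerivAt_Φ_left s t)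
  have h2 : HasDerivAt (fun σ => D.γ t + σ • D.row 1 t) (D.row 1 t) s := by
    simpa using ((hasDerivAt_id s).smul_const (D.row 1 t)).const_add (D.γ t)
  refine h1.unique (h2.congr_of_eventuallyEq ?_)
  filter_upwards [isOpen_Ioo.mem_nhds h.2] with σ hσ
  exact D.u_eq ⟨h.1, hσ⟩

/-- The chart `u` maps the tangent of the plane curve to the tangent of the space curve. The frame
equation gives this for almost every `t`, away from focal points; continuity removes both
restrictions. -/
theorem fderiv_u_tangent (hu : ContDiffOn ℝ 1 D.u D.Ω) {s t : ℝ} (h : (s, t) ∈ D.M) :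
    fderiv ℝ D.u (D.Φ s t) (D.tangent t) = D.row 0 t := by
  have hΩ := D.lipschitz_domain.isOpen
  have hdiff : DifferentiableOn ℝ D.u D.Ω := hu.differentiableOn one_ne_zero
  have hcont : ContinuousOn (fderiv ℝ D.u) D.Ω := hu.continuousOn_fderiv_of_isOpen hΩ le_rfl
  have hae : ∀ᵐ τ, τ ∈ Ioo 0 D.T → ∀ σ, (σ, τ) ∈ D.M →
      fderiv ℝ D.u (D.Φ σ τ) (D.tangent τ) = D.row 0 τ := by
    filter_upwards [D.ae_hasDerivAt_row_one, D.ae_hasDerivAt_tangent] with τ hτ1 hτ2 hτ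
    have hscaled : ∀ σ, (σ, τ) ∈ D.M → (1 - σ * D.κ τ) •
        fderiv ℝ D.u (D.Φ σ τ) (D.tangent τ) = (1 - σ * D.κ τ) • D.row 0 τ := by
      intro σ hσ
      have hd := (hdiff.differentiableAt (hΩ.mem_nhds (D.Φ_mem hσ))).hasFDerivAt
      have h1 := hd.comp_hasDerivAt τ (D.hasDerivAt_Φ_right (s := σ) hτ (hτ2 hτ))
      rw [map_smul] at h1
      have h2 := (D.hasDerivAt_γ hτ).add ((hτ1 hτ).const_smul σ)
      have h3 : D.row 0 τ + σ • (-D.κ τ • D.row 0 τ) = (1 - σ * D.κ τ) • D.row 0 τ := by module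
      rw [h3] at h2
      refine h1.unique (h2.congr_of_eventuallyEq ?_)
      filter_upwards [D.eventually_mem_M hσ] with ρ hρ
      exact D.u_eq hρ
    intro σ hσ
    have hc : ContinuousOn (fun σ => fderiv ℝ D.u (D.Φ σ τ) (D.tangent τ))
        (Ioo (-D.sMinus τ) (D.sPlus τ)) := by
      refine ContinuousOn.clm_apply (hcont.comp ?_ fun σ hσ => D.Φ_mem ⟨hτ, hσ⟩) continuousOn_const
      exact fun σ _ => (D.hasDerivAt_Φ_left σ τ).continuousAt.continuousWithinAt
    refine Measure.eqOn_open_of_ae_eq (μ := volume) ?_ isOpen_Ioo hc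
      (continuousOn_const (c := D.row 0 τ)) hσ.2
    -- at most one point of the segment is focal
    have hne : ∀ᵐ σ : ℝ, σ ≠ (D.κ τ)⁻¹ := by simp [ae_iff, measure_singleton]
    refine (ae_restrict_iff' measurableSet_Ioo).2 ?_
    filter_upwards [hne] with σ' hσ' hmem
    have h1 := hscaled σ' ⟨hτ, hmem⟩
    have hfoc : 1 - σ' * D.κ τ ≠ 0 := fun h0 =>
      hσ' (eq_inv_of_mul_eq_one_left (by linarith))
    exact smul_right_injective E3 hfoc h1
  obtain ⟨r, hr, hb⟩ := Metric.eventually_nhds_iff_ball.1 (D.eventually_mem_M h)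
  have hsub : Metric.ball t r ⊆ Icc 0 D.T := fun τ hτ => Ioo_subset_Icc_self (hb τ hτ).1
  have hc : ContinuousOn (fun τ => fderiv ℝ D.u (D.Φ s τ) (D.tangent τ)) (Metric.ball t r) := by
    refine ContinuousOn.clm_apply (hcont.comp ((D.continuousOn_Φ_right s).mono hsub)
      fun τ hτ => D.Φ_mem (hb τ hτ)) (D.continuousOn_tangent.mono hsub)
  refine Measure.eqOn_open_of_ae_eq (μ := volume) ?_ Metric.isOpen_ball hc
    ((D.continuousOn_row 0).mono hsub) (Metric.mem_ball_self hr)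
  refine (ae_restrict_iff' Metric.isOpen_ball.measurableSet).2 ?_
  filter_upwards [hae] with τ hτ hmem
  exact hτ (hb τ hmem).1 s (hb τ hmem)

/-- The chart `u` is an isometric immersion. -/
theorem inner_fderiv_u (hu : ContDiffOn ℝ 1 D.u D.Ω) {x : E2} (hx : x ∈ D.Ω) (ξ ζ : E2) :
    inner ℝ (fderiv ℝ D.u x ξ) (fderiv ℝ D.u x ζ) = (inner ℝ ξ ζ : ℝ) := by
  obtain ⟨⟨s, t⟩, h, rfl⟩ := hx
  have ht : t ∈ Icc 0 D.T := Ioo_subset_Icc_self h.1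
  have hT := fderiv_u_tangent hu h
  have hN := fderiv_u_N (hu.differentiableOn one_ne_zero) h
  have h00 := D.inner_row ht 0 0
  have h01 := D.inner_row ht 0 1
  have h10 := D.inner_row ht 1 0
  have h11 := D.inner_row ht 1 1
  simp only [Fin.isValue, if_true, zero_ne_one, one_ne_zero, if_false] at h00 h01 h10 h11
  have hexp := fun v => eq_smul_add_smul_perp (D.norm_tangent ht) v
  have hR : (inner ℝ ξ ζ : ℝ) = inner ℝ ξ (D.tangent t) * inner ℝ ζ (D.tangent t) +
      inner ℝ ξ (D.N t) * inner ℝ ζ (D.N t) := by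
    conv_lhs => rw [hexp ζ, inner_add_right, inner_smul_right, inner_smul_right]
    rw [PlanarChart.N]; ring
  change inner ℝ (fderiv ℝ D.u (D.Φ s t) ξ) (fderiv ℝ D.u (D.Φ s t) ζ) = _
  have hA : ∀ v, fderiv ℝ D.u (D.Φ s t) v = (inner ℝ v (D.tangent t) : ℝ) • D.row 0 t +
      (inner ℝ v (D.N t) : ℝ) • D.row 1 t := fun v => by
    conv_lhs => rw [hexp v, map_add, map_smul, map_smul]
    rw [hT, ← hN]
    rfl
  rw [hA, hA, hR]
  simp only [inner_add_left, inner_add_right, real_inner_smul_left, real_inner_smul_right, h00, h01,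
    h10, h11]
  ring

end DevelopableSurface

end DevelopableShell

end

/-! ### The second fundamental form and the rulings -/

noncomputable section

namespace DevelopableShell

section Space

/-- The vector product as a continuous bilinear map. -/
def crossL : E3 →L[ℝ] E3 →L[ℝ] E3 :=
  LinearMap.toContinuousLinearMap (LinearMap.toContinuousLinearMap.toLinearMap ∘ₗ
    LinearMap.mk₂ ℝ cross
      (fun a b c => by simp [cross])
      (fun c a b => by simp [cross])
      (fun a b c => by simp [cross])
      (fun c a b => by simp [cross]))

@[simp] theorem crossL_apply (a b : E3) : crossL a b = cross a b := rfl

theorem inner_e3 (a b : E3) : inner ℝ a b = a 0 * b 0 + a 1 * b 1 + a 2 * b 2 := by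
  simp [PiLp.inner_apply, Fin.sum_univ_three, mul_comm]

theorem cross_apply_zero (a b : E3) : cross a b 0 = a 1 * b 2 - a 2 * b 1 := by
  simp [cross, cross_apply]

theorem cross_apply_one (a b : E3) : cross a b 1 = a 2 * b 0 - a 0 * b 2 := by
  simp [cross, cross_apply]

theorem cross_apply_two (a b : E3) : cross a b 2 = a 0 * b 1 - a 1 * b 0 := by
  simp [cross, cross_apply]

theorem inner_cross_left (a b : E3) : inner ℝ (cross a b) a = 0 := by
  rw [inner_e3, cross_apply_zero, cross_apply_one, cross_apply_two]; ring

theorem inner_cross_right (a b : E3) : inner ℝ (cross a b) b = 0 := by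
  rw [inner_e3, cross_apply_zero, cross_apply_one, cross_apply_two]; ring

theorem inner_cross_self (a b : E3) : inner ℝ (cross a b) (cross a b) =
    inner ℝ a a * inner ℝ b b - inner ℝ a b * (inner ℝ a b : ℝ) := by
  simp only [inner_e3, cross_apply_zero, cross_apply_one, cross_apply_two]; ring

theorem cross_combination (p q p' q' : ℝ) (a b : E3) :
    cross (p • a + q • b) (p' • a + q' • b) = (p * q' - q * p') • cross a b := by
  ext i
  fin_cases i <;> simp [cross, cross_apply] <;> ring

/-- Expansion in the orthonormal basis `a`, `b`, `a × b`. -/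
theorem eq_sum_of_orthonormal {a b : E3} (ha : inner ℝ a a = (1 : ℝ)) (hb : inner ℝ b b = (1 : ℝ))
    (hab : inner ℝ a b = (0 : ℝ)) (v : E3) :
    v = (inner ℝ v a : ℝ) • a + (inner ℝ v b : ℝ) • b +
      (inner ℝ v (cross a b) : ℝ) • cross a b := by
  have hc : inner ℝ (cross a b) (cross a b) = (1 : ℝ) := by
    rw [inner_cross_self, ha, hb, hab]; ring
  have h1 := inner_cross_left a b
  have h2 := inner_cross_right a b
  have hba : inner ℝ b a = (0 : ℝ) := by rw [real_inner_comm]; exact hab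
  have h1' : inner ℝ a (cross a b) = (0 : ℝ) := by rw [real_inner_comm]; exact h1
  have h2' : inner ℝ b (cross a b) = (0 : ℝ) := by rw [real_inner_comm]; exact h2
  have hon : Orthonormal ℝ ![a, b, cross a b] := by
    rw [orthonormal_iff_ite]
    intro i j
    fin_cases i <;> fin_cases j <;> simp [ha, hb, hab, hc, h1, h2, hba, h1', h2',
      -inner_self_eq_norm_sq_to_K]
  have hspan := hon.linearIndependent.span_eq_top_of_card_eq_finrank (by simp)
  let B := OrthonormalBasis.mk hon hspan.ge
  have := B.sum_repr' v
  rw [Fin.sum_univ_three] at this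
  simp only [B, OrthonormalBasis.coe_mk, Matrix.cons_val_zero, Matrix.cons_val_one,
    Matrix.cons_val] at this
  rw [real_inner_comm a v, real_inner_comm b v, real_inner_comm (cross a b) v]
  exact this.symm

end Space

namespace DevelopableSurface

variable {D : DevelopableSurface}

theorem isOpen_Ω : IsOpen D.Ω := D.lipschitz_domain.isOpen

theorem inner_normal_fderiv_u {x : E2} (ξ : E2) :
    inner ℝ (D.normal x) (fderiv ℝ D.u x ξ) = (0 : ℝ) := by
  conv_lhs => rw [vec_eq ξ, map_add, map_smul, map_smul, inner_add_right, inner_smul_right,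
    inner_smul_right, normal, inner_cross_left, inner_cross_right]
  ring

theorem _root_.HasFDerivAt.apply_const {E F G : Type*} [NormedAddCommGroup E] [NormedSpace ℝ E]
    [NormedAddCommGroup F] [NormedSpace ℝ F] [NormedAddCommGroup G] [NormedSpace ℝ G]
    {f : E → F →L[ℝ] G} {f' : E →L[ℝ] F →L[ℝ] G} {x : E} (h : HasFDerivAt f f' x) (v : F) :
    HasFDerivAt (fun y => f y v) (f'.flip v) x :=
  (ContinuousLinearMap.apply ℝ G v).hasFDerivAt.comp x h

/-- The trace of `[a_ij]`. -/
def tr (D : DevelopableSurface) (x : E2) : ℝ := D.a 0 0 x + D.a 1 1 x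

section Normal

variable (hu : ContDiffOn ℝ 3 D.u D.Ω)
include hu

theorem contDiffOn_fderiv_u : ContDiffOn ℝ 2 (fderiv ℝ D.u) D.Ω :=
  hu.fderiv_of_isOpen isOpen_Ω (by norm_num)

theorem contDiffOn_fderiv_fderiv_u : ContDiffOn ℝ 1 (fderiv ℝ (fderiv ℝ D.u)) D.Ω :=
  (contDiffOn_fderiv_u hu).fderiv_of_isOpen isOpen_Ω (by norm_num)

theorem hasFDerivAt_u {x : E2} (hx : x ∈ D.Ω) : HasFDerivAt D.u (fderiv ℝ D.u x) x :=
  ((hu.differentiableOn (by norm_num)).differentiableAt (isOpen_Ω.mem_nhds hx)).hasFDerivAt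

theorem hasFDerivAt_fderiv_u {x : E2} (hx : x ∈ D.Ω) :
    HasFDerivAt (fderiv ℝ D.u) (fderiv ℝ (fderiv ℝ D.u) x) x :=
  (((contDiffOn_fderiv_u hu).differentiableOn (by norm_num)).differentiableAt
    (isOpen_Ω.mem_nhds hx)).hasFDerivAt

theorem hasFDerivAt_fderiv_fderiv_u {x : E2} (hx : x ∈ D.Ω) :
    HasFDerivAt (fderiv ℝ (fderiv ℝ D.u)) (fderiv ℝ (fderiv ℝ (fderiv ℝ D.u)) x) x :=
  (((contDiffOn_fderiv_fderiv_u hu).differentiableOn (by norm_num)).differentiableAt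
    (isOpen_Ω.mem_nhds hx)).hasFDerivAt

theorem hasFDerivAt_fderiv_u_apply {x : E2} (hx : x ∈ D.Ω) (ζ : E2) :
    HasFDerivAt (fun y => fderiv ℝ D.u y ζ) ((fderiv ℝ (fderiv ℝ D.u) x).flip ζ) x :=
  (hasFDerivAt_fderiv_u hu hx).apply_const ζ

theorem fderiv_fderiv_u_symm {x : E2} (hx : x ∈ D.Ω) (ξ ζ : E2) :
    fderiv ℝ (fderiv ℝ D.u) x ξ ζ = fderiv ℝ (fderiv ℝ D.u) x ζ ξ :=
  second_derivative_symmetric_of_eventually (f := D.u) (f' := fderiv ℝ D.u)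
    (by filter_upwards [isOpen_Ω.mem_nhds hx] with y hy using hasFDerivAt_u hu hy)
    (hasFDerivAt_fderiv_u hu hx) ξ ζ

theorem inner_u (x : E2) (hx : x ∈ D.Ω) (ξ ζ : E2) :
    inner ℝ (fderiv ℝ D.u x ξ) (fderiv ℝ D.u x ζ) = (inner ℝ ξ ζ : ℝ) :=
  inner_fderiv_u (hu.of_le (by norm_num)) hx ξ ζ

/-- The Christoffel symbols of an isometric immersion of a plane domain vanish. -/
theorem inner_fderiv_fderiv_u {x : E2} (hx : x ∈ D.Ω) (ξ ζ η : E2) :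
    inner ℝ (fderiv ℝ (fderiv ℝ D.u) x ξ ζ) (fderiv ℝ D.u x η) = (0 : ℝ) := by
  have key : ∀ h ζ η : E2, (inner ℝ (fderiv ℝ D.u x ζ) (fderiv ℝ (fderiv ℝ D.u) x h η) : ℝ) +
      inner ℝ (fderiv ℝ (fderiv ℝ D.u) x h ζ) (fderiv ℝ D.u x η) = 0 := by
    intro h ζ η
    have h1 := (hasFDerivAt_fderiv_u_apply hu hx ζ).inner ℝ (hasFDerivAt_fderiv_u_apply hu hx η)
    have h2 : HasFDerivAt (fun y => (inner ℝ (fderiv ℝ D.u y ζ) (fderiv ℝ D.u y η) : ℝ))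
        (0 : E2 →L[ℝ] ℝ) x := by
      refine (hasFDerivAt_const (inner ℝ ζ η : ℝ) x).congr_of_eventuallyEq ?_
      filter_upwards [isOpen_Ω.mem_nhds hx] with y hy using inner_u hu y hy ζ η
    have h3 := congrArg (fun A : E2 →L[ℝ] ℝ => A h) (h1.unique h2)
    simpa [fderivInnerCLM_apply] using h3
  have k1 := key ξ ζ η
  have k2 := key ζ η ξ
  have k3 := key η ξ ζ
  rw [fderiv_fderiv_u_symm hu hx ζ ξ, fderiv_fderiv_u_symm hu hx ζ η, real_inner_comm] at k2
  rw [fderiv_fderiv_u_symm hu hx η ξ, real_inner_comm] at k3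
  rw [real_inner_comm] at k1
  linarith

theorem inner_normal_self {x : E2} (hx : x ∈ D.Ω) :
    inner ℝ (D.normal x) (D.normal x) = (1 : ℝ) := by
  rw [normal, inner_cross_self, inner_u hu x hx, inner_u hu x hx, inner_u hu x hx]
  simp only [inner_e2]
  simp

/-- Expansion in the orthonormal frame `∂₁u`, `∂₂u`, `n`. -/
theorem frame_expansion {x : E2} (hx : x ∈ D.Ω) (v : E3) :
    v = (inner ℝ v (fderiv ℝ D.u x (e 0)) : ℝ) • fderiv ℝ D.u x (e 0) +
      (inner ℝ v (fderiv ℝ D.u x (e 1)) : ℝ) • fderiv ℝ D.u x (e 1) +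
      (inner ℝ v (D.normal x) : ℝ) • D.normal x := by
  refine eq_sum_of_orthonormal ?_ ?_ ?_ v <;> rw [inner_u hu x hx, inner_e2] <;> simp

theorem contDiffOn_normal : ContDiffOn ℝ 2 D.normal D.Ω := by
  have h := contDiffOn_fderiv_u hu
  exact crossL.isBoundedBilinearMap.contDiff.comp_contDiffOn
    ((h.clm_apply contDiffOn_const).prodMk (h.clm_apply contDiffOn_const))

theorem hasFDerivAt_normal {x : E2} (hx : x ∈ D.Ω) :
    HasFDerivAt D.normal (fderiv ℝ D.normal x) x :=
  (((contDiffOn_normal hu).differentiableOn (by norm_num)).differentiableAt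
    (isOpen_Ω.mem_nhds hx)).hasFDerivAt

theorem fderiv_fderiv_u_eq {x : E2} (hx : x ∈ D.Ω) (ξ ζ : E2) :
    fderiv ℝ (fderiv ℝ D.u) x ξ ζ =
      (inner ℝ (D.normal x) (fderiv ℝ (fderiv ℝ D.u) x ξ ζ) : ℝ) • D.normal x := by
  conv_lhs => rw [frame_expansion hu hx (fderiv ℝ (fderiv ℝ D.u) x ξ ζ),
    inner_fderiv_fderiv_u hu hx, inner_fderiv_fderiv_u hu hx]
  rw [zero_smul, zero_smul, zero_add, zero_add, real_inner_comm]

theorem inner_fderiv_normal_normal {x : E2} (hx : x ∈ D.Ω) (ξ : E2) :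
    inner ℝ (fderiv ℝ D.normal x ξ) (D.normal x) = (0 : ℝ) := by
  have h1 := (hasFDerivAt_normal hu hx).inner ℝ (hasFDerivAt_normal hu hx)
  have h2 : HasFDerivAt (fun y => (inner ℝ (D.normal y) (D.normal y) : ℝ)) (0 : E2 →L[ℝ] ℝ) x := by
    refine (hasFDerivAt_const (1 : ℝ) x).congr_of_eventuallyEq ?_
    filter_upwards [isOpen_Ω.mem_nhds hx] with y hy using inner_normal_self hu hy
  have h3 := congrArg (fun A : E2 →L[ℝ] ℝ => A ξ) (h1.unique h2)
  simp only [ContinuousLinearMap.comp_apply, fderivInnerCLM_apply, ContinuousLinearMap.prod_apply,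
    zero_apply] at h3
  rw [real_inner_comm] at h3
  linarith

/-- The Weingarten relation. -/
theorem secondForm_eq {x : E2} (hx : x ∈ D.Ω) (ξ ζ : E2) :
    D.secondForm x ξ ζ = -(inner ℝ (D.normal x) (fderiv ℝ (fderiv ℝ D.u) x ξ ζ) : ℝ) := by
  have h1 := (hasFDerivAt_normal hu hx).inner ℝ (hasFDerivAt_fderiv_u_apply hu hx ζ)
  have h2 : HasFDerivAt (fun y => (inner ℝ (D.normal y) (fderiv ℝ D.u y ζ) : ℝ))
      (0 : E2 →L[ℝ] ℝ) x := by
    refine (hasFDerivAt_const (0 : ℝ) x).congr_of_eventuallyEq ?_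
    filter_upwards with y using inner_normal_fderiv_u ζ
  have h3 := congrArg (fun A : E2 →L[ℝ] ℝ => A ξ) (h1.unique h2)
  simp only [ContinuousLinearMap.comp_apply, fderivInnerCLM_apply, ContinuousLinearMap.prod_apply,
    zero_apply, ContinuousLinearMap.flip_apply] at h3
  rw [secondForm]
  linarith

theorem a_symm {x : E2} (hx : x ∈ D.Ω) (i j : Fin 2) : D.a i j x = D.a j i x := by
  rw [a, fderiv_fderiv_u_symm hu hx]; rfl

theorem secondForm_eq_sum {x : E2} (hx : x ∈ D.Ω) (ξ ζ : E2) :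
    D.secondForm x ξ ζ = -(D.a 0 0 x * ξ 0 * ζ 0 + D.a 0 1 x * (ξ 0 * ζ 1 + ξ 1 * ζ 0) +
      D.a 1 1 x * ξ 1 * ζ 1) := by
  have h := a_symm hu hx 1 0
  rw [secondForm_eq hu hx, vec_eq ξ, vec_eq ζ]
  simp only [map_add, map_smul, add_apply, smul_apply, inner_add_right, inner_smul_right]
  simp only [a] at h ⊢
  simp [h]
  ring

/-- In the derivative of `a_{ij}` only the third derivatives of `u` survive: the derivative of
the normal is tangential, while the second derivatives of `u` are normal. -/
theorem hasFDerivAt_a {x : E2} (hx : x ∈ D.Ω) (i j : Fin 2) :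
    HasFDerivAt (D.a i j) (fderiv ℝ (D.a i j) x) x ∧ ∀ h, fderiv ℝ (D.a i j) x h =
      inner ℝ (D.normal x) (fderiv ℝ (fderiv ℝ (fderiv ℝ D.u)) x h (e i) (e j)) := by
  have h2 := ((hasFDerivAt_fderiv_fderiv_u hu hx).apply_const (e i)).apply_const (e j)
  have h1 := (hasFDerivAt_normal hu hx).inner ℝ h2
  have h3 : HasFDerivAt (D.a i j) _ x := h1
  refine ⟨h3.differentiableAt.hasFDerivAt, fun h => ?_⟩
  rw [h3.fderiv]
  simp only [ContinuousLinearMap.comp_apply, fderivInnerCLM_apply, ContinuousLinearMap.prod_apply,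
    ContinuousLinearMap.flip_apply]
  rw [fderiv_fderiv_u_eq hu hx (e i) (e j), inner_smul_right, inner_fderiv_normal_normal hu hx]
  ring

/-- The Codazzi equations. -/
theorem codazzi {x : E2} (hx : x ∈ D.Ω) (i j l : Fin 2) :
    fderiv ℝ (D.a i j) x (e l) = fderiv ℝ (D.a l j) x (e i) := by
  rw [(hasFDerivAt_a hu hx i j).2, (hasFDerivAt_a hu hx l j).2,
    second_derivative_symmetric_of_eventually (f := fderiv ℝ D.u)
      (f' := fderiv ℝ (fderiv ℝ D.u))
      (by filter_upwards [isOpen_Ω.mem_nhds hx] with y hy using hasFDerivAt_fderiv_u hu hy)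
      (hasFDerivAt_fderiv_fderiv_u hu hx) (e l) (e i)]

/-- The normal is constant along the segments. -/
theorem normal_Φ {s t : ℝ} (h : (s, t) ∈ D.M) :
    D.normal (D.Φ s t) = cross (D.row 0 t) (D.row 1 t) := by
  have ht : t ∈ Icc 0 D.T := Ioo_subset_Icc_self h.1
  have hT := fderiv_u_tangent (hu.of_le (by norm_num)) h
  have hN := fderiv_u_N (hu.differentiableOn (by norm_num)) h
  have hA : ∀ v, fderiv ℝ D.u (D.Φ s t) v = (inner ℝ v (D.tangent t) : ℝ) • D.row 0 t +
      (inner ℝ v (D.N t) : ℝ) • D.row 1 t := fun v => by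
    conv_lhs => rw [eq_smul_add_smul_perp (D.norm_tangent ht) v, map_add, map_smul, map_smul]
    rw [hT, ← hN]
    rfl
  have hn : D.tangent t 0 ^ 2 + D.tangent t 1 ^ 2 = 1 := by
    rw [← norm_sq_e2, D.norm_tangent ht, one_pow]
  rw [normal, hA, hA, cross_combination]
  have : (inner ℝ (e 0) (D.tangent t) * inner ℝ (e 1) (D.N t) -
      inner ℝ (e 0) (D.N t) * inner ℝ (e 1) (D.tangent t) : ℝ) = 1 := by
    simp [inner_e2, PlanarChart.N]
    linarith
  rw [this, one_smul]

theorem fderiv_normal_N {s t : ℝ} (h : (s, t) ∈ D.M) :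
    fderiv ℝ D.normal (D.Φ s t) (D.N t) = 0 := by
  have h1 := (hasFDerivAt_normal hu (D.Φ_mem h)).comp_hasDerivAt s (D.hasDerivAt_Φ_left s t)
  refine h1.unique ((hasDerivAt_const s (cross (D.row 0 t) (D.row 1 t))).congr_of_eventuallyEq ?_)
  filter_upwards [isOpen_Ioo.mem_nhds h.2] with σ hσ
  exact normal_Φ hu ⟨h.1, hσ⟩

/-- `[a_ij]` is symmetric and annihilates `N`, hence is a multiple of `Γ' ⊗ Γ'`. -/
theorem a_eq {s t : ℝ} (h : (s, t) ∈ D.M) (i j : Fin 2) :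
    D.a i j (D.Φ s t) = D.tr (D.Φ s t) * (D.tangent t i * D.tangent t j) := by
  have ht : t ∈ Icc 0 D.T := Ioo_subset_Icc_self h.1
  have hx := D.Φ_mem h
  have hker : ∀ ζ : E2, D.secondForm (D.Φ s t) (D.N t) ζ = 0 := fun ζ => by
    rw [secondForm, fderiv_normal_N hu h, inner_zero_left]
  have h0 := hker (e 0)
  have h1 := hker (e 1)
  rw [secondForm_eq_sum hu hx] at h0 h1
  simp only [PlanarChart.N, perp_zero_apply, perp_one_apply, e_zero_zero, e_zero_one, e_one_zero,
    e_one_one] at h0 h1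
  have hn : D.tangent t 0 ^ 2 + D.tangent t 1 ^ 2 = 1 := by
    rw [← norm_sq_e2, D.norm_tangent ht, one_pow]
  have hs := a_symm hu hx 1 0
  rw [tr]
  set p := D.tangent t 0
  set q := D.tangent t 1
  set A := D.a 0 0 (D.Φ s t)
  set B := D.a 0 1 (D.Φ s t)
  set C := D.a 1 1 (D.Φ s t)
  have k0 : A * q = B * p := by linarith
  have k1 : B * q = C * p := by linarith
  fin_cases i <;> fin_cases j
  · change A = (A + C) * (p * p)
    linear_combination (-A) * hn + q * k0 + p * k1
  · change B = (A + C) * (p * q)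
    linear_combination (-B) * hn - p * k0 + q * k1
  · change D.a 1 0 (D.Φ s t) = (A + C) * (q * p)
    rw [hs]
    linear_combination (-B) * hn - p * k0 + q * k1
  · change C = (A + C) * (q * q)
    linear_combination (-C) * hn - q * k0 - p * k1

/-- The normal turns in the direction `γ'`, at the rate given by the mean curvature. -/
theorem fderiv_normal_apply {s t : ℝ} (h : (s, t) ∈ D.M) (ξ : E2) :
    fderiv ℝ D.normal (D.Φ s t) ξ =
      (-D.tr (D.Φ s t) * inner ℝ ξ (D.tangent t)) • D.row 0 t := by
  have hx := D.Φ_mem h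
  have hT := fderiv_u_tangent (hu.of_le (by norm_num)) h
  have h0 := secondForm_eq_sum hu hx ξ (e 0)
  have h1 := secondForm_eq_sum hu hx ξ (e 1)
  rw [secondForm] at h0 h1
  rw [frame_expansion hu hx (fderiv ℝ D.normal (D.Φ s t) ξ), h0, h1,
    inner_fderiv_normal_normal hu hx, ← hT, vec_eq (D.tangent t), map_add, map_smul, map_smul,
    a_eq hu h, a_eq hu h, a_eq hu h, inner_e2]
  simp
  module

end Normal

end DevelopableSurface

end DevelopableShell

end

/-! ### Regularity of the ruled coordinates -/

noncomputable section

namespace DevelopableShell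

namespace DevelopableSurface

variable {D : DevelopableSurface}

theorem tr_ne_zero (hH : D.MeanCurvatureAwayFromZero) {x : E2} (hx : x ∈ D.Ω) : D.tr x ≠ 0 := by
  obtain ⟨c, hc, h⟩ := hH
  exact abs_pos.1 (hc.trans_le (h x hx))

/-- Parameters `(s, t)` of a point of `Ω`. -/
def param (D : DevelopableSurface) (x : E2) : ℝ × ℝ :=
  open Classical in if h : x ∈ D.Ω then h.choose else 0

/-- The arclength parameter of the segment through `x`. -/
def time (D : DevelopableSurface) (x : E2) : ℝ := (D.param x).2

/-- The signed distance from `x` to the curve along its segment. -/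
def height (D : DevelopableSurface) (x : E2) : ℝ := (D.param x).1

/-- The foot point of the segment through `x`. -/
def foot (D : DevelopableSurface) (x : E2) : E2 := D.Γ (D.time x)

theorem param_mem {x : E2} (hx : x ∈ D.Ω) : (D.height x, D.time x) ∈ D.M := by
  rw [height, time, param, dif_pos hx]
  exact hx.choose_spec.1

theorem Φ_param {x : E2} (hx : x ∈ D.Ω) : D.Φ (D.height x) (D.time x) = x := by
  rw [height, time, param, dif_pos hx]
  exact hx.choose_spec.2

theorem time_mem {x : E2} (hx : x ∈ D.Ω) : D.time x ∈ Ioo 0 D.T := (param_mem hx).1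

/-- The map `Φ` is injective on `M`, since distinct segments are disjoint. -/
theorem param_unique {s t s' t' : ℝ} (h : (s, t) ∈ D.M) (h' : (s', t') ∈ D.M)
    (heq : D.Φ s t = D.Φ s' t') : s = s' ∧ t = t' := by
  have ht : t = t' := by
    by_contra hne
    exact Set.disjoint_left.1 (D.disjoint_segments t (Ioo_subset_Icc_self h.1) t'
      (Ioo_subset_Icc_self h'.1) hne) ⟨s, h.2, rfl⟩ ⟨s', h'.2, heq.symm⟩
  subst ht
  refine ⟨?_, rfl⟩
  have hN : D.N t ≠ 0 := fun h0 => by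
    have := D.norm_N (Ioo_subset_Icc_self h.1)
    rw [h0, norm_zero] at this
    exact zero_ne_one this
  have h1 : s • D.N t = s' • D.N t := add_left_cancel heq
  exact smul_left_injective ℝ hN h1

theorem time_Φ {s t : ℝ} (h : (s, t) ∈ D.M) : D.time (D.Φ s t) = t :=
  (param_unique (param_mem (D.Φ_mem h)) h (Φ_param (D.Φ_mem h))).2

theorem height_Φ {s t : ℝ} (h : (s, t) ∈ D.M) : D.height (D.Φ s t) = s :=
  (param_unique (param_mem (D.Φ_mem h)) h (Φ_param (D.Φ_mem h))).1

theorem foot_Φ {s t : ℝ} (h : (s, t) ∈ D.M) : D.foot (D.Φ s t) = D.Γ t := by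
  rw [foot, time_Φ h]

theorem foot_mem {x : E2} (hx : x ∈ D.Ω) : D.foot x ∈ D.Ω := by
  rw [foot, ← D.Φ_zero]
  exact D.Φ_mem (D.zero_mem_M (time_mem hx))

theorem sub_foot {x : E2} (hx : x ∈ D.Ω) : x - D.foot x = D.height x • D.N (D.time x) := by
  have h : x = D.Γ (D.time x) + D.height x • D.N (D.time x) := (Φ_param hx).symm
  rw [foot]
  nth_rewrite 1 [h]
  rw [add_sub_cancel_left]

theorem smul_mem_M {s t l : ℝ} (h : (s, t) ∈ D.M) (hl : l ∈ Icc (0 : ℝ) 1) : (l * s, t) ∈ D.M := by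
  refine ⟨h.1, ?_⟩
  have ht := Ioo_subset_Icc_self h.1
  have h1 := D.sMinus_pos t ht
  have h2 := D.sPlus_pos t ht
  have h3 : -D.sMinus t < s := h.2.1
  have h4 : s < D.sPlus t := h.2.2
  constructor
  · change -D.sMinus t < l * s
    nlinarith [mul_nonneg hl.1 (sub_pos.2 h3).le, hl.2, hl.1,
      mul_nonneg (sub_nonneg.2 hl.2) h1.le]
  · change l * s < D.sPlus t
    nlinarith [mul_nonneg hl.1 (sub_pos.2 h4).le, hl.2, hl.1,
      mul_nonneg (sub_nonneg.2 hl.2) h2.le]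

theorem ray_eq {x : E2} (hx : x ∈ D.Ω) (l : ℝ) :
    ray D.foot l x = D.Φ (l * D.height x) (D.time x) := by
  rw [ray, sub_foot hx, smul_smul]; rfl

theorem ray_mem {x : E2} (hx : x ∈ D.Ω) {l : ℝ} (hl : l ∈ Icc (0 : ℝ) 1) :
    ray D.foot l x ∈ D.Ω := by
  rw [ray_eq hx]
  exact D.Φ_mem (smul_mem_M (param_mem hx) hl)

theorem foot_ray {x : E2} (hx : x ∈ D.Ω) {l : ℝ} (hl : l ∈ Icc (0 : ℝ) 1) :
    D.foot (ray D.foot l x) = D.foot x := by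
  rw [ray_eq hx, foot_Φ (smul_mem_M (param_mem hx) hl), foot]

/-- Two of the segments that lie on a common line and whose closures share a point which is
interior to the first one coincide. -/
theorem eq_of_collinear {s₀ t₀ s t : ℝ} (h₀ : (s₀, t₀) ∈ D.M) (ht : t ∈ Icc 0 D.T)
    (hs : s ∈ Icc (-D.sMinus t) (D.sPlus t)) (heq : D.Φ s₀ t₀ = D.Φ s t) {c : ℝ}
    (hN : D.N t = c • D.N t₀) : t = t₀ := by
  by_contra hne
  -- moving from the common point into the segment at `t` stays on the segment at `t₀`
  have hcont : Filter.Tendsto (fun l : ℝ => s₀ - c * l * s) (𝓝[>] 0) (𝓝 (s₀ - c * 0 * s)) := by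
    refine Continuous.tendsto' (by fun_prop) _ _ rfl |>.mono_left nhdsWithin_le_nhds
  have hmem : Ioo (-D.sMinus t₀) (D.sPlus t₀) ∈ 𝓝 (s₀ - c * 0 * s) := by
    simpa using isOpen_Ioo.mem_nhds h₀.2
  obtain ⟨l, hl, hl0⟩ := ((hcont.eventually hmem).and
    (Ioo_mem_nhdsGT (zero_lt_one' ℝ))).exists
  have h1 := D.sMinus_pos t ht
  have h2 := D.sPlus_pos t ht
  have hd := Set.disjoint_left.1 (D.disjoint_segments t ht t₀ (Ioo_subset_Icc_self h₀.1) hne)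
  refine @hd (D.Φ (s - l * s) t) ⟨s - l * s, ⟨?_, ?_⟩, rfl⟩ ⟨s₀ - c * l * s, hl, ?_⟩
  · nlinarith [mul_nonneg (sub_pos.2 hl0.2).le (sub_nonneg.2 hs.1), mul_pos hl0.1 h1]
  · nlinarith [mul_nonneg (sub_pos.2 hl0.2).le (sub_nonneg.2 hs.2), mul_pos hl0.1 h2]
  · simp only [PlanarChart.Φ] at heq ⊢
    have e1 : D.Γ t₀ + (s₀ - c * l * s) • D.N t₀ = (D.Γ t₀ + s₀ • D.N t₀) -
        (l * s) • c • D.N t₀ := by module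
    rw [e1, heq, ← hN]
    module

theorem continuousOn_a (hu : ContDiffOn ℝ 3 D.u D.Ω) (i j : Fin 2) :
    ContinuousOn (D.a i j) D.Ω := fun _ hx =>
  (hasFDerivAt_a hu hx i j).1.continuousAt.continuousWithinAt

section Regularity

variable (hu : ContDiffOn ℝ 3 D.u D.Ω) (hH : D.MeanCurvatureAwayFromZero)
include hu hH

/-- The segments depend continuously on the point: the kernel of `[a_ij]` is closed under limits, so
a limit of segments through nearby points is collinear with the segment through the limit point, and
disjointness forces them to agree. -/
theorem continuousOn_time : ContinuousOn D.time D.Ω := by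
  intro x₀ hx₀
  obtain ⟨h₀, hΦ₀⟩ : (D.height x₀, D.time x₀) ∈ D.M ∧ D.Φ (D.height x₀) (D.time x₀) = x₀ :=
    ⟨param_mem hx₀, Φ_param hx₀⟩
  -- by compactness it suffices to identify the cluster points of `time` at `x₀`
  refine isCompact_Icc.tendsto_nhds_of_unique_mapClusterPt (s := Icc 0 D.T) ?_ fun t ht hcl => ?_
  · filter_upwards [self_mem_nhdsWithin] with x hx using Ioo_subset_Icc_self (time_mem hx)
  obtain ⟨U, hU, hlim⟩ := mapClusterPt_iff_ultrafilter.1 hcl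
  have hUx : Filter.Tendsto (fun x : E2 => x) U (𝓝 x₀) := hU.trans nhdsWithin_le_nhds
  have hUΩ : ∀ᶠ x in (U : Filter E2), x ∈ D.Ω := hU self_mem_nhdsWithin
  have hlim' : Filter.Tendsto D.time U (𝓝[Icc 0 D.T] t) := tendsto_nhdsWithin_iff.2
    ⟨hlim, hUΩ.mono fun x hx => Ioo_subset_Icc_self (time_mem hx)⟩
  have hΓ := (D.continuousOn_Γ t ht).tendsto.comp hlim'
  have hT := (D.continuousOn_tangent t ht).tendsto.comp hlim'
  have hN := (D.continuousOn_N t ht).tendsto.comp hlim'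
  have hm := (D.continuousOn_sMinus t ht).tendsto.comp hlim'
  have hp := (D.continuousOn_sPlus t ht).tendsto.comp hlim'
  have hUΩ' : Filter.Tendsto (fun x : E2 => x) U (𝓝[D.Ω] x₀) := hU
  have ha : ∀ i j, Filter.Tendsto (D.a i j) U (𝓝 (D.a i j x₀)) := fun i j =>
    (continuousOn_a hu i j x₀ hx₀).tendsto.comp hUΩ'
  have hcoord : ∀ i : Fin 2, Filter.Tendsto (fun x => D.N (D.time x) i) U (𝓝 (D.N t i)) :=
    fun i => ((EuclideanSpace.proj (𝕜 := ℝ) i).continuous.tendsto _).comp hN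
  -- the limit of the rulings is in the kernel of `[a_ij]`
  have hker : ∀ i, D.a i 0 x₀ * D.N t 0 + D.a i 1 x₀ * D.N t 1 = 0 := by
    intro i
    refine tendsto_nhds_unique (((ha i 0).mul (hcoord 0)).add ((ha i 1).mul (hcoord 1)))
      (tendsto_const_nhds.congr' ?_)
    filter_upwards [hUΩ] with x hx
    have e1 : ∀ j, D.a i j x = D.tr x * (D.tangent (D.time x) i * D.tangent (D.time x) j) :=
      fun j => by
        have := a_eq hu (param_mem hx) i j
        rwa [Φ_param hx] at this
    rw [e1, e1]
    simp [PlanarChart.N]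
    ring
  have htr := tr_ne_zero hH hx₀
  have ht₀ := Ioo_subset_Icc_self h₀.1
  have hn₀ : D.tangent (D.time x₀) 0 ^ 2 + D.tangent (D.time x₀) 1 ^ 2 = 1 := by
    rw [← norm_sq_e2, D.norm_tangent ht₀, one_pow]
  have e1 : ∀ i j, D.a i j x₀ = D.tr x₀ * (D.tangent (D.time x₀) i * D.tangent (D.time x₀) j) :=
    fun i j => by
      have := a_eq hu h₀ i j
      rwa [hΦ₀] at this
  have horth : inner ℝ (D.N t) (D.tangent (D.time x₀)) = 0 := by
    have k0 := hker 0
    have k1 := hker 1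
    rw [e1, e1] at k0 k1
    rw [inner_e2]
    refine mul_left_cancel₀ htr ?_
    linear_combination D.tangent (D.time x₀) 0 * k0 + D.tangent (D.time x₀) 1 * k1 -
      D.tr x₀ * (D.N t 0 * D.tangent (D.time x₀) 0 + D.N t 1 * D.tangent (D.time x₀) 1) * hn₀
  set c : ℝ := inner ℝ (D.N t) (D.N (D.time x₀)) with hc
  have hNt : D.N t = c • D.N (D.time x₀) := by
    conv_lhs => rw [eq_smul_add_smul_perp (D.norm_tangent ht₀) (D.N t), horth, zero_smul, zero_add]
    rfl
  -- the limit segment passes through `x₀`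
  have hheight : Filter.Tendsto (fun x => (inner ℝ (x - D.Γ (D.time x)) (D.N (D.time x)) : ℝ)) U
      (𝓝 (inner ℝ (x₀ - D.Γ t) (D.N t))) := (hUx.sub hΓ).inner hN
  have hval : ∀ x ∈ D.Ω, (inner ℝ (x - D.Γ (D.time x)) (D.N (D.time x)) : ℝ) = D.height x := by
    intro x hx
    rw [← foot, sub_foot hx, real_inner_smul_left, real_inner_self_eq_norm_sq,
      D.norm_N (Ioo_subset_Icc_self (time_mem hx))]
    ring
  set s : ℝ := inner ℝ (x₀ - D.Γ t) (D.N t) with hs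
  have hline : x₀ = D.Φ s t := by
    have h1 : Filter.Tendsto (fun x => D.Γ (D.time x) +
        (inner ℝ (x - D.Γ (D.time x)) (D.N (D.time x)) : ℝ) • D.N (D.time x)) U
        (𝓝 (D.Γ t + s • D.N t)) := hΓ.add (hheight.smul hN)
    refine tendsto_nhds_unique hUx (h1.congr' ?_)
    filter_upwards [hUΩ] with x hx
    rw [hval x hx]
    exact Φ_param hx
  have hsI : s ∈ Icc (-D.sMinus t) (D.sPlus t) := by
    constructor
    · refine le_of_tendsto_of_tendsto hm.neg hheight ?_
      filter_upwards [hUΩ] with x hx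
      rw [hval x hx]
      exact (param_mem hx).2.1.le
    · refine le_of_tendsto_of_tendsto hheight hp ?_
      filter_upwards [hUΩ] with x hx
      rw [hval x hx]
      exact (param_mem hx).2.2.le
  exact eq_of_collinear h₀ ht hsI (hΦ₀.trans hline) hNt

theorem continuousOn_foot : ContinuousOn D.foot D.Ω :=
  D.continuousOn_Γ.comp (continuousOn_time hu hH) fun _ hx => Ioo_subset_Icc_self (time_mem hx)

/-- The time function is differentiable because the normal is a function of time with nonvanishing
derivative. -/
theorem hasFDerivAt_time {x : E2} (hx : x ∈ D.Ω) :
    HasFDerivAt D.time ((D.tr x / D.tr (D.foot x)) • innerSL ℝ (D.tangent (D.time x))) x := by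
  set t₀ := D.time x with ht₀
  have hM := param_mem hx
  have ht : t₀ ∈ Ioo 0 D.T := time_mem hx
  have hrow : inner ℝ (D.row 0 t₀) (D.row 0 t₀) = (1 : ℝ) := by
    simpa using D.inner_row (Ioo_subset_Icc_self ht) 0 0
  have hΓs : HasStrictDerivAt D.Γ (D.tangent t₀) t₀ := by
    refine hasStrictDerivAt_of_hasDerivAt_of_continuousAt (f' := D.tangent) ?_
      (D.continuousOn_tangent.continuousAt (D.Icc_mem_nhds ht))
    filter_upwards [isOpen_Ioo.mem_nhds ht] with τ hτ using D.hasDerivAt_Γ hτ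
  have hΓt : D.Γ t₀ = D.Φ 0 t₀ := (D.Φ_zero t₀).symm
  have hΓΩ : D.Γ t₀ ∈ D.Ω := foot_mem hx
  have hns : HasStrictFDerivAt D.normal (fderiv ℝ D.normal (D.Γ t₀)) (D.Γ t₀) :=
    ((contDiffOn_normal hu).contDiffAt (isOpen_Ω.mem_nhds hΓΩ)).hasStrictFDerivAt (by norm_num)
  -- the component of the normal along `γ'(t₀)` is a local coordinate for the time
  let ℓ : E3 →L[ℝ] ℝ := innerSL ℝ (D.row 0 t₀)
  have hν : HasStrictDerivAt (fun τ => ℓ (D.normal (D.Γ τ))) (-D.tr (D.Γ t₀)) t₀ := by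
    have h1 := ℓ.hasStrictFDerivAt.comp_hasStrictDerivAt t₀ (hns.comp_hasStrictDerivAt t₀ hΓs)
    refine h1.congr_deriv ?_
    rw [hΓt, fderiv_normal_apply hu (D.zero_mem_M ht), map_smul]
    simp only [ℓ, innerSL_apply_apply, hrow, real_inner_self_eq_norm_sq,
      D.norm_tangent (Ioo_subset_Icc_self ht)]
    simp
  have hc : -D.tr (D.Γ t₀) ≠ 0 := neg_ne_zero.2 (tr_ne_zero hH hΓΩ)
  have hleft := (hν.hasStrictFDerivAt_equiv hc).eventually_left_inverse
  have hinv := (hν.to_localInverse hc).hasDerivAt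
  have hnx : D.normal x = D.normal (D.Γ t₀) := by
    have h1 := normal_Φ hu hM
    rw [Φ_param hx] at h1
    rw [h1, hΓt, normal_Φ hu (D.zero_mem_M ht)]
  have hcomp : HasFDerivAt (fun y => ℓ (D.normal y)) (ℓ.comp (fderiv ℝ D.normal x)) x :=
    ℓ.hasFDerivAt.comp x (hasFDerivAt_normal hu hx)
  have hfin : HasFDerivAt (fun y => hν.localInverse _ _ _ hc (ℓ (D.normal y)))
      ((-D.tr (D.Γ t₀))⁻¹ • ℓ.comp (fderiv ℝ D.normal x)) x := by
    have h2 : HasDerivAt (hν.localInverse _ _ _ hc) (-D.tr (D.Γ t₀))⁻¹ (ℓ (D.normal x)) := by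
      rw [hnx]; exact hinv
    exact h2.comp_hasFDerivAt x hcomp
  have hev : D.time =ᶠ[𝓝 x] fun y => hν.localInverse _ _ _ hc (ℓ (D.normal y)) := by
    have htc : ContinuousAt D.time x :=
      (continuousOn_time hu hH).continuousAt (isOpen_Ω.mem_nhds hx)
    filter_upwards [htc.eventually hleft, isOpen_Ω.mem_nhds hx] with y hy hyΩ
    have h1 : D.normal y = D.normal (D.Γ (D.time y)) := by
      have h1 := normal_Φ hu (param_mem hyΩ)
      rw [Φ_param hyΩ] at h1
      rw [h1, ← D.Φ_zero, normal_Φ hu (D.zero_mem_M (time_mem hyΩ))]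
    rw [h1]
    exact hy.symm
  refine (hfin.congr_of_eventuallyEq hev).congr_fderiv ?_
  ext ξ
  have h3 := fderiv_normal_apply hu hM ξ
  rw [Φ_param hx, ← ht₀] at h3
  simp only [smul_apply, ContinuousLinearMap.comp_apply, smul_eq_mul, innerSL_apply_apply]
  rw [h3, map_smul]
  simp only [ℓ, innerSL_apply_apply, hrow, smul_eq_mul, mul_one, foot, ← ht₀]
  rw [real_inner_comm]
  have := tr_ne_zero hH hΓΩ
  field_simp

theorem hasFDerivAt_foot {x : E2} (hx : x ∈ D.Ω) :
    HasFDerivAt D.foot (((D.tr x / D.tr (D.foot x)) • innerSL ℝ (D.tangent (D.time x))).smulRight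
      (D.tangent (D.time x))) x :=
  ((D.hasDerivAt_Γ (time_mem hx)).hasFDerivAt.comp x (hasFDerivAt_time hu hH hx)).congr_fderiv
    (by ext; simp [mul_assoc])

/-- The derivative of the foot point map is `a(x) / tr a(π x)`. -/
theorem fderiv_foot_apply {x : E2} (hx : x ∈ D.Ω) (i j : Fin 2) :
    fderiv ℝ D.foot x (e j) i = (D.tr (D.foot x))⁻¹ * D.a i j x := by
  have h := a_eq hu (param_mem hx) i j
  rw [Φ_param hx] at h
  rw [(hasFDerivAt_foot hu hH hx).fderiv, h]
  fin_cases j <;> simp [inner_e2] <;> ring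

/-- The unit tangent is differentiable although the curve is only assumed to be `C^{1,1}`: up to
sign it is determined by `[a_ij]`. -/
theorem hasDerivAt_tangent {t : ℝ} (ht : t ∈ Ioo 0 D.T) :
    HasDerivAt D.tangent (D.κ t • D.N t) t := by
  refine D.hasDerivAt_tangent_of_differentiableAt ht ?_
  have hΓΩ : ∀ τ ∈ Ioo 0 D.T, D.Γ τ ∈ D.Ω := fun τ hτ => by
    rw [← D.Φ_zero]; exact D.Φ_mem (D.zero_mem_M hτ)
  have had : ∀ i j, DifferentiableAt ℝ (fun τ => D.a i j (D.Γ τ)) t := fun i j =>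
    ((hasFDerivAt_a hu (hΓΩ t ht) i j).1.comp_hasDerivAt t (D.hasDerivAt_Γ ht)).differentiableAt
  have htrd : DifferentiableAt ℝ (fun τ => D.tr (D.Γ τ)) t := (had 0 0).add (had 1 1)
  have htr : ∀ τ ∈ Ioo 0 D.T, D.tr (D.Γ τ) ≠ 0 := fun τ hτ => tr_ne_zero hH (hΓΩ τ hτ)
  have ha : ∀ τ ∈ Ioo 0 D.T, ∀ i j, D.a i j (D.Γ τ) / D.tr (D.Γ τ) =
      D.tangent τ i * D.tangent τ j := fun τ hτ i j => by
    have h := a_eq hu (D.zero_mem_M hτ) i j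
    rw [D.Φ_zero] at h
    rw [h, mul_div_cancel_left₀ _ (htr τ hτ)]
  have hmd : ∀ i j, DifferentiableAt ℝ (fun τ => D.a i j (D.Γ τ) / D.tr (D.Γ τ)) t := fun i j =>
    (had i j).div htrd (htr t ht)
  -- near `t`, the tangent is `m / √q`, with `m = (Γ' ⊗ Γ') ξ` and `q = ⟨m, ξ⟩`
  set ξ := D.tangent t with hξ
  let m : ℝ → Fin 2 → ℝ := fun τ i => D.a i 0 (D.Γ τ) / D.tr (D.Γ τ) * ξ 0 +
    D.a i 1 (D.Γ τ) / D.tr (D.Γ τ) * ξ 1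
  have hm : ∀ i, DifferentiableAt ℝ (fun τ => m τ i) t := fun i =>
    ((hmd i 0).mul_const _).add ((hmd i 1).mul_const _)
  let q : ℝ → ℝ := fun τ => m τ 0 * ξ 0 + m τ 1 * ξ 1
  have hq : DifferentiableAt ℝ q t := ((hm 0).mul_const _).add ((hm 1).mul_const _)
  have hme : ∀ τ ∈ Ioo 0 D.T, ∀ i, m τ i = D.tangent τ i * inner ℝ (D.tangent τ) ξ := by
    intro τ hτ i
    simp only [m]
    rw [ha τ hτ, ha τ hτ, inner_e2]; ring
  have hqe : ∀ τ ∈ Ioo 0 D.T, q τ = (inner ℝ (D.tangent τ) ξ : ℝ) ^ 2 := by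
    intro τ hτ
    simp only [q]
    rw [hme τ hτ, hme τ hτ, inner_e2]; ring
  have hξ1 : (inner ℝ (D.tangent t) ξ : ℝ) = 1 := by
    rw [← hξ, real_inner_self_eq_norm_sq, D.norm_tangent (Ioo_subset_Icc_self ht), one_pow]
  have hpos : ∀ᶠ τ in 𝓝 t, 0 < (inner ℝ (D.tangent τ) ξ : ℝ) := by
    have hc : ContinuousAt (fun τ => (inner ℝ (D.tangent τ) ξ : ℝ)) t :=
      (D.continuousOn_tangent.continuousAt (D.Icc_mem_nhds ht)).inner continuousAt_const
    refine hc.eventually (lt_mem_nhds ?_)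
    change 0 < (inner ℝ (D.tangent t) ξ : ℝ)
    rw [hξ1]; exact one_pos
  have hcomp : ∀ i, DifferentiableAt ℝ (fun τ => D.tangent τ i) t := by
    intro i
    have hq1 : q t = 1 := by rw [hqe t ht, hξ1, one_pow]
    have h1 : DifferentiableAt ℝ (fun τ => m τ i / Real.sqrt (q τ)) t :=
      (hm i).div (hq.sqrt (by rw [hq1]; exact one_ne_zero)) (by rw [hq1]; simp)
    refine h1.congr_of_eventuallyEq ?_
    filter_upwards [hpos, isOpen_Ioo.mem_nhds ht] with τ hτ hτI
    rw [hqe τ hτI, Real.sqrt_sq hτ.le, hme τ hτI, mul_div_cancel_right₀ _ hτ.ne']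
  have hpi : DifferentiableAt ℝ (fun τ => (WithLp.ofLp (D.tangent τ) : Fin 2 → ℝ)) t :=
    differentiableAt_pi.2 hcomp
  exact (PiLp.continuousLinearEquiv 2 ℝ (fun _ : Fin 2 => ℝ)).symm.differentiableAt.comp t hpi

/-- The mean curvature along a segment is inversely proportional to the Jacobian `1 - s κ` of the
ruled coordinates, because the normal does not depend on `s`. -/
theorem jacobian_eq {s t : ℝ} (h : (s, t) ∈ D.M) :
    (1 - s * D.κ t) * D.tr (D.Φ s t) = D.tr (D.Γ t) := by
  have hΓ := D.zero_mem_M h.1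
  have ht := Ioo_subset_Icc_self h.1
  have h1 := (hasFDerivAt_normal hu (D.Φ_mem h)).comp_hasDerivAt t
    (D.hasDerivAt_Φ_right (s := s) h.1 (hasDerivAt_tangent hu hH h.1))
  have h2 := (hasFDerivAt_normal hu (D.Φ_mem hΓ)).comp_hasDerivAt t
    (D.hasDerivAt_Φ_right (s := 0) h.1 (hasDerivAt_tangent hu hH h.1))
  have h3 : D.normal ∘ (fun τ => D.Φ s τ) =ᶠ[𝓝 t] D.normal ∘ fun τ => D.Φ 0 τ := by
    filter_upwards [D.eventually_mem_M h] with τ hτ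
    simp only [Function.comp_apply]
    rw [normal_Φ hu hτ, normal_Φ hu (D.zero_mem_M hτ.1)]
  have h4 := h1.unique (h2.congr_of_eventuallyEq h3)
  rw [fderiv_normal_apply hu h, fderiv_normal_apply hu hΓ, real_inner_smul_left,
    real_inner_smul_left, real_inner_self_eq_norm_sq, D.norm_tangent ht, D.Φ_zero] at h4
  have hrow : D.row 0 t ≠ 0 := fun h0 => by
    have := D.inner_row ht 0 0
    rw [h0] at this
    simp at this
  have h5 := smul_left_injective ℝ hrow h4
  simp only at h5
  linarith

/-- There are no focal points, since the mean curvature vanishes nowhere. -/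
theorem jacobian_ne_zero {s t : ℝ} (h : (s, t) ∈ D.M) : 1 - s * D.κ t ≠ 0 := fun h0 => by
  have h1 := jacobian_eq hu hH h
  rw [h0, zero_mul, ← D.Φ_zero] at h1
  exact tr_ne_zero hH (D.Φ_mem (D.zero_mem_M h.1)) h1.symm

end Regularity

end DevelopableSurface

end DevelopableShell

end

/-! ### Estimates for the geometric coefficients -/

noncomputable section

namespace DevelopableShell

section Rays

variable {Ω : Set E2} {π : E2 → E2}

theorem ray_one (π : E2 → E2) (x : E2) : ray π 1 x = x := by simp [ray]

/-- Along the segments the ray means with weight `l ^ j` solve a first order equation. -/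
theorem fderiv_rayMean_sub (hray : ∀ x ∈ Ω, ∀ l ∈ Icc (0 : ℝ) 1, ray π l x ∈ Ω)
    (hfoot : ∀ x ∈ Ω, ∀ l ∈ Icc (0 : ℝ) 1, π (ray π l x) = π x) {h : E2 → ℝ}
    (hh : ContinuousOn h Ω) (j : ℕ) {x : E2} (hx : x ∈ Ω)
    (hd : DifferentiableAt ℝ (rayMean π (fun l => l ^ j) h) x) :
    fderiv ℝ (rayMean π (fun l => l ^ j) h) x (x - π x) =
      h x - (j + 1) * rayMean π (fun l => l ^ j) h x := by
  set P := rayMean π (fun l => l ^ j) h with hP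
  let g : ℝ → ℝ := fun σ => σ ^ j * h (ray π σ x)
  have hg : ContinuousOn g (Icc 0 1) :=
    continuousOn_rayMean_integrand hray (continuous_pow j) hh hx
  have hone : (1 : ℝ) ∈ Icc (0 : ℝ) 1 := right_mem_Icc.2 zero_le_one
  have hrr : ∀ μ ∈ Icc (0 : ℝ) 1, ∀ l, ray π l (ray π μ x) = ray π (l * μ) x := by
    intro μ hμ l
    rw [ray, hfoot x hx μ hμ, ray, ray, add_sub_cancel_left, smul_smul]
  have hscale : ∀ μ ∈ Icc (0 : ℝ) 1, μ ^ (j + 1) * P (ray π μ x) = ∫ σ in (0 : ℝ)..μ, g σ := by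
    intro μ hμ
    have h1 := intervalIntegral.mul_integral_comp_mul_right (a := 0) (b := 1) (f := g) μ
    rw [zero_mul, one_mul] at h1
    rw [← h1, hP, rayMean, pow_succ, mul_comm (μ ^ j), mul_assoc,
      ← intervalIntegral.integral_const_mul]
    congr 1
    refine intervalIntegral.integral_congr fun l _ => ?_
    simp only [g, smul_eq_mul, hrr μ hμ l, mul_pow]
    ring
  have hleft : HasDerivWithinAt (fun μ : ℝ => μ ^ (j + 1) * P (ray π μ x))
      ((j + 1) * P x + fderiv ℝ P x (x - π x)) (Icc 0 1) 1 := by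
    have h1 : HasDerivAt (fun l : ℝ => ray π l x) (x - π x) 1 := by
      simpa [ray] using ((hasDerivAt_id (1 : ℝ)).smul_const (x - π x)).const_add (π x)
    have h2 : HasFDerivAt P (fderiv ℝ P x) (ray π 1 x) := by rw [ray_one]; exact hd.hasFDerivAt
    have h3 := (hasDerivAt_pow (j + 1) (1 : ℝ)).mul (h2.comp_hasDerivAt (1 : ℝ) h1)
    refine (h3.congr_deriv ?_).hasDerivWithinAt
    simp [ray_one]
  have hright : HasDerivWithinAt (fun μ : ℝ => ∫ σ in (0 : ℝ)..μ, g σ) (g 1) (Icc 0 1) 1 := by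
    have : Fact ((1 : ℝ) ∈ Icc (0 : ℝ) 1) := ⟨hone⟩
    exact intervalIntegral.integral_hasDerivWithinAt_right
      (hg.intervalIntegrable_of_Icc zero_le_one)
      (hg.stronglyMeasurableAtFilter_nhdsWithin measurableSet_Icc 1) (hg 1 hone)
  have h4 := (uniqueDiffOn_Icc (zero_lt_one' ℝ) 1 hone).eq_deriv _ hleft
    (hright.congr hscale (hscale 1 hone))
  simp only [g, one_pow, one_mul, ray_one] at h4
  linarith

end Rays

namespace DevelopableSurface

variable {D : DevelopableSurface}

/-- A surface of class `C^{m+3,1}` with mean curvature bounded away from zero, in the form in which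
the estimates use it. -/
structure IsRegular (D : DevelopableSurface) (m : ℕ) (L : ℝ) : Prop where
  quasiconvex : Quasiconvex L D.Ω
  contDiffOn : ContDiffOn ℝ 3 D.u D.Ω
  bound : ∃ A, 0 ≤ A ∧ CkBound (m + 3) D.Ω A D.u
  curved : D.MeanCurvatureAwayFromZero

theorem exists_isRegular {m : ℕ} (hS : D.IsOfClass (m + 3)) (hH : D.MeanCurvatureAwayFromZero) :
    ∃ L, D.IsRegular m L := by
  obtain ⟨L, hL⟩ := D.lipschitz_domain.quasiconvex
  exact ⟨L, hL, hS.1.of_le (by norm_cast; omega), ⟨_, ENNReal.toReal_nonneg,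
    MemCk.ckBound isOpen_Ω hS⟩, hH⟩

theorem exists_norm_sub_le (D : DevelopableSurface) :
    ∃ R, 0 ≤ R ∧ ∀ x ∈ D.Ω, ∀ y ∈ D.Ω, ‖x - y‖ ≤ R := by
  refine ⟨Metric.diam D.Ω, Metric.diam_nonneg, fun x hx y hy => ?_⟩
  rw [← dist_eq_norm]
  exact Metric.dist_le_diam_of_mem D.lipschitz_domain.isBounded hx hy

theorem volume_Ω_ne_top (D : DevelopableSurface) : volume D.Ω ≠ ⊤ :=
  D.lipschitz_domain.isBounded.measure_lt_top.ne

namespace IsRegular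

variable {ι : Type} {m : ℕ} {L : ℝ} (hD : D.IsRegular m L)
include hD

theorem family_u : CkFamily (m + 3) D.Ω (fun _ : ι => 1) (fun _ => D.u) :=
  hD.bound.choose_spec.2.family hD.bound.choose_spec.1

theorem family_fderiv_u (ζ : E2) :
    CkFamily (m + 2) D.Ω (fun _ : ι => 1) (fun _ x => fderiv ℝ D.u x ζ) :=
  hD.family_u.fderiv.clm isOpen_Ω (ContinuousLinearMap.apply ℝ E3 ζ)

theorem family_normal : CkFamily (m + 2) D.Ω (fun _ : ι => 1) (fun _ => D.normal) :=
  ((hD.family_fderiv_u (e 0)).bilin hD.quasiconvex crossL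
    (hD.family_fderiv_u (e 1))).weight_congr fun _ => one_mul _

theorem family_a (i j : Fin 2) : CkFamily (m + 1) D.Ω (fun _ : ι => 1) (fun _ => D.a i j) :=
  ((hD.family_normal.of_le hD.quasiconvex (Nat.le_succ _)).inner hD.quasiconvex
    ((hD.family_u.fderiv.fderiv.clm isOpen_Ω (ContinuousLinearMap.apply ℝ _ (e i))).clm isOpen_Ω
      (ContinuousLinearMap.apply ℝ E3 (e j)))).weight_congr fun _ => one_mul _

theorem family_tr : CkFamily (m + 1) D.Ω (fun _ : ι => 1) (fun _ => D.tr) :=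
  (hD.family_a 0 0).add isOpen_Ω (hD.family_a 1 1)

theorem family_inv_tr : CkFamily (m + 1) D.Ω (fun _ : ι => 1) (fun _ x => (D.tr x)⁻¹) := by
  obtain ⟨c, hc, h⟩ := hD.curved
  exact CkFamily.inv hD.quasiconvex hc h hD.family_tr

theorem fderiv_foot_eq {x : E2} (hx : x ∈ D.Ω) : fderiv ℝ D.foot x =
    (D.tr (D.foot x))⁻¹ • ((D.a 0 0 x • dx 0 + D.a 0 1 x • dx 1).smulRight (e 0) +
      (D.a 1 0 x • dx 0 + D.a 1 1 x • dx 1).smulRight (e 1)) := by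
  have h := fun i j => fderiv_foot_apply hD.contDiffOn hD.curved hx i j
  ext ξ i
  conv_lhs => rw [vec_eq ξ, map_add, map_smul, map_smul]
  fin_cases i <;> simp [h] <;> ring

theorem hasFDerivAt_foot {x : E2} (hx : x ∈ D.Ω) :
    HasFDerivAt D.foot (fderiv ℝ D.foot x) x :=
  (DevelopableSurface.hasFDerivAt_foot hD.contDiffOn hD.curved hx).differentiableAt.hasFDerivAt

theorem family_matrix : CkFamily (m + 1) D.Ω (fun _ : ι => 1) (fun _ x =>
    (D.a 0 0 x • dx 0 + D.a 0 1 x • dx 1).smulRight (e 0) +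
      (D.a 1 0 x • dx 0 + D.a 1 1 x • dx 1).smulRight (e 1)) := by
  have key : ∀ i j k, CkFamily (m + 1) D.Ω (fun _ : ι => 1)
      (fun _ x => D.a i j x • (dx j).smulRight (e k)) := fun i j k =>
    (hD.family_a i j).clm isOpen_Ω
      ((ContinuousLinearMap.lsmul ℝ ℝ).flip ((dx j).smulRight (e k)))
  refine ((((key 0 0 0).add isOpen_Ω (key 0 1 0)).add isOpen_Ω
    ((key 1 0 1).add isOpen_Ω (key 1 1 1)))).congr isOpen_Ω fun i x _ => ?_
  ext ξ
  simp
  ring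

/-- The foot point map gains regularity from its own derivative. -/
theorem family_foot : CkFamily (m + 1) D.Ω (fun _ : ι => 1) (fun _ => D.foot) := by
  have hΩ := hD.quasiconvex
  obtain ⟨B, hB⟩ : ∃ B, ∀ x ∈ D.Ω, ‖x‖ ≤ B :=
    D.lipschitz_domain.isBounded.exists_norm_le
  have hfoot : ∀ x ∈ D.Ω, ‖D.foot x‖ ≤ B := fun x hx => hB _ (foot_mem hx)
  have hdiff : DifferentiableOn ℝ D.foot D.Ω := fun x hx =>
    (hD.hasFDerivAt_foot hx).differentiableAt.differentiableWithinAt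
  obtain ⟨c, hc, hcH⟩ := hD.curved
  obtain ⟨C, hC0, hC⟩ : ∃ C, 0 ≤ C ∧ ∀ x ∈ D.Ω, ‖fderiv ℝ D.foot x‖ ≤ C := by
    obtain ⟨C, hC0, hC⟩ := (hD.family_matrix (ι := Unit)).2
    refine ⟨c⁻¹ * (C * 1), by positivity, fun x hx => ?_⟩
    rw [hD.fderiv_foot_eq hx, norm_smul, norm_inv]
    gcongr
    · exact hcH _ (foot_mem hx)
    · exact (hC ()).norm_le hx
  suffices H : ∀ j ≤ m + 1, CkFamily j D.Ω (fun _ : ι => 1) (fun _ => D.foot) from H _ le_rfl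
  intro j
  induction j with
  | zero =>
    intro _
    have hL := hΩ.one_le
    refine ⟨fun _ => zero_le_one, |B| + L * C, by positivity,
      fun i => ⟨fun x hx => ?_, fun x hx y hy => ?_⟩⟩
    · have h2 : 0 ≤ L * C := by positivity
      linarith [hfoot x hx, le_abs_self B]
    · refine (hΩ.norm_sub_le hdiff hC hx hy).trans ?_
      refine mul_le_mul_of_nonneg_right ?_ (norm_nonneg _)
      linarith [abs_nonneg B]
  | succ j ih =>
    intro hj
    have h1 := ih (by omega)
    have h2 : CkFamily j D.Ω (fun _ : ι => 1) (fun _ x => (D.tr (D.foot x))⁻¹) :=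
      CkFamily.comp (f := fun _ x => (D.tr x)⁻¹) hΩ (fun _ hx => foot_mem hx) h1
        (hD.family_inv_tr.of_le hΩ (by omega))
    have h3 := (h2.smul hΩ (hD.family_matrix.of_le hΩ (by omega : j ≤ m + 1))).weight_congr
      (M := fun _ => 1) (by simp)
    refine h3.succ isOpen_Ω (C := B) (fun i x hx => ?_) (fun i x hx => by simpa using hfoot x hx)
    rw [← hD.fderiv_foot_eq hx]
    exact hD.hasFDerivAt_foot hx

end IsRegular

end DevelopableSurface

end DevelopableShell

end

noncomputable section

namespace DevelopableShell

theorem _root_.LipschitzOnWith.ae_differentiableAt_of_isOpen {F : Type} [NormedAddCommGroup F]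
    [NormedSpace ℝ F] [FiniteDimensional ℝ F] {Ω : Set E2} {K : ℝ≥0} {f : E2 → F}
    (hf : LipschitzOnWith K f Ω) (hΩ : IsOpen Ω) :
    ∀ᵐ x ∂(volume.restrict Ω), DifferentiableAt ℝ f x := by
  rw [ae_restrict_iff' hΩ.measurableSet]
  filter_upwards [hf.ae_differentiableWithinAt_of_mem] with x hx hxΩ
  exact (hx hxΩ).differentiableAt (hΩ.mem_nhds hxΩ)

namespace DevelopableSurface

variable {D : DevelopableSurface}

theorem IsRegular.ae_differentiableAt {F : Type} [NormedAddCommGroup F]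
    [NormedSpace ℝ F] [FiniteDimensional ℝ F] {ι : Type} {k m : ℕ} {L : ℝ} (hD : D.IsRegular m L)
    {N : ι → ℝ} {f : ι → E2 → F} (hf : CkFamily k D.Ω N f) (i : ι) :
    ∀ᵐ x ∂(volume.restrict D.Ω), DifferentiableAt ℝ (f i) x :=
  (hf.lipschitzOnWith hD.quasiconvex i).choose_spec.ae_differentiableAt_of_isOpen isOpen_Ω

theorem ae_mem_Ω : ∀ᵐ x ∂(volume.restrict D.Ω), x ∈ D.Ω :=
  ae_restrict_mem isOpen_Ω.measurableSet

theorem integrableOn_of_continuousOn {F : Type} [NormedAddCommGroup F] {f : E2 → F}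
    (hf : ContinuousOn f D.Ω) {C : ℝ} (hC : ∀ x ∈ D.Ω, ‖f x‖ ≤ C) : IntegrableOn f D.Ω :=
  IntegrableOn.of_bound D.volume_Ω_ne_top.lt_top
    (hf.aestronglyMeasurable isOpen_Ω.measurableSet) C
    ((ae_restrict_iff' isOpen_Ω.measurableSet).2 (Filter.Eventually.of_forall hC))

theorem nonempty_Ω (D : DevelopableSurface) : D.Ω.Nonempty :=
  D.lipschitz_domain.isConnected.nonempty

/-- Families of one-forms which are closed almost everywhere have primitives with mean zero, and
these gain one derivative. -/
theorem IsRegular.exists_primitive {ι : Type} {k m : ℕ} {L : ℝ} (hD : D.IsRegular m L)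
    {N : ι → ℝ} {V W : ι → E2 → ℝ} (hV : CkFamily k D.Ω N V) (hW : CkFamily k D.Ω N W)
    (hcl : ∀ i, ∀ᵐ x ∂(volume.restrict D.Ω),
      fderiv ℝ (W i) x (e 0) = fderiv ℝ (V i) x (e 1)) :
    ∃ v : ι → E2 → ℝ, CkFamily (k + 1) D.Ω N v ∧
      (∀ i, ∀ x ∈ D.Ω, HasFDerivAt (v i) (covec (V i x) (W i x)) x) ∧
      ∀ i, ∫ x in D.Ω, v i x = 0 := by
  have hΩ := hD.quasiconvex
  obtain ⟨R, hR0, hR⟩ := D.exists_norm_sub_le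
  have hΓΩ : ∀ τ ∈ Ioo 0 D.T, D.Γ τ ∈ D.Ω := fun τ hτ => by
    rw [← D.Φ_zero]; exact D.Φ_mem (D.zero_mem_M hτ)
  have h1 : ∀ i, ∃ v : E2 → ℝ, ∀ x ∈ D.Ω, HasFDerivAt v (covec (V i x) (W i x)) x := fun i =>
    exists_primitive_of_ruled isOpen_Ω ⟨R, hR⟩ (fun x hx l hl => ray_mem hx hl)
      (continuousOn_foot hD.contDiffOn hD.curved) (continuousOn_time hD.contDiffOn hD.curved)
      (fun x hx => time_mem hx) (fun x _ => rfl) hΓΩ (fun τ hτ => D.hasDerivAt_Γ hτ)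
      (D.continuousOn_tangent.mono Ioo_subset_Icc_self)
      (hV.lipschitzOnWith hΩ i).choose_spec (hW.lipschitzOnWith hΩ i).choose_spec (hcl i)
  choose v₀ hv₀ using h1
  let v : ι → E2 → ℝ := fun i x => v₀ i x - ⨍ y in D.Ω, v₀ i y
  have hv : ∀ i, ∀ x ∈ D.Ω, HasFDerivAt (v i) (covec (V i x) (W i x)) x := fun i x hx =>
    (hv₀ i x hx).sub_const _
  have hcov : CkFamily k D.Ω N (fun i x => covec (V i x) (W i x)) :=
    (hV.clm isOpen_Ω ((ContinuousLinearMap.lsmul ℝ ℝ).flip (dx 0))).add isOpen_Ω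
      (hW.clm isOpen_Ω ((ContinuousLinearMap.lsmul ℝ ℝ).flip (dx 1)))
  obtain ⟨hN, C, hC0, hC⟩ := hcov
  have hd : ∀ i, ∀ x ∈ D.Ω, ‖fderiv ℝ (v₀ i) x‖ ≤ C * N i := fun i x hx => by
    rw [(hv₀ i x hx).fderiv]; exact (hC i).norm_le hx
  have hd0 : ∀ i, DifferentiableOn ℝ (v₀ i) D.Ω := fun i x hx =>
    (hv₀ i x hx).differentiableAt.differentiableWithinAt
  have hint : ∀ i, IntegrableOn (v₀ i) D.Ω := fun i => by
    obtain ⟨x₀, hx₀⟩ := D.nonempty_Ω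
    refine integrableOn_of_continuousOn (hd0 i).continuousOn
      (C := L * (C * N i) * R + ‖v₀ i x₀‖) fun x hx => ?_
    have h2 := hΩ.norm_sub_le (hd0 i) (hd i) hx hx₀
    have h3 : ‖v₀ i x‖ ≤ ‖v₀ i x - v₀ i x₀‖ + ‖v₀ i x₀‖ := by
      simpa using norm_add_le (v₀ i x - v₀ i x₀) (v₀ i x₀)
    have := hΩ.one_le
    have := mul_nonneg hC0 (hN i)
    refine h3.trans (add_le_add_left (h2.trans ?_) _)
    gcongr
    exact hR x hx x₀ hx₀
  have hmean : ∀ i, ∫ x in D.Ω, v i x = 0 := fun i => by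
    have : IsFiniteMeasure (volume.restrict D.Ω) := isFiniteMeasure_restrict.2 D.volume_Ω_ne_top
    exact integral_sub_average _ _
  refine ⟨v, ?_, hv, hmean⟩
  refine CkFamily.succ isOpen_Ω hv ⟨hN, C, hC0, hC⟩ (C := L * C * R) fun i x hx => ?_
  refine (hΩ.norm_le_of_integral_eq_zero D.nonempty_Ω hR D.volume_Ω_ne_top (A := C * N i)
    (fun x hx => (hv i x hx).differentiableAt.differentiableWithinAt) (fun x hx => ?_)
    (hmean i) x hx).trans_eq (by ring)
  rw [(hv i x hx).fderiv]; exact (hC i).norm_le hx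

section Geometry

variable (hu : ContDiffOn ℝ 3 D.u D.Ω) (hH : D.MeanCurvatureAwayFromZero)
include hu

theorem hasFDerivAt_tr {x : E2} (hx : x ∈ D.Ω) : HasFDerivAt D.tr (fderiv ℝ D.tr x) x :=
  ((hasFDerivAt_a hu hx 0 0).1.add (hasFDerivAt_a hu hx 1 1).1).differentiableAt.hasFDerivAt

include hH

/-- The derivative of the mean curvature along the segments. Together with
`div (x - foot x) = 2 - tr x / tr (foot x)` it says that `tr x • (x - foot x)` has divergence
`tr x`. -/
theorem fderiv_tr_sub_foot {x : E2} (hx : x ∈ D.Ω) :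
    fderiv ℝ D.tr x (x - D.foot x) = -D.tr x + D.tr x ^ 2 * (D.tr (D.foot x))⁻¹ := by
  obtain ⟨⟨s, t⟩, h, rfl⟩ := hx
  change fderiv ℝ D.tr (D.Φ s t) (D.Φ s t - D.foot (D.Φ s t)) = -D.tr (D.Φ s t) +
    D.tr (D.Φ s t) ^ 2 * (D.tr (D.foot (D.Φ s t)))⁻¹
  have h1 := ((hasDerivAt_id s).mul_const (D.κ t)).const_sub 1
  have h2 := (hasFDerivAt_tr hu (D.Φ_mem h)).comp_hasDerivAt s (D.hasDerivAt_Φ_left s t)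
  have h3 := (h1.mul h2).unique ((hasDerivAt_const s (D.tr (D.Γ t))).congr_of_eventuallyEq (by
    filter_upwards [isOpen_Ioo.mem_nhds h.2] with σ hσ
    exact jacobian_eq hu hH (s := σ) ⟨h.1, hσ⟩))
  have h4 := jacobian_eq hu hH h
  have h5 : D.tr (D.Γ t) ≠ 0 := by
    rw [← D.Φ_zero]; exact tr_ne_zero hH (D.Φ_mem (D.zero_mem_M h.1))
  rw [sub_foot (D.Φ_mem h), height_Φ h, time_Φ h, foot_Φ h, map_smul, smul_eq_mul]
  simp only [Function.comp_apply, one_mul, id] at h3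
  set q := fderiv ℝ D.tr (D.Φ s t) (D.N t)
  set τ := D.tr (D.Φ s t)
  have hJ := jacobian_ne_zero hu hH h
  have h6 : D.tr (D.Γ t) * (s * q) = D.tr (D.Γ t) * (-τ) + τ ^ 2 := by
    rw [← h4]
    linear_combination s * τ * h3
  field_simp
  linarith

end Geometry

end DevelopableSurface

end DevelopableShell

end

/-! ### The compatibility conditions -/

noncomputable section

namespace DevelopableShell

section SymmetricProduct

/-- First derivatives with respect to the coordinates. -/
def d1 (φ : E2 → E3) (i : Fin 2) (x : E2) : E3 := fderiv ℝ φ x (e i)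

/-- Second derivatives with respect to the coordinates. -/
def d2 (φ : E2 → E3) (i j : Fin 2) (x : E2) : E3 := fderiv ℝ (fderiv ℝ φ) x (e i) (e j)

/-- The components of `B = sym ((∇φ)ᵀ ∇ψ)`. -/
def symProdComp (φ ψ : E2 → E3) (i j : Fin 2) (x : E2) : ℝ :=
  DevelopableSurface.symProd φ ψ x (e i) (e j)

/-- The row-wise curl `∂₁ B_{2j} - ∂₂ B_{1j}` of `B = sym ((∇φ)ᵀ ∇ψ)`; the third derivatives of
`φ` and `ψ` that a second curl would produce cancel. -/
def curlSymProd (φ ψ : E2 → E3) (j : Fin 2) (x : E2) : ℝ :=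
  (1 / 2) * (inner ℝ (d1 φ 1 x) (d2 ψ 0 j x) + inner ℝ (d2 φ 0 j x) (d1 ψ 1 x) -
    inner ℝ (d1 φ 0 x) (d2 ψ 1 j x) - inner ℝ (d2 φ 1 j x) (d1 ψ 0 x))

/-- The double curl of `B = sym ((∇φ)ᵀ ∇ψ)`. -/
def curlCurlSymProd (φ ψ : E2 → E3) (x : E2) : ℝ :=
  2 * inner ℝ (d2 φ 0 1 x) (d2 ψ 0 1 x) - inner ℝ (d2 φ 0 0 x) (d2 ψ 1 1 x) -
    inner ℝ (d2 φ 1 1 x) (d2 ψ 0 0 x)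

variable {φ ψ : E2 → E3} {x : E2}

theorem symProdComp_symm (φ ψ : E2 → E3) (i j : Fin 2) (x : E2) :
    symProdComp φ ψ i j x = symProdComp φ ψ j i x := by
  simp only [symProdComp, DevelopableSurface.symProd]
  ring

theorem hasFDerivAt_d1 (h : DifferentiableAt ℝ (fderiv ℝ φ) x) (i : Fin 2) :
    HasFDerivAt (d1 φ i) ((fderiv ℝ (fderiv ℝ φ) x).flip (e i)) x :=
  h.hasFDerivAt.apply_const (e i)

theorem hasFDerivAt_d2 (h : DifferentiableAt ℝ (fderiv ℝ (fderiv ℝ φ)) x) (i j : Fin 2) :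
    HasFDerivAt (d2 φ i j) (((fderiv ℝ (fderiv ℝ (fderiv ℝ φ)) x).flip (e i)).flip (e j)) x :=
  (h.hasFDerivAt.apply_const (e i)).apply_const (e j)

theorem hasFDerivAt_symProdComp (hφ : DifferentiableAt ℝ (fderiv ℝ φ) x)
    (hψ : DifferentiableAt ℝ (fderiv ℝ ψ) x) (i j : Fin 2) :
    HasFDerivAt (symProdComp φ ψ i j) (fderiv ℝ (symProdComp φ ψ i j) x) x ∧
    ∀ ξ, fderiv ℝ (symProdComp φ ψ i j) x ξ = (1 / 2) *
      (inner ℝ (d1 φ i x) (fderiv ℝ (fderiv ℝ ψ) x ξ (e j)) +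
        inner ℝ (fderiv ℝ (fderiv ℝ φ) x ξ (e i)) (d1 ψ j x) +
        inner ℝ (d1 φ j x) (fderiv ℝ (fderiv ℝ ψ) x ξ (e i)) +
        inner ℝ (fderiv ℝ (fderiv ℝ φ) x ξ (e j)) (d1 ψ i x)) := by
  have h : HasFDerivAt (symProdComp φ ψ i j) _ x :=
    (((hasFDerivAt_d1 hφ i).inner ℝ (hasFDerivAt_d1 hψ j)).add
      ((hasFDerivAt_d1 hφ j).inner ℝ (hasFDerivAt_d1 hψ i))).const_mul (1 / 2 : ℝ)
  refine ⟨h.differentiableAt.hasFDerivAt, fun ξ => ?_⟩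
  rw [h.fderiv]
  simp [fderivInnerCLM_apply]
  ring

theorem curl_symProdComp (hφ : DifferentiableAt ℝ (fderiv ℝ φ) x)
    (hψ : DifferentiableAt ℝ (fderiv ℝ ψ) x)
    (sφ : d2 φ 0 1 x = d2 φ 1 0 x) (sψ : d2 ψ 0 1 x = d2 ψ 1 0 x) (j : Fin 2) :
    fderiv ℝ (symProdComp φ ψ 1 j) x (e 0) - fderiv ℝ (symProdComp φ ψ 0 j) x (e 1) =
      curlSymProd φ ψ j x := by
  rw [(hasFDerivAt_symProdComp hφ hψ 1 j).2, (hasFDerivAt_symProdComp hφ hψ 0 j).2, curlSymProd]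
  simp only [d2] at sφ sψ ⊢
  rw [sφ, sψ]
  ring

theorem d2_symm (h : ∀ᶠ y in 𝓝 x, DifferentiableAt ℝ φ y)
    (h' : DifferentiableAt ℝ (fderiv ℝ φ) x) (i j : Fin 2) : d2 φ i j x = d2 φ j i x :=
  second_derivative_symmetric_of_eventually (h.mono fun _ hy => hy.hasFDerivAt)
    h'.hasFDerivAt (e i) (e j)

theorem curl_curlSymProd (hφ : ∀ᶠ y in 𝓝 x, DifferentiableAt ℝ φ y)
    (hψ : ∀ᶠ y in 𝓝 x, DifferentiableAt ℝ ψ y)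
    (hφ' : ∀ᶠ y in 𝓝 x, DifferentiableAt ℝ (fderiv ℝ φ) y)
    (hψ' : ∀ᶠ y in 𝓝 x, DifferentiableAt ℝ (fderiv ℝ ψ) y)
    (hφ'' : DifferentiableAt ℝ (fderiv ℝ (fderiv ℝ φ)) x)
    (hψ'' : DifferentiableAt ℝ (fderiv ℝ (fderiv ℝ ψ)) x) :
    fderiv ℝ (curlSymProd φ ψ 1) x (e 0) - fderiv ℝ (curlSymProd φ ψ 0) x (e 1) =
      curlCurlSymProd φ ψ x := by
  have key : ∀ {φ : E2 → E3}, (∀ᶠ y in 𝓝 x, DifferentiableAt ℝ φ y) →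
      (∀ᶠ y in 𝓝 x, DifferentiableAt ℝ (fderiv ℝ φ) y) →
      DifferentiableAt ℝ (fderiv ℝ (fderiv ℝ φ)) x →
      (∀ ξ ζ η, fderiv ℝ (fderiv ℝ (fderiv ℝ φ)) x ξ ζ η =
        fderiv ℝ (fderiv ℝ (fderiv ℝ φ)) x ζ ξ η) ∧
      (∀ ξ (i j : Fin 2), fderiv ℝ (fderiv ℝ (fderiv ℝ φ)) x ξ (e i) (e j) =
        fderiv ℝ (fderiv ℝ (fderiv ℝ φ)) x ξ (e j) (e i)) ∧ d2 φ 0 1 x = d2 φ 1 0 x := by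
    intro φ h h' h''
    refine ⟨fun ξ ζ η => ?_, fun ξ i j => ?_, d2_symm h h'.self_of_nhds 0 1⟩
    · rw [second_derivative_symmetric_of_eventually (h'.mono fun _ hy => hy.hasFDerivAt)
        h''.hasFDerivAt ξ ζ]
    · have h1 : d2 φ i j =ᶠ[𝓝 x] d2 φ j i := by
        filter_upwards [h.eventually_nhds, h'] with y hy hy' using d2_symm hy hy' i j
      have h2 := ((hasFDerivAt_d2 h'' i j).congr_of_eventuallyEq h1.symm).unique
        (hasFDerivAt_d2 h'' j i)
      simpa using congrArg (fun A : E2 →L[ℝ] E3 => A ξ) h2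
  obtain ⟨a1, a2, a3⟩ := key hφ hφ' hφ''
  obtain ⟨b1, b2, b3⟩ := key hψ hψ' hψ''
  have hd : ∀ j, HasFDerivAt (curlSymProd φ ψ j) _ x := fun j =>
    ((((((hasFDerivAt_d1 hφ'.self_of_nhds 1).inner ℝ (hasFDerivAt_d2 hψ'' 0 j)).add
      ((hasFDerivAt_d2 hφ'' 0 j).inner ℝ (hasFDerivAt_d1 hψ'.self_of_nhds 1))).sub
      ((hasFDerivAt_d1 hφ'.self_of_nhds 0).inner ℝ (hasFDerivAt_d2 hψ'' 1 j))).sub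
      ((hasFDerivAt_d2 hφ'' 1 j).inner ℝ (hasFDerivAt_d1 hψ'.self_of_nhds 0))).const_mul
        (1 / 2 : ℝ))
  rw [(hd 1).fderiv, (hd 0).fderiv]
  simp only [smul_apply, sub_apply, add_apply, ContinuousLinearMap.comp_apply,
    ContinuousLinearMap.prod_apply, fderivInnerCLM_apply, ContinuousLinearMap.flip_apply,
    smul_eq_mul, curlCurlSymProd]
  rw [a1 (e 1) (e 0) (e 0), a2 (e 0) 1 0, a2 (e 1) 1 0, a1 (e 1) (e 0) (e 1),
    b1 (e 1) (e 0) (e 0), b2 (e 0) 1 0, b2 (e 1) 1 0, b1 (e 1) (e 0) (e 1)]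
  simp only [d2] at a3 b3 ⊢
  rw [a3, b3]
  ring

end SymmetricProduct

namespace DevelopableSurface

variable {D : DevelopableSurface}

/-- The vector from the foot point to the point. -/
def offset (D : DevelopableSurface) (x : E2) : E2 := x - D.foot x

/-- The mean of `h` over the segment to the foot point, with weight `l ^ j`. -/
def segMean (D : DevelopableSurface) (j : ℕ) (h : E2 → ℝ) : E2 → ℝ :=
  rayMean D.foot (fun l => l ^ j) h

/-- The solution `f` of `∂²f/∂s² = h` along the segments with vanishing initial data at the foot
point: `f = |y|² ∫₀¹ (1 - l) h (foot + l y) dl`, where `y` is the offset. -/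
def segSolution (D : DevelopableSurface) (h : E2 → ℝ) (x : E2) : ℝ :=
  inner ℝ (D.offset x) (D.offset x) * (D.segMean 0 h x - D.segMean 1 h x)

theorem segSolution_Φ {s t : ℝ} (hM : (s, t) ∈ D.M) (h : E2 → ℝ) :
    D.segSolution h (D.Φ s t) =
      s ^ 2 * (D.segMean 0 h (D.Φ s t) - D.segMean 1 h (D.Φ s t)) := by
  rw [segSolution, offset, sub_foot (D.Φ_mem hM), height_Φ hM, time_Φ hM,
    real_inner_self_eq_norm_sq, norm_smul, D.norm_N (Ioo_subset_Icc_self hM.1), mul_one,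
    Real.norm_eq_abs, sq_abs]

theorem fderiv_segMean_offset {h : E2 → ℝ} (hh : ContinuousOn h D.Ω) (j : ℕ) {x : E2}
    (hx : x ∈ D.Ω) (hd : DifferentiableAt ℝ (D.segMean j h) x) :
    fderiv ℝ (D.segMean j h) x (D.offset x) = h x - (j + 1) * D.segMean j h x :=
  fderiv_rayMean_sub (fun _ hx _ hl => ray_mem hx hl) (fun _ hx _ hl => foot_ray hx hl) hh j hx hd

namespace IsRegular

variable {ι : Type} {m : ℕ} {L : ℝ} (hD : D.IsRegular m L)
include hD

theorem hasFDerivAt_offset {x : E2} (hx : x ∈ D.Ω) :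
    HasFDerivAt D.offset (ContinuousLinearMap.id ℝ E2 - fderiv ℝ D.foot x) x :=
  (hasFDerivAt_id x).sub (hD.hasFDerivAt_foot hx)

theorem family_offset : CkFamily (m + 1) D.Ω (fun _ : ι => 1) (fun _ => D.offset) := by
  obtain ⟨B, hB⟩ := D.lipschitz_domain.isBounded.exists_norm_le
  refine CkFamily.sub isOpen_Ω ?_ hD.family_foot
  refine CkFamily.succ isOpen_Ω (fun _ x _ => hasFDerivAt_id x) ?_ (C := B)
    (fun _ x hx => by simpa using hB x hx)
  exact (ckBound_const isOpen_Ω (ContinuousLinearMap.id ℝ E2)).family (norm_nonneg _)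

theorem family_segMean {k : ℕ} (hk : k ≤ m + 1) {N : ι → ℝ} {h : ι → E2 → ℝ}
    (hh : CkFamily k D.Ω N h) (j : ℕ) : CkFamily k D.Ω N (fun i => D.segMean j (h i)) :=
  CkFamily.mean_along_rays hD.quasiconvex (fun _ hx _ hl => ray_mem hx hl)
    (hD.family_foot.of_le hD.quasiconvex hk) (continuous_pow j) hh

theorem family_segSolution {k : ℕ} (hk : k ≤ m + 1) {N : ι → ℝ} {h : ι → E2 → ℝ}
    (hh : CkFamily k D.Ω N h) : CkFamily k D.Ω N (fun i => D.segSolution (h i)) := by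
  have h1 : CkFamily k D.Ω (fun _ : ι => 1) (fun _ => D.offset) :=
    hD.family_offset.of_le hD.quasiconvex hk
  exact CkFamily.fixed_mul (c := fun _ x => inner ℝ (D.offset x) (D.offset x)) hD.quasiconvex
    ((h1.inner hD.quasiconvex h1).weight_congr fun _ => one_mul _)
    ((hD.family_segMean hk hh 0).sub isOpen_Ω (hD.family_segMean hk hh 1))

/-- The row-wise curl of `f a`, where `f` solves the second order equation along the segments. -/
theorem curl_segSolution {h : E2 → ℝ} (hh : ContinuousOn h D.Ω) {x : E2} (hx : x ∈ D.Ω)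
    (h0 : DifferentiableAt ℝ (D.segMean 0 h) x) (h1 : DifferentiableAt ℝ (D.segMean 1 h) x)
    (j : Fin 2) :
    DifferentiableAt ℝ (D.segSolution h) x ∧
    fderiv ℝ (D.segSolution h) x (e 0) * D.a 1 j x -
      fderiv ℝ (D.segSolution h) x (e 1) * D.a 0 j x =
        D.tr x * D.segMean 0 h x * perp (D.offset x) j := by
  have hy := hD.hasFDerivAt_offset hx
  have hf : HasFDerivAt (D.segSolution h) _ x :=
    (hy.inner ℝ hy).mul (h0.hasFDerivAt.sub h1.hasFDerivAt)
  refine ⟨hf.differentiableAt, ?_⟩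
  have e0 := fderiv_segMean_offset hh 0 hx h0
  have e1 := fderiv_segMean_offset hh 1 hx h1
  have hoff : D.offset x = D.height x • D.N (D.time x) := sub_foot hx
  have ht := Ioo_subset_Icc_self (time_mem hx)
  have hfoot : ∀ ξ, inner ℝ (D.offset x) (fderiv ℝ D.foot x ξ) = (0 : ℝ) := fun ξ => by
    rw [(DevelopableSurface.hasFDerivAt_foot hD.contDiffOn hD.curved hx).fderiv, hoff]
    simp [real_inner_smul_right, real_inner_comm, D.inner_tangent_N]
  have ha : ∀ i, D.a i j x =
      D.tr x * (D.tangent (D.time x) i * D.tangent (D.time x) j) := fun i => by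
    have := a_eq hD.contDiffOn (param_mem hx) i j
    rwa [Φ_param hx] at this
  have hn : D.tangent (D.time x) 0 ^ 2 + D.tangent (D.time x) 1 ^ 2 = 1 := by
    rw [← norm_sq_e2, D.norm_tangent ht, one_pow]
  have hN : ∀ A : E2 →L[ℝ] ℝ, A (D.offset x) = D.height x *
      (-D.tangent (D.time x) 1 * A (e 0) + D.tangent (D.time x) 0 * A (e 1)) := fun A => by
    rw [hoff, map_smul, vec_eq (D.N _), map_add, map_smul, map_smul]
    rfl
  have hfξ : ∀ ξ, fderiv ℝ (D.segSolution h) x ξ = inner ℝ (D.offset x) (D.offset x) *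
      (fderiv ℝ (D.segMean 0 h) x ξ - fderiv ℝ (D.segMean 1 h) x ξ) +
      (D.segMean 0 h x - D.segMean 1 h x) * (2 * inner ℝ (D.offset x) ξ) := fun ξ => by
    rw [hf.fderiv]
    simp only [add_apply, smul_apply, sub_apply, ContinuousLinearMap.comp_apply,
      ContinuousLinearMap.prod_apply, fderivInnerCLM_apply, smul_eq_mul,
      ContinuousLinearMap.id_apply, inner_sub_left, inner_sub_right]
    rw [real_inner_comm (D.offset x) (fderiv ℝ D.foot x ξ), hfoot, real_inner_comm (D.offset x) ξ]
    ring
  rw [hN] at e0 e1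
  have hin : ∀ i, inner ℝ (D.offset x) (e i) = D.offset x i := fun i => by
    rw [inner_e2]; fin_cases i <;> simp
  rw [ha, ha, hfξ, hfξ, hin, hin, inner_e2]
  have c0 : D.offset x 0 = -(D.height x * D.tangent (D.time x) 1) := by
    rw [hoff]; simp [PlanarChart.N]
  have c1 : D.offset x 1 = D.height x * D.tangent (D.time x) 0 := by
    rw [hoff]; simp [PlanarChart.N]
  have cj : perp (D.offset x) j = -D.height x * D.tangent (D.time x) j := by
    fin_cases j <;> simp [c0, c1]
  rw [cj, c0, c1]
  set s := D.height x
  set p := D.tangent (D.time x) 0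
  set q := D.tangent (D.time x) 1
  set r := D.tangent (D.time x) j
  push_cast at e0 e1
  linear_combination D.tr x * r * (s ^ 2 * (q * fderiv ℝ (D.segMean 0 h) x (e 0) -
    p * fderiv ℝ (D.segMean 0 h) x (e 1) - q * fderiv ℝ (D.segMean 1 h) x (e 0) +
    p * fderiv ℝ (D.segMean 1 h) x (e 1)) - 2 * (D.segMean 0 h x - D.segMean 1 h x) * s) * hn -
    D.tr x * r * s * e0 + D.tr x * r * s * e1

/-- The vector field `tr a · Q · y`, where `Q` is the mean of `h`, has divergence `tr a · h`. -/
theorem div_segMean {h : E2 → ℝ} (hh : ContinuousOn h D.Ω) {x : E2} (hx : x ∈ D.Ω)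
    (h0 : DifferentiableAt ℝ (D.segMean 0 h) x) :
    (∀ j, DifferentiableAt ℝ (fun x => D.tr x * D.segMean 0 h x * perp (D.offset x) j) x) ∧
    fderiv ℝ (fun x => D.tr x * D.segMean 0 h x * perp (D.offset x) 1) x (e 0) -
      fderiv ℝ (fun x => D.tr x * D.segMean 0 h x * perp (D.offset x) 0) x (e 1) =
        D.tr x * h x := by
  have hy := hD.hasFDerivAt_offset hx
  have e0 := fderiv_segMean_offset hh 0 hx h0
  have htr := hasFDerivAt_tr hD.contDiffOn hx
  have hp : ∀ j, HasFDerivAt (fun x => perp (D.offset x) j) ((dx j).comp (perpL.comp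
    (ContinuousLinearMap.id ℝ E2 - fderiv ℝ D.foot x))) x := fun j =>
    ((dx j).comp perpL).hasFDerivAt.comp x hy
  have hd : ∀ j, HasFDerivAt (fun x => D.tr x * D.segMean 0 h x * perp (D.offset x) j) _ x :=
    fun j => (htr.mul h0.hasFDerivAt).mul (hp j)
  refine ⟨fun j => (hd j).differentiableAt, ?_⟩
  rw [(hd 1).fderiv, (hd 0).fderiv]
  have e1 := fderiv_tr_sub_foot hD.contDiffOn hD.curved hx
  have e2 := fun i j => fderiv_foot_apply hD.contDiffOn hD.curved hx i j
  change fderiv ℝ D.tr x (D.offset x) = _ at e1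
  rw [vec_eq (D.offset x), map_add, map_smul, map_smul] at e0 e1
  simp [e2] at e0 e1 ⊢
  have e3 : D.tr x = D.a 0 0 x + D.a 1 1 x := rfl
  linear_combination D.segMean 0 h x * e1 + D.tr x * e0 +
    D.tr x * D.segMean 0 h x * (D.tr (D.foot x))⁻¹ * e3

end IsRegular

end DevelopableSurface

end DevelopableShell

end

/-! ### Existence of normalized solutions, with estimates -/

noncomputable section

namespace DevelopableShell

/-- On a bounded set a Lipschitz map is Hölder continuous with exponent `1/2`. -/
theorem _root_.LipschitzOnWith.holderOnWith_half {F : Type} [NormedAddCommGroup F] {Ω : Set E2}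
    {K : ℝ≥0} {f : E2 → F} (hf : LipschitzOnWith K f Ω) {R : ℝ}
    (hR : ∀ x ∈ Ω, ∀ y ∈ Ω, ‖x - y‖ ≤ R) : ∃ K' : ℝ≥0, HolderOnWith K' (1 / 2) f Ω := by
  have h := HolderOnWith.of_le (D := R.toNNReal) (s := 1 / 2) (fun x hx y hy => ?_)
    hf.holderOnWith (by norm_num)
  · exact ⟨_, h⟩
  · rw [edist_dist, dist_eq_norm]
    exact ENNReal.ofReal_le_ofReal (hR x hx y hy)

namespace DevelopableSurface

variable {D : DevelopableSurface}

theorem hasWeakGradient_of_bounded {F : Type} [NormedAddCommGroup F] [NormedSpace ℝ F]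
    {f : E2 → F} (hd : DifferentiableOn ℝ f D.Ω) (hc : ContinuousOn (fderiv ℝ f) D.Ω) {A : ℝ}
    (hA : ∀ x ∈ D.Ω, ‖f x‖ ≤ A) (hA' : ∀ x ∈ D.Ω, ‖fderiv ℝ f x‖ ≤ A) :
    HasWeakGradient D.Ω f (fderiv ℝ f) := by
  refine ⟨integrableOn_of_continuousOn hd.continuousOn hA, integrableOn_of_continuousOn hc hA',
    fun η hη hηc hηs ξ => ?_⟩
  have hη1 : Continuous fun x => fderiv ℝ η x ξ := (hη.continuous_fderiv (by simp)).clm_apply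
    continuous_const
  have hη1c : HasCompactSupport fun x => fderiv ℝ η x ξ :=
    hηc.mono' ((subset_tsupport _).trans (tsupport_fderiv_apply_subset ℝ ξ))
  have hη1s : ∀ x ∉ D.Ω, fderiv ℝ η x ξ = 0 := fun x hx =>
    image_eq_zero_of_notMem_tsupport (f := fun x => fderiv ℝ η x ξ) fun h =>
      hx (hηs (tsupport_fderiv_apply_subset ℝ ξ h))
  have hη0 : ∀ x ∉ D.Ω, η x = 0 := fun x hx =>
    image_eq_zero_of_notMem_tsupport fun h => hx (hηs h)
  have key : ∀ {G : Type} [NormedAddCommGroup G] [NormedSpace ℝ G] {g : E2 → G} {ζ : E2 → ℝ}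
      {B : ℝ}, ContinuousOn g D.Ω → (∀ x ∈ D.Ω, ‖g x‖ ≤ B) → Continuous ζ → HasCompactSupport ζ →
      (∀ x ∉ D.Ω, ζ x = 0) → Integrable fun x => ζ x • g x := by
    intro G _ _ g ζ B hg hB hζ hζc hζ0
    obtain ⟨C, hC⟩ := hζc.exists_bound_of_continuous hζ
    have h1 : IntegrableOn (fun x => ζ x • g x) D.Ω :=
      integrableOn_of_continuousOn (hζ.continuousOn.smul hg) (C := C * B) fun x hx => by
        rw [norm_smul]
        have := (norm_nonneg _).trans (hC x)
        gcongr
        · exact hC x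
        · exact hB x hx
    refine (integrableOn_iff_integrable_of_support_subset fun x hx => ?_).1 h1
    by_contra hn
    exact hx (by simp [hζ0 x hn])
  have h := integral_smul_fderiv_eq_neg_fderiv_smul_of_integrable (μ := volume) (f := η) (g := f)
    (v := ξ) (key hd.continuousOn hA hη1 hη1c hη1s)
    (key (g := fun x => fderiv ℝ f x ξ) (B := A * ‖ξ‖) (hc.clm_apply continuousOn_const)
      (fun x hx => ((fderiv ℝ f x).le_opNorm ξ).trans (by gcongr; exact hA' x hx)) hη.continuous
      hηc hη0) (key hd.continuousOn hA hη.continuous hηc hη0)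
    (fun x _ => (hη.differentiable (by simp)) x)
    (fun x hx => hd.differentiableAt (isOpen_Ω.mem_nhds (hηs hx)))
  rw [setIntegral_eq_integral_of_forall_compl_eq_zero fun x hx => by rw [hη0 x hx, zero_smul],
    setIntegral_eq_integral_of_forall_compl_eq_zero fun x hx => by rw [hη1s x hx, zero_smul], h]

/-- The vector field with covariant components `p`, `q` and normal component `f`. -/
def assemble (D : DevelopableSurface) (p q f : E2 → ℝ) (x : E2) : E3 :=
  p x • fderiv ℝ D.u x (e 0) + q x • fderiv ℝ D.u x (e 1) + f x • D.normal x

section Assemble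

variable (hu : ContDiffOn ℝ 3 D.u D.Ω) (p q f : E2 → ℝ) {x : E2}
include hu

theorem normalPart_assemble (hx : x ∈ D.Ω) : D.normalPart (D.assemble p q f) x = f x := by
  rw [normalPart, assemble, inner_add_left, inner_add_left, real_inner_smul_left,
    real_inner_smul_left, real_inner_smul_left, inner_normal_self hu hx,
    real_inner_comm _ (fderiv ℝ D.u x (e 0)), real_inner_comm _ (fderiv ℝ D.u x (e 1)),
    inner_normal_fderiv_u, inner_normal_fderiv_u]
  ring

theorem tanPart_assemble (hx : x ∈ D.Ω) : D.tanPart (D.assemble p q f) x =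
    p x • fderiv ℝ D.u x (e 0) + q x • fderiv ℝ D.u x (e 1) := by
  rw [tanPart, normalPart_assemble hu p q f hx, assemble]
  abel

theorem pullback_assemble (hx : x ∈ D.Ω) : D.pullback (D.assemble p q f) x = !₂[p x, q x] := by
  rw [pullback, tanPart_assemble hu p q f hx]
  simp only [inner_add_left, real_inner_smul_left, inner_u hu x hx, inner_e2]
  simp

end Assemble

namespace IsRegular

variable {ι : Type} {m : ℕ} {L : ℝ} (hD : D.IsRegular m L) {N M : ι → ℝ} {φ ψ : ι → E2 → E3}
  (hφ : CkFamily (m + 2) D.Ω N φ) (hψ : CkFamily (m + 2) D.Ω M ψ)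
include hD

section Data

include hφ hψ

theorem family_symProdComp (i j : Fin 2) : CkFamily (m + 1) D.Ω (fun n => N n * M n)
    (fun n => symProdComp (φ n) (ψ n) i j) := by
  have h1 : ∀ {N : ι → ℝ} {φ : ι → E2 → E3}, CkFamily (m + 2) D.Ω N φ → ∀ i,
      CkFamily (m + 1) D.Ω N (fun n => d1 (φ n) i) := fun h i =>
    h.fderiv.clm isOpen_Ω (ContinuousLinearMap.apply ℝ E3 (e i))
  exact ((((h1 hφ i).inner hD.quasiconvex (h1 hψ j)).add isOpen_Ω
    ((h1 hφ j).inner hD.quasiconvex (h1 hψ i))).const_smul isOpen_Ω (1 / 2))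

theorem family_curlSymProd (j : Fin 2) : CkFamily m D.Ω (fun n => N n * M n)
    (fun n => curlSymProd (φ n) (ψ n) j) := by
  have h1 : ∀ {N : ι → ℝ} {φ : ι → E2 → E3}, CkFamily (m + 2) D.Ω N φ → ∀ i,
      CkFamily m D.Ω N (fun n => d1 (φ n) i) := fun h i =>
    (h.fderiv.clm isOpen_Ω (ContinuousLinearMap.apply ℝ E3 (e i))).of_le hD.quasiconvex m.le_succ
  have h2 : ∀ {N : ι → ℝ} {φ : ι → E2 → E3}, CkFamily (m + 2) D.Ω N φ → ∀ i j,
      CkFamily m D.Ω N (fun n => d2 (φ n) i j) := fun h i j =>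
    (h.fderiv.fderiv.clm isOpen_Ω (ContinuousLinearMap.apply ℝ _ (e i))).clm isOpen_Ω
      (ContinuousLinearMap.apply ℝ E3 (e j))
  have hΩ := hD.quasiconvex
  exact ((((((h1 hφ 1).inner hΩ (h2 hψ 0 j)).add isOpen_Ω
    ((h2 hφ 0 j).inner hΩ (h1 hψ 1))).sub isOpen_Ω ((h1 hφ 0).inner hΩ (h2 hψ 1 j))).sub isOpen_Ω
    ((h2 hφ 1 j).inner hΩ (h1 hψ 0)))).const_smul isOpen_Ω (1 / 2)

theorem family_curlCurlSymProd : CkFamily m D.Ω (fun n => N n * M n)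
    (fun n => curlCurlSymProd (φ n) (ψ n)) := by
  have h2 : ∀ {N : ι → ℝ} {φ : ι → E2 → E3}, CkFamily (m + 2) D.Ω N φ → ∀ i j,
      CkFamily m D.Ω N (fun n => d2 (φ n) i j) := fun h i j =>
    (h.fderiv.fderiv.clm isOpen_Ω (ContinuousLinearMap.apply ℝ _ (e i))).clm isOpen_Ω
      (ContinuousLinearMap.apply ℝ E3 (e j))
  have hΩ := hD.quasiconvex
  exact ((((h2 hφ 0 1).inner hΩ (h2 hψ 0 1)).const_smul isOpen_Ω 2).sub isOpen_Ω
    ((h2 hφ 0 0).inner hΩ (h2 hψ 1 1))).sub isOpen_Ω ((h2 hφ 1 1).inner hΩ (h2 hψ 0 0))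

end Data

/-- The right-hand side of the equation along the segments: by the compatibility condition the
second derivative of the normal component along the segments is minus the double curl of `B`
divided by the trace of `[a_ij]`. -/
def _root_.DevelopableShell.DevelopableSurface.source (D : DevelopableSurface) (φ ψ : E2 → E3)
    (x : E2) : ℝ := -(D.tr x)⁻¹ * curlCurlSymProd φ ψ x

/-- The components of `B + f a`, where `f` is the normal component. -/
def _root_.DevelopableShell.DevelopableSurface.strain (D : DevelopableSurface) (φ ψ : E2 → E3)
    (i j : Fin 2) (x : E2) : ℝ :=
  symProdComp φ ψ i j x + D.a i j x * D.segSolution (D.source φ ψ) x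

/-- The derivatives of the rotation `(∂₁ w'₂ - ∂₂ w'₁) / 2`. -/
def _root_.DevelopableShell.DevelopableSurface.rotationGradient (D : DevelopableSurface)
    (φ ψ : E2 → E3) (j : Fin 2) (x : E2) : ℝ :=
  curlSymProd φ ψ j x + D.tr x * D.segMean 0 (D.source φ ψ) x * perp (D.offset x) j

include hφ hψ

theorem family_source : CkFamily m D.Ω (fun n => N n * M n)
    (fun n => D.source (φ n) (ψ n)) :=
  CkFamily.fixed_mul hD.quasiconvex (c := fun _ x => -(D.tr x)⁻¹)
    ((hD.family_inv_tr.of_le hD.quasiconvex m.le_succ).neg isOpen_Ω)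
    (hD.family_curlCurlSymProd hφ hψ)

theorem family_normalComp : CkFamily m D.Ω (fun n => N n * M n)
    (fun n => D.segSolution (D.source (φ n) (ψ n))) :=
  hD.family_segSolution m.le_succ (hD.family_source hφ hψ)

theorem family_strain (i j : Fin 2) : CkFamily m D.Ω (fun n => N n * M n)
    (fun n => D.strain (φ n) (ψ n) i j) :=
  ((hD.family_symProdComp hφ hψ i j).of_le hD.quasiconvex m.le_succ).add isOpen_Ω
    (CkFamily.fixed_mul (c := fun _ => D.a i j) hD.quasiconvex
      ((hD.family_a i j).of_le hD.quasiconvex m.le_succ) (hD.family_normalComp hφ hψ))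

theorem family_rotationGradient (j : Fin 2) : CkFamily m D.Ω (fun n => N n * M n)
    (fun n => D.rotationGradient (φ n) (ψ n) j) := by
  have hΩ := hD.quasiconvex
  refine (hD.family_curlSymProd hφ hψ j).add isOpen_Ω ?_
  have h1 := CkFamily.fixed_mul (c := fun _ => D.tr) hΩ (hD.family_tr.of_le hΩ m.le_succ)
    (hD.family_segMean m.le_succ (hD.family_source hφ hψ) 0)
  exact (h1.mul hΩ ((hD.family_offset.of_le hΩ m.le_succ).clm isOpen_Ω
    ((dx j).comp perpL))).weight_congr fun _ => mul_one _

/-- The rotation gradient is closed exactly because the normal component solves the equation along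
the segments. -/
theorem ae_curl_rotationGradient (n : ι) : ∀ᵐ x ∂(volume.restrict D.Ω),
    fderiv ℝ (D.rotationGradient (φ n) (ψ n) 1) x (e 0) =
      fderiv ℝ (D.rotationGradient (φ n) (ψ n) 0) x (e 1) := by
  have hK := hD.family_curlSymProd hφ hψ
  have hh := hD.family_source hφ hψ
  filter_upwards [ae_mem_Ω, hD.ae_differentiableAt (hK 0) n, hD.ae_differentiableAt (hK 1) n,
    hD.ae_differentiableAt (hD.family_segMean m.le_succ hh 0) n,
    hD.ae_differentiableAt hφ.fderiv.fderiv n,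
    hD.ae_differentiableAt hψ.fderiv.fderiv n] with x hx hK0 hK1 h0 hφ'' hψ''
  have hnhds := isOpen_Ω.mem_nhds hx
  have hc := curl_curlSymProd
    (by filter_upwards [hnhds] with y hy using hφ.differentiableAt isOpen_Ω n hy)
    (by filter_upwards [hnhds] with y hy using hψ.differentiableAt isOpen_Ω n hy)
    (by filter_upwards [hnhds] with y hy using hφ.fderiv.differentiableAt isOpen_Ω n hy)
    (by filter_upwards [hnhds] with y hy using hψ.fderiv.differentiableAt isOpen_Ω n hy) hφ'' hψ''
  obtain ⟨hdd, hdiv⟩ := hD.div_segMean (hh.continuousOn hD.quasiconvex n) hx h0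
  have e1 := fderiv_fun_add hK1 (hdd 1)
  have e0 := fderiv_fun_add hK0 (hdd 0)
  change fderiv ℝ (D.rotationGradient (φ n) (ψ n) 1) x = _ at e1
  change fderiv ℝ (D.rotationGradient (φ n) (ψ n) 0) x = _ at e0
  rw [e1, e0, add_apply, add_apply]
  have htr := tr_ne_zero hD.curved hx
  have : D.tr x * D.source (φ n) (ψ n) x = -curlCurlSymProd (φ n) (ψ n) x := by
    rw [source]; field_simp
  linarith

/-- The row-wise curl of the strain is the gradient of the rotation; this uses the Codazzi
equations. -/
theorem ae_curl_strain (n : ι) (j : Fin 2) : ∀ᵐ x ∂(volume.restrict D.Ω),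
    (∀ i k, DifferentiableAt ℝ (D.strain (φ n) (ψ n) i k) x) ∧
    fderiv ℝ (D.strain (φ n) (ψ n) 1 j) x (e 0) - fderiv ℝ (D.strain (φ n) (ψ n) 0 j) x (e 1) =
      D.rotationGradient (φ n) (ψ n) j x := by
  have hh := hD.family_source hφ hψ
  filter_upwards [ae_mem_Ω, hD.ae_differentiableAt (hD.family_segMean m.le_succ hh 0) n,
    hD.ae_differentiableAt (hD.family_segMean m.le_succ hh 1) n] with x hx h0 h1
  obtain ⟨hf, hcurl⟩ := hD.curl_segSolution (hh.continuousOn hD.quasiconvex n) hx h0 h1 j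
  have hφ1 := hφ.fderiv.differentiableAt isOpen_Ω n hx
  have hψ1 := hψ.fderiv.differentiableAt isOpen_Ω n hx
  have hs : ∀ {φ : ι → E2 → E3} {N : ι → ℝ}, CkFamily (m + 2) D.Ω N φ →
      d2 (φ n) 0 1 x = d2 (φ n) 1 0 x := fun h => d2_symm
    (by filter_upwards [isOpen_Ω.mem_nhds hx] with y hy using h.differentiableAt isOpen_Ω n hy)
    (h.fderiv.differentiableAt isOpen_Ω n hx) 0 1
  have hc := curl_symProdComp hφ1 hψ1 (hs hφ) (hs hψ) j
  have hd : ∀ i k, HasFDerivAt (D.strain (φ n) (ψ n) i k) _ x := fun i k =>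
    (hasFDerivAt_symProdComp hφ1 hψ1 i k).1.add
      ((hasFDerivAt_a hD.contDiffOn hx i k).1.mul hf.hasFDerivAt)
  refine ⟨fun i k => (hd i k).differentiableAt, ?_⟩
  rw [(hd 1 j).fderiv, (hd 0 j).fderiv]
  have hcod := codazzi hD.contDiffOn hx 1 j 0
  simp only [add_apply, smul_apply, smul_eq_mul, rotationGradient]
  rw [hcod]
  linarith

/-- Existence, with estimates: integrate the source twice along the segments to obtain the normal
component, then integrate the rotation and the displacement. -/
theorem exists_components : ∃ rot p q : ι → E2 → ℝ,
    CkFamily (m + 1) D.Ω (fun n => N n * M n) p ∧ CkFamily (m + 1) D.Ω (fun n => N n * M n) q ∧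
    (∀ n, ∀ x ∈ D.Ω, HasFDerivAt (p n) (covec (D.strain (φ n) (ψ n) 0 0 x)
      (D.strain (φ n) (ψ n) 0 1 x - rot n x)) x) ∧
    (∀ n, ∀ x ∈ D.Ω, HasFDerivAt (q n) (covec (D.strain (φ n) (ψ n) 1 0 x + rot n x)
      (D.strain (φ n) (ψ n) 1 1 x)) x) ∧
    ∀ n, ∫ x in D.Ω, rot n x = 0 ∧ ∫ x in D.Ω, p n x = 0 ∧ ∫ x in D.Ω, q n x = 0 := by
  have hΩ := hD.quasiconvex
  have hV := hD.family_rotationGradient hφ hψ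
  have hS := hD.family_strain hφ hψ
  obtain ⟨rot, hrot, hdrot, hmrot⟩ := hD.exists_primitive (hV 0) (hV 1)
    (fun n => hD.ae_curl_rotationGradient hφ hψ n)
  have hrot' := hrot.of_le hΩ m.le_succ
  have hswap : ∀ n, ∀ᵐ x ∂(volume.restrict D.Ω), fderiv ℝ (D.strain (φ n) (ψ n) 0 1) x =
      fderiv ℝ (D.strain (φ n) (ψ n) 1 0) x := fun n => by
    filter_upwards [ae_mem_Ω] with x hx
    refine Filter.EventuallyEq.fderiv_eq ?_
    filter_upwards [isOpen_Ω.mem_nhds hx] with y hy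
    rw [strain, strain, symProdComp_symm, a_symm hD.contDiffOn hy]
  obtain ⟨p, hp, hdp, hmp⟩ := hD.exists_primitive (hS 0 0) ((hS 0 1).sub isOpen_Ω hrot') (by
    intro n
    filter_upwards [ae_mem_Ω, hD.ae_curl_strain hφ hψ n 0, hswap n] with x hx h hs
    rw [fderiv_fun_sub (h.1 0 1) (hdrot n x hx).differentiableAt, (hdrot n x hx).fderiv, hs]
    simp
    linarith [h.2])
  obtain ⟨q, hq, hdq, hmq⟩ := hD.exists_primitive ((hS 1 0).add isOpen_Ω hrot') (hS 1 1) (by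
    intro n
    filter_upwards [ae_mem_Ω, hD.ae_curl_strain hφ hψ n 1, hswap n] with x hx h hs
    rw [fderiv_fun_add (h.1 1 0) (hdrot n x hx).differentiableAt, (hdrot n x hx).fderiv, ← hs]
    simp
    linarith [h.2])
  exact ⟨rot, p, q, hp, hq, hdp, hdq, fun n => ⟨hmrot n, hmp n, hmq n⟩⟩

end IsRegular

end DevelopableSurface

end DevelopableShell

end

noncomputable section

namespace DevelopableShell

theorem symProd_eq_sum (φ ψ : E2 → E3) (x ξ ζ : E2) :
    DevelopableSurface.symProd φ ψ x ξ ζ = symProdComp φ ψ 0 0 x * ξ 0 * ζ 0 +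
      symProdComp φ ψ 0 1 x * (ξ 0 * ζ 1 + ξ 1 * ζ 0) + symProdComp φ ψ 1 1 x * ξ 1 * ζ 1 := by
  simp only [symProdComp, DevelopableSurface.symProd]
  conv_lhs => rw [vec_eq ξ, vec_eq ζ]
  simp only [map_add, map_smul, inner_add_left, inner_add_right, real_inner_smul_left,
    real_inner_smul_right]
  ring

/-- `s² g(s)` has vanishing derivative at `s = 0` when `g` is merely continuous there. -/
theorem hasDerivAt_sq_mul_zero {g : ℝ → ℝ} (hg : ContinuousAt g 0) :
    HasDerivAt (fun s => s ^ 2 * g s) 0 0 := by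
  rw [hasDerivAt_iff_tendsto_slope]
  have h1 : Filter.Tendsto (fun s => s * g s) (𝓝[≠] 0) (𝓝 0) := by
    have h2 : ContinuousAt (fun s => s * g s) 0 := continuousAt_id.mul hg
    have h3 := h2.tendsto
    rw [zero_mul] at h3
    exact h3.mono_left nhdsWithin_le_nhds
  refine h1.congr' ?_
  filter_upwards [self_mem_nhdsWithin] with s hs
  have hs' : s ≠ 0 := hs
  rw [slope_def_field]
  field_simp
  ring

namespace DevelopableSurface

variable {D : DevelopableSurface}

theorem segment_mapsTo {t : ℝ} (ht : t ∈ Ioo 0 D.T) :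
    MapsTo (fun s => D.Φ s t) (Ioo (-D.sMinus t) (D.sPlus t)) D.Ω := fun _ hs => D.Φ_mem ⟨ht, hs⟩

theorem continuous_Φ_left (t : ℝ) : Continuous fun s => D.Φ s t := by
  unfold PlanarChart.Φ; fun_prop

namespace IsRegular

variable {ι : Type} {m : ℕ} {L : ℝ} (hD : D.IsRegular m L) {N M : ι → ℝ} {φ ψ : ι → E2 → E3}
include hD

theorem hasWeakGradient {F : Type} [NormedAddCommGroup F] [NormedSpace ℝ F] {k : ℕ}
    {f : ι → E2 → F} (hf : CkFamily (k + 1) D.Ω N f) (n : ι) :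
    HasWeakGradient D.Ω (f n) (fderiv ℝ (f n)) := by
  have hc := hf.fderiv.continuousOn hD.quasiconvex n
  obtain ⟨-, C, -, hC⟩ := hf
  exact hasWeakGradient_of_bounded (hC n).2.1 hc (hC n).1 fun x hx => (hC n).2.2.norm_le hx

theorem family_tanPart {k : ℕ} (hk : k ≤ m + 2) {p q : ι → E2 → ℝ} (hp : CkFamily k D.Ω N p)
    (hq : CkFamily k D.Ω N q) (f : ι → E2 → ℝ) :
    CkFamily k D.Ω N (fun n => D.tanPart (D.assemble (p n) (q n) (f n))) := by
  have hΩ := hD.quasiconvex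
  have hN : ∀ n, N n * 1 = N n := fun n => mul_one _
  refine (((hp.smul hΩ ((hD.family_fderiv_u (e 0)).of_le hΩ hk)).weight_congr hN).add isOpen_Ω
    ((hq.smul hΩ ((hD.family_fderiv_u (e 1)).of_le hΩ hk)).weight_congr hN)).congr isOpen_Ω
    fun n x hx => ?_
  exact (tanPart_assemble hD.contDiffOn _ _ _ hx).symm

theorem family_pullback {k : ℕ} {p q : ι → E2 → ℝ} (hp : CkFamily k D.Ω N p)
    (hq : CkFamily k D.Ω N q) (f : ι → E2 → ℝ) :
    CkFamily k D.Ω N (fun n => D.pullback (D.assemble (p n) (q n) (f n))) := by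
  refine ((hp.clm isOpen_Ω ((ContinuousLinearMap.lsmul ℝ ℝ).flip (e 0))).add isOpen_Ω
    (hq.clm isOpen_Ω ((ContinuousLinearMap.lsmul ℝ ℝ).flip (e 1)))).congr isOpen_Ω fun n x hx => ?_
  simp only
  rw [pullback_assemble hD.contDiffOn _ _ _ hx]
  ext i
  fin_cases i <;> simp

/-- The pairing of the derivative of the tangential part with tangent vectors only sees the
derivatives of the components, since the Christoffel symbols vanish. -/
theorem inner_fderiv_tanPart {p q : E2 → ℝ} (f : E2 → ℝ) {x : E2} (hx : x ∈ D.Ω)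
    {p' q' : E2 →L[ℝ] ℝ} (hp : HasFDerivAt p p' x) (hq : HasFDerivAt q q' x) (ξ ζ : E2) :
    inner ℝ (fderiv ℝ (D.tanPart (D.assemble p q f)) x ξ) (fderiv ℝ D.u x ζ) =
      p' ξ * ζ 0 + q' ξ * ζ 1 := by
  have h1 := (hp.smul (hasFDerivAt_fderiv_u_apply hD.contDiffOn hx (e 0))).add
    (hq.smul (hasFDerivAt_fderiv_u_apply hD.contDiffOn hx (e 1)))
  have h2 : D.tanPart (D.assemble p q f) =ᶠ[𝓝 x]
      fun y => p y • fderiv ℝ D.u y (e 0) + q y • fderiv ℝ D.u y (e 1) := by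
    filter_upwards [isOpen_Ω.mem_nhds hx] with y hy
    exact tanPart_assemble hD.contDiffOn _ _ _ hy
  rw [h2.fderiv_eq]
  erw [h1.fderiv]
  simp only [add_apply, smul_apply, ContinuousLinearMap.smulRight_apply,
    ContinuousLinearMap.flip_apply, inner_add_left, real_inner_smul_left,
    inner_fderiv_fderiv_u hD.contDiffOn hx, inner_u hD.contDiffOn x hx]
  simp [inner_e2]

theorem isNormalized_initial {k : ℕ} (hk : k ≤ m + 1) {h : ι → E2 → ℝ} (hh : CkFamily k D.Ω N h)
    (n : ι) (p q : E2 → ℝ) : ∀ᵐ t ∂(volume.restrict (Ioo 0 D.T)),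
    ContinuousOn (fun s => D.normalPart (D.assemble p q (D.segSolution (h n))) (D.Φ s t))
      (Ioo (-D.sMinus t) (D.sPlus t)) ∧
    D.normalPart (D.assemble p q (D.segSolution (h n))) (D.Φ 0 t) = 0 ∧
    HasDerivAt (fun s => D.normalPart (D.assemble p q (D.segSolution (h n))) (D.Φ s t)) 0 0 := by
  filter_upwards [ae_restrict_mem measurableSet_Ioo] with t ht
  have hΩ := hD.quasiconvex
  have hmem := D.zero_mem_M ht
  have hN : ∀ s ∈ Ioo (-D.sMinus t) (D.sPlus t),
      D.normalPart (D.assemble p q (D.segSolution (h n))) (D.Φ s t) =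
        D.segSolution (h n) (D.Φ s t) := fun s hs =>
    normalPart_assemble hD.contDiffOn _ _ _ (D.Φ_mem ⟨ht, hs⟩)
  have hR : ∀ j, ContinuousOn (fun s => D.segMean j (h n) (D.Φ s t))
      (Ioo (-D.sMinus t) (D.sPlus t)) := fun j =>
    ((hD.family_segMean hk hh j).continuousOn hΩ n).comp (continuous_Φ_left t).continuousOn
      (segment_mapsTo ht)
  refine ⟨?_, ?_, ?_⟩
  · refine ContinuousOn.congr ?_ hN
    exact ((hD.family_segSolution hk hh).continuousOn hΩ n).comp
      (continuous_Φ_left t).continuousOn (segment_mapsTo ht)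
  · rw [hN 0 hmem.2, segSolution_Φ hmem]
    ring
  · have h0 := isOpen_Ioo.mem_nhds hmem.2
    refine (hasDerivAt_sq_mul_zero (((hR 0).sub (hR 1)).continuousAt h0)).congr_of_eventuallyEq ?_
    filter_upwards [h0] with s hs
    rw [hN s hs, segSolution_Φ ⟨ht, hs⟩]
    rfl

/-- A normalized solution exists, and it satisfies the estimates. -/
theorem exists_solution (hφ : CkFamily (m + 2) D.Ω N φ) (hψ : CkFamily (m + 2) D.Ω M ψ) :
    ∃ w : ι → E2 → E3, (∀ n, D.IsWeakSolution (symProd (φ n) (ψ n)) (w n) ∧ D.IsNormalized (w n)) ∧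
      CkFamily (m + 1) D.Ω (fun n => N n * M n) (fun n => D.tanPart (w n)) ∧
      CkFamily m D.Ω (fun n => N n * M n) (fun n => D.normalPart (w n)) := by
  have hΩ := hD.quasiconvex
  obtain ⟨rot, p, q, hp, hq, hdp, hdq, hmean⟩ := hD.exists_components hφ hψ
  set f : ι → E2 → ℝ := fun n => D.segSolution (D.source (φ n) (ψ n)) with hf
  have hfF := hD.family_normalComp hφ hψ
  have htan := hD.family_tanPart (Nat.le_succ _) hp hq f
  have hpull := hD.family_pullback hp hq f
  have hnor : CkFamily m D.Ω (fun n => N n * M n)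
      (fun n => D.normalPart (D.assemble (p n) (q n) (f n))) := hfF.congr isOpen_Ω fun n x hx =>
    (normalPart_assemble hD.contDiffOn _ _ _ hx).symm
  refine ⟨fun n => D.assemble (p n) (q n) (f n), fun n => ⟨⟨?_, ?_, ?_⟩, ⟨?_, ?_, ?_⟩⟩, htan, hnor⟩
  · obtain ⟨R, -, hR⟩ := D.exists_norm_sub_le
    obtain ⟨K, hK⟩ := htan.lipschitzOnWith hΩ n
    exact ⟨1 / 2, by norm_num, by
      rw [← NNReal.coe_lt_coe]; norm_num, hK.holderOnWith_half hR⟩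
  · have hc := hnor.continuousOn hΩ n
    obtain ⟨-, C, -, hC⟩ := hnor
    refine memLp_top_of_bound (hc.aestronglyMeasurable isOpen_Ω.measurableSet)
      (C * (N n * M n)) ?_
    filter_upwards [ae_mem_Ω] with x hx using (hC n).norm_le hx
  · refine ⟨_, hD.hasWeakGradient htan n, ?_⟩
    filter_upwards [ae_mem_Ω] with x hx ξ ζ
    rw [hD.inner_fderiv_tanPart _ hx (hdp n x hx) (hdq n x hx),
      hD.inner_fderiv_tanPart _ hx (hdp n x hx) (hdq n x hx),
      normalPart_assemble hD.contDiffOn _ _ _ hx, secondForm_eq_sum hD.contDiffOn hx,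
      symProd_eq_sum]
    simp only [covec_apply, strain, symProdComp_symm _ _ 1 0, a_symm hD.contDiffOn hx 1 0, hf]
    ring
  · exact hD.isNormalized_initial m.le_succ (hD.family_source hφ hψ) n _ _
  · have hint := (hD.hasWeakGradient hpull n).integrable
    have key : ∀ i, (∫ x in D.Ω, D.pullback (D.assemble (p n) (q n) (f n)) x) i =
        ∫ x in D.Ω, D.pullback (D.assemble (p n) (q n) (f n)) x i := fun i =>
      ((dx i).integral_comp_comm hint).symm
    ext i
    rw [key]
    fin_cases i
    · refine Eq.trans (setIntegral_congr_fun isOpen_Ω.measurableSet fun x hx => ?_) (hmean n).2.1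
      simp [pullback_assemble hD.contDiffOn _ _ _ hx]
    · refine Eq.trans (setIntegral_congr_fun isOpen_Ω.measurableSet fun x hx => ?_) (hmean n).2.2
      simp [pullback_assemble hD.contDiffOn _ _ _ hx]
  · refine ⟨_, hD.hasWeakGradient hpull n, ?_⟩
    have key : ∀ x ∈ D.Ω, ∀ v, fderiv ℝ (D.pullback (D.assemble (p n) (q n) (f n))) x v =
        !₂[covec (D.strain (φ n) (ψ n) 0 0 x) (D.strain (φ n) (ψ n) 0 1 x - rot n x) v,
          covec (D.strain (φ n) (ψ n) 1 0 x + rot n x) (D.strain (φ n) (ψ n) 1 1 x) v] := by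
      intro x hx v
      have hd := (hpull.differentiableAt isOpen_Ω n hx).hasFDerivAt
      ext i
      have h1 := (dx i).hasFDerivAt.comp x hd
      fin_cases i
      · refine congrArg (fun A : E2 →L[ℝ] ℝ => A v)
          (h1.unique ((hdp n x hx).congr_of_eventuallyEq ?_))
        filter_upwards [isOpen_Ω.mem_nhds hx] with y hy
        simp [pullback_assemble hD.contDiffOn _ _ _ hy]
      · refine congrArg (fun A : E2 →L[ℝ] ℝ => A v)
          (h1.unique ((hdq n x hx).congr_of_eventuallyEq ?_))
        filter_upwards [isOpen_Ω.mem_nhds hx] with y hy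
        simp [pullback_assemble hD.contDiffOn _ _ _ hy]
    have h2 : ∫ x in D.Ω, (2 : ℝ) * rot n x = 0 := by
      rw [integral_const_mul, (hmean n).1, mul_zero]
    refine Eq.trans (setIntegral_congr_fun isOpen_Ω.measurableSet fun x hx => ?_) h2
    simp only [key x hx]
    simp [strain, symProdComp_symm _ _ 1 0, a_symm hD.contDiffOn hx 1 0]
    ring

end IsRegular

end DevelopableSurface

end DevelopableShell

end

/-! ### Weak gradients and `C²` test functions -/

noncomputable section

namespace DevelopableShell

section TestFunctions

open scoped Convolution
open ContinuousLinearMap (lsmul)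

variable {F : Type} [NormedAddCommGroup F] [NormedSpace ℝ F]

/-- Integrals against uniformly convergent functions converge. -/
theorem tendsto_integral_smul_of_uniform {μ : Measure E2} {g : E2 → F} (hg : Integrable g μ)
    {ζ' : ℕ → E2 → ℝ} {ζ : E2 → ℝ} (hζ' : ∀ n, Continuous (ζ' n)) {C : ℝ}
    (hC : ∀ x, ‖ζ x‖ ≤ C)
    (hlim : ∀ ε > 0, ∀ᶠ n in Filter.atTop, ∀ x, ‖ζ' n x - ζ x‖ ≤ ε) :
    Filter.Tendsto (fun n => ∫ x, ζ' n x • g x ∂μ) Filter.atTop (𝓝 (∫ x, ζ x • g x ∂μ)) := by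
  refine tendsto_integral_filter_of_dominated_convergence (fun x => (C + 1) * ‖g x‖)
    (Filter.Eventually.of_forall fun n => (hζ' n).aestronglyMeasurable.smul hg.aestronglyMeasurable)
    ?_ (hg.norm.const_mul _) (Filter.Eventually.of_forall fun x => ?_)
  · filter_upwards [hlim 1 one_pos] with n hn
    refine Filter.Eventually.of_forall fun x => ?_
    rw [norm_smul]
    gcongr
    calc ‖ζ' n x‖ = ‖ζ x + (ζ' n x - ζ x)‖ := by congr 1; ring
      _ ≤ ‖ζ x‖ + ‖ζ' n x - ζ x‖ := norm_add_le _ _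
      _ ≤ C + 1 := add_le_add (hC x) (hn x)
  · refine Filter.Tendsto.smul_const ?_ _
    rw [Metric.tendsto_nhds]
    intro ε hε
    filter_upwards [hlim (ε / 2) (half_pos hε)] with n hn
    rw [dist_eq_norm]
    exact (hn x).trans_lt (half_lt_self hε)

theorem fderiv_mollify_of_contDiff {ρ : E2 → ℝ} (hρ : Continuous ρ)
    {g : E2 → F} (hg : ContDiff ℝ 1 g) (hgc : HasCompactSupport g) :
    fderiv ℝ (ρ ⋆[lsmul ℝ ℝ] g) = ρ ⋆[lsmul ℝ ℝ] fderiv ℝ g := by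
  ext1 x
  have h := hgc.hasFDerivAt_convolution_right (lsmul ℝ ℝ : ℝ →L[ℝ] F →L[ℝ] F)
    (hρ.locallyIntegrable (μ := volume)) hg x
  rw [h.fderiv]
  rw [convolution, convolution]
  refine integral_congr_ae (Filter.Eventually.of_forall fun y => ?_)
  ext v
  simp

theorem eventually_norm_mollify_sub_le [CompleteSpace F] {g : E2 → F} (hg : Continuous g)
    (hgc : HasCompactSupport g)
    {δ ε : ℝ} (hδ : 0 < δ) (hε : 0 < ε) : ∀ᶠ n in Filter.atTop, ∀ x,
      ‖((bumpSeq E2 δ hδ n).normed volume ⋆[lsmul ℝ ℝ] g) x - g x‖ ≤ ε := by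
  obtain ⟨r, hr, h⟩ := Metric.uniformContinuous_iff.1
    (hgc.uniformContinuous_of_continuous hg) ε hε
  filter_upwards [(tendsto_bumpSeq_rOut (E := E2) hδ).eventually (gt_mem_nhds hr)] with n hn x
  rw [← dist_eq_norm]
  refine ContDiffBump.dist_normed_convolution_le hg.aestronglyMeasurable fun y hy => ?_
  exact (h ((Metric.mem_ball.1 hy).trans hn)).le

/-- Test functions of class `C²` are limits of smooth ones, with their derivatives. -/
theorem exists_smooth_approximation {Ω : Set E2} (hΩ : IsOpen Ω) {η : E2 → ℝ} {k : ℕ}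
    (hk : 1 ≤ k) (hη : ContDiff ℝ k η) (hc : HasCompactSupport η) (hs : tsupport η ⊆ Ω) :
    ∃ η' : ℕ → E2 → ℝ, (∀ n, ContDiff ℝ (⊤ : ℕ∞) (η' n) ∧ HasCompactSupport (η' n) ∧
      tsupport (η' n) ⊆ Ω) ∧
      (∀ ε > 0, ∀ᶠ n in Filter.atTop, ∀ x, ‖η' n x - η x‖ ≤ ε) ∧
      (∀ ε > 0, ∀ᶠ n in Filter.atTop, ∀ x, ‖fderiv ℝ (η' n) x - fderiv ℝ η x‖ ≤ ε) ∧
      (2 ≤ k → ∀ ε > 0, ∀ᶠ n in Filter.atTop, ∀ x,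
        ‖fderiv ℝ (fderiv ℝ (η' n)) x - fderiv ℝ (fderiv ℝ η) x‖ ≤ ε) := by
  obtain ⟨δ, hδ, hδs⟩ := hc.isCompact.exists_cthickening_subset_open hΩ hs
  set ρ := bumpSeq E2 δ hδ with hρ
  have h1 : ContDiff ℝ 1 η := hη.of_le (by exact_mod_cast hk)
  have hcont : ∀ n, Continuous ((ρ n).normed volume) := fun n =>
    ((ρ n).contDiff_normed (μ := volume) (n := 0)).continuous
  have hsupp : ∀ n, Function.support ((ρ n).normed volume ⋆[lsmul ℝ ℝ] η) ⊆
      Metric.cthickening δ (tsupport η) := by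
    intro n
    refine (support_convolution_subset (lsmul ℝ ℝ)).trans ?_
    rintro _ ⟨a, ha, b, hb, rfl⟩
    rw [ContDiffBump.support_normed_eq] at ha
    refine Metric.mem_cthickening_of_dist_le _ b δ _ (subset_tsupport _ hb) ?_
    rw [dist_eq_norm, add_sub_cancel_right]
    exact (mem_ball_zero_iff.1 ha).le.trans (bumpSeq_rOut_lt hδ n).le
  refine ⟨fun n => (ρ n).normed volume ⋆[lsmul ℝ ℝ] η, fun n => ⟨?_, ?_, ?_⟩, ?_, ?_, ?_⟩
  · exact (ρ n).hasCompactSupport_normed.contDiff_convolution_left _ (ρ n).contDiff_normed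
      h1.continuous.locallyIntegrable
  · exact HasCompactSupport.intro' hc.isCompact.cthickening Metric.isClosed_cthickening
      fun x hx => by_contra fun h => hx (hsupp n h)
  · exact (closure_minimal (hsupp n) Metric.isClosed_cthickening).trans hδs
  · exact fun ε hε => eventually_norm_mollify_sub_le h1.continuous hc hδ hε
  · intro ε hε
    simp only [fderiv_mollify_of_contDiff (hcont _) h1 hc]
    exact eventually_norm_mollify_sub_le (h1.continuous_fderiv one_ne_zero) (hc.fderiv ℝ) hδ hε
  · intro hk2 ε hε
    have h2 : ContDiff ℝ 1 (fderiv ℝ η) := by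
      refine ContDiff.fderiv_right (m := 1) hη ?_
      exact_mod_cast hk2
    simp only [fderiv_mollify_of_contDiff (hcont _) h1 hc,
      fderiv_mollify_of_contDiff (hcont _) h2 (hc.fderiv ℝ)]
    exact eventually_norm_mollify_sub_le (h2.continuous_fderiv one_ne_zero)
      ((hc.fderiv ℝ).fderiv ℝ) hδ hε

theorem HasWeakGradient.by_parts_of_contDiff_one {Ω : Set E2} (hΩ : IsOpen Ω) {W : E2 → F}
    {G : E2 → E2 →L[ℝ] F} (h : HasWeakGradient Ω W G) {η : E2 → ℝ} (hη : ContDiff ℝ 1 η)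
    (hc : HasCompactSupport η) (hs : tsupport η ⊆ Ω) (ξ : E2) :
    ∫ x in Ω, η x • G x ξ = -∫ x in Ω, fderiv ℝ η x ξ • W x := by
  obtain ⟨η', h1, h2, h3, -⟩ := exists_smooth_approximation hΩ (k := 1) le_rfl
    (by exact_mod_cast hη) hc hs
  obtain ⟨C, hC⟩ := hc.exists_bound_of_continuous hη.continuous
  have hd : Continuous fun x => fderiv ℝ η x ξ :=
    (hη.continuous_fderiv one_ne_zero).clm_apply continuous_const
  have hdc : HasCompactSupport fun x => fderiv ℝ η x ξ :=
    hc.mono' ((subset_tsupport _).trans (tsupport_fderiv_apply_subset ℝ ξ))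
  obtain ⟨C', hC'⟩ := hdc.exists_bound_of_continuous hd
  have l1 := tendsto_integral_smul_of_uniform (h.integrable_grad.apply_continuousLinearMap ξ)
    (fun n => (h1 n).1.continuous) hC h2
  have l2 := tendsto_integral_smul_of_uniform h.integrable
    (fun n => ((h1 n).1.continuous_fderiv (by simp)).clm_apply continuous_const) hC'
    (fun ε hε => by
      have hpos : 0 < ε / (‖ξ‖ + 1) := by positivity
      filter_upwards [h3 _ hpos] with n hn x
      rw [← sub_apply]
      refine (ContinuousLinearMap.le_opNorm _ _).trans ?_
      calc _ ≤ ε / (‖ξ‖ + 1) * ‖ξ‖ := by gcongr; exact hn x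
        _ ≤ ε / (‖ξ‖ + 1) * (‖ξ‖ + 1) := by gcongr; linarith
        _ = ε := by field_simp)
  refine tendsto_nhds_unique l1 (l2.neg.congr fun n => ?_)
  exact (h.by_parts _ (h1 n).1 (h1 n).2.1 (h1 n).2.2 ξ).symm

end TestFunctions

end DevelopableShell

end

noncomputable section

namespace DevelopableShell

section WeakProducts

variable {Ω : Set E2}

theorem integrableOn_smul_of_hasCompactSupport {F : Type} [NormedAddCommGroup F] [NormedSpace ℝ F]
    {g : E2 → F} (hg : IntegrableOn g Ω) {ζ : E2 → ℝ} (hζ : Continuous ζ)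
    (hc : HasCompactSupport ζ) : IntegrableOn (fun x => ζ x • g x) Ω := by
  obtain ⟨C, hC⟩ := hc.exists_bound_of_continuous hζ
  refine (hg.norm.const_mul C).mono' (hζ.aestronglyMeasurable.smul hg.aestronglyMeasurable)
    (Filter.Eventually.of_forall fun x => ?_)
  rw [norm_smul]
  gcongr
  exact hC x

/-- The product rule for a weakly differentiable vector field and a field of class `C¹`. -/
theorem HasWeakGradient.inner_by_parts (hΩ : IsOpen Ω) {W : E2 → E3} {G : E2 → E2 →L[ℝ] E3}
    (h : HasWeakGradient Ω W G) {Z : E2 → E3} (hZ : ContDiffOn ℝ 1 Z Ω) {η : E2 → ℝ}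
    (hη : ContDiff ℝ (⊤ : ℕ∞) η) (hc : HasCompactSupport η) (hs : tsupport η ⊆ Ω) (ξ : E2) :
    ∫ x in Ω, η x * inner ℝ (G x ξ) (Z x) =
      -∫ x in Ω, (fderiv ℝ η x ξ * inner ℝ (W x) (Z x) +
        η x * inner ℝ (W x) (fderiv ℝ Z x ξ)) := by
  let pr : Fin 3 → E3 →L[ℝ] ℝ := fun c => EuclideanSpace.proj c
  have hpr : ∀ c (z : E3), pr c z = z c := fun _ _ => rfl
  let ζ : Fin 3 → E2 → ℝ := fun c x => η x * pr c (Z x)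
  have hη1 : ContDiff ℝ 1 η := hη.of_le (by simp)
  have hζ1 : ∀ c, ContDiff ℝ 1 (ζ c) := by
    intro c
    rw [contDiff_iff_contDiffAt]
    intro x
    by_cases hx : x ∈ tsupport η
    · have h1 : ContDiffAt ℝ 1 Z x := hZ.contDiffAt (hΩ.mem_nhds (hs hx))
      exact hη1.contDiffAt.mul ((pr c).contDiff.contDiffAt.comp x h1)
    · have h1 : ζ c =ᶠ[𝓝 x] fun _ => 0 := by
        filter_upwards [(isClosed_tsupport η).isOpen_compl.mem_nhds hx] with y hy
        simp [ζ, image_eq_zero_of_notMem_tsupport hy]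
      exact contDiffAt_const.congr_of_eventuallyEq h1
  have hζs : ∀ c, tsupport (ζ c) ⊆ tsupport η := fun c => closure_mono fun x hx => by
    simp only [ζ, Function.mem_support] at hx ⊢
    exact left_ne_zero_of_mul hx
  have hζc : ∀ c, HasCompactSupport (ζ c) := fun c =>
    hc.mono' ((subset_tsupport _).trans (hζs c))
  have hGξ : IntegrableOn (fun x => G x ξ) Ω := h.integrable_grad.apply_continuousLinearMap ξ
  have hdζ : ∀ c, Continuous (fun x => fderiv ℝ (ζ c) x ξ) ∧
      HasCompactSupport fun x => fderiv ℝ (ζ c) x ξ := fun c =>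
    ⟨((hζ1 c).continuous_fderiv one_ne_zero).clm_apply continuous_const,
      (hζc c).mono' ((subset_tsupport _).trans (tsupport_fderiv_apply_subset ℝ ξ))⟩
  have hi1 : ∀ c, IntegrableOn (fun x => ζ c x • G x ξ) Ω := fun c =>
    integrableOn_smul_of_hasCompactSupport hGξ (hζ1 c).continuous (hζc c)
  have hi2 : ∀ c, IntegrableOn (fun x => fderiv ℝ (ζ c) x ξ • W x) Ω := fun c =>
    integrableOn_smul_of_hasCompactSupport h.integrable (hdζ c).1 (hdζ c).2
  have hpart : ∀ c, ∫ x in Ω, pr c (ζ c x • G x ξ) =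
      -∫ x in Ω, pr c (fderiv ℝ (ζ c) x ξ • W x) := by
    intro c
    rw [(pr c).integral_comp_comm (hi1 c), (pr c).integral_comp_comm (hi2 c), ← map_neg]
    exact congrArg (pr c) (h.by_parts_of_contDiff_one hΩ (hζ1 c) (hζc c) ((hζs c).trans hs) ξ)
  have h1 : ∫ x in Ω, η x * inner ℝ (G x ξ) (Z x) = ∑ c, ∫ x in Ω, pr c (ζ c x • G x ξ) := by
    rw [← integral_finsetSum _ fun c _ => (pr c).integrable_comp (hi1 c)]
    refine integral_congr_ae (Filter.Eventually.of_forall fun x => ?_)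
    simp only [Fin.sum_univ_three, ζ, hpr, inner_e3, PiLp.smul_apply, smul_eq_mul]
    ring
  have h2 : ∫ x in Ω, (fderiv ℝ η x ξ * inner ℝ (W x) (Z x) +
      η x * inner ℝ (W x) (fderiv ℝ Z x ξ)) =
      ∑ c, ∫ x in Ω, pr c (fderiv ℝ (ζ c) x ξ • W x) := by
    rw [← integral_finsetSum _ fun c _ => (pr c).integrable_comp (hi2 c)]
    refine setIntegral_congr_fun hΩ.measurableSet fun x hx => ?_
    have hZx := ((hZ.differentiableOn one_ne_zero).differentiableAt (hΩ.mem_nhds hx)).hasFDerivAt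
    have hd : ∀ c, fderiv ℝ (ζ c) x ξ =
        fderiv ℝ η x ξ * pr c (Z x) + η x * pr c (fderiv ℝ Z x ξ) := fun c => by
      have h3 := ((hη1.differentiable one_ne_zero) x).hasFDerivAt.mul
        ((pr c).hasFDerivAt.comp x hZx)
      have h4 : HasFDerivAt (ζ c) _ x := h3
      rw [h4.fderiv]
      simp
      ring
    simp only [map_smul, smul_eq_mul, Fin.sum_univ_three, hd, inner_e3]
    simp only [hpr]
    ring
  rw [h1, h2, ← Finset.sum_neg_distrib]
  exact Finset.sum_congr rfl fun c _ => hpart c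

/-- The compatibility condition in weak form: the symmetric part `S` of a weak gradient has
vanishing double curl. -/
theorem integral_cofactor_eq_zero (hΩ : IsOpen Ω) {S g : Fin 2 → Fin 2 → E2 → ℝ}
    {v : Fin 2 → E2 → ℝ} (hSi : ∀ i j, IntegrableOn (S i j) Ω)
    (hgi : ∀ i j, IntegrableOn (g i j) Ω)
    (hg : ∀ i j, ∀ η : E2 → ℝ, ContDiff ℝ (⊤ : ℕ∞) η → HasCompactSupport η → tsupport η ⊆ Ω →
      ∫ x in Ω, η x * g i j x = -∫ x in Ω, fderiv ℝ η x (e i) * v j x)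
    (hS : ∀ᵐ x ∂(volume.restrict Ω), ∀ i j, g i j x + g j i x = 2 * S i j x)
    {η : E2 → ℝ} (hη : ContDiff ℝ 2 η) (hc : HasCompactSupport η) (hs : tsupport η ⊆ Ω) :
    ∫ x in Ω, (fderiv ℝ (fderiv ℝ η) x (e 1) (e 1) * S 0 0 x -
      fderiv ℝ (fderiv ℝ η) x (e 0) (e 1) * S 0 1 x -
      fderiv ℝ (fderiv ℝ η) x (e 1) (e 0) * S 1 0 x +
      fderiv ℝ (fderiv ℝ η) x (e 0) (e 0) * S 1 1 x) = 0 := by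
  have hsecond : ∀ {η : E2 → ℝ}, ContDiff ℝ 2 η → HasCompactSupport η → ∀ i j,
      Continuous (fun x => fderiv ℝ (fderiv ℝ η) x (e i) (e j)) ∧
      HasCompactSupport (fun x => fderiv ℝ (fderiv ℝ η) x (e i) (e j)) ∧
      tsupport (fun x => fderiv ℝ (fderiv ℝ η) x (e i) (e j)) ⊆ tsupport η := by
    intro η hη hc i j
    have h1 : ContDiff ℝ 1 (fderiv ℝ η) := hη.fderiv_right (m := 1) (by norm_num)
    have h3 : tsupport (fun x => fderiv ℝ (fderiv ℝ η) x (e i) (e j)) ⊆ tsupport η := by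
      refine (closure_mono fun x hx => ?_).trans ((tsupport_fderiv_subset ℝ (f := fderiv ℝ η)).trans
        (tsupport_fderiv_subset ℝ))
      rw [Function.mem_support] at hx ⊢
      intro h0
      rw [h0] at hx
      simp at hx
    exact ⟨((h1.continuous_fderiv one_ne_zero).clm_apply continuous_const).clm_apply
      continuous_const, hc.mono' ((subset_tsupport _).trans h3), h3⟩
  have hsplit : ∀ {η : E2 → ℝ}, ContDiff ℝ 2 η → HasCompactSupport η →
      ∀ {k : Fin 2 → Fin 2 → E2 → ℝ}, (∀ i j, IntegrableOn (k i j) Ω) →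
      ∫ x in Ω, (fderiv ℝ (fderiv ℝ η) x (e 1) (e 1) * k 0 0 x -
        fderiv ℝ (fderiv ℝ η) x (e 0) (e 1) * k 0 1 x -
        fderiv ℝ (fderiv ℝ η) x (e 1) (e 0) * k 1 0 x +
        fderiv ℝ (fderiv ℝ η) x (e 0) (e 0) * k 1 1 x) =
      (∫ x in Ω, fderiv ℝ (fderiv ℝ η) x (e 1) (e 1) • k 0 0 x) -
      (∫ x in Ω, fderiv ℝ (fderiv ℝ η) x (e 0) (e 1) • k 0 1 x) -
      (∫ x in Ω, fderiv ℝ (fderiv ℝ η) x (e 1) (e 0) • k 1 0 x) +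
      ∫ x in Ω, fderiv ℝ (fderiv ℝ η) x (e 0) (e 0) • k 1 1 x := by
    intro η hη hc k hk
    have hi : ∀ i j i' j', IntegrableOn (fun x => fderiv ℝ (fderiv ℝ η) x (e i) (e j) • k i' j' x)
        Ω := fun i j i' j' =>
      integrableOn_smul_of_hasCompactSupport (hk i' j') (hsecond hη hc i j).1
        (hsecond hη hc i j).2.1
    have i1 := hi 1 1 0 0
    have i2 := hi 0 1 0 1
    have i3 := hi 1 0 1 0
    have i4 := hi 0 0 1 1
    simp only [smul_eq_mul] at i1 i2 i3 i4 ⊢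
    rw [integral_add _ i4, integral_sub _ i3, integral_sub i1 i2]
    · exact i1.sub i2
    · exact (i1.sub i2).sub i3
  -- smooth test functions
  have hsmooth : ∀ {η : E2 → ℝ}, ContDiff ℝ (⊤ : ℕ∞) η → HasCompactSupport η → tsupport η ⊆ Ω →
      ∫ x in Ω, (fderiv ℝ (fderiv ℝ η) x (e 1) (e 1) * S 0 0 x -
        fderiv ℝ (fderiv ℝ η) x (e 0) (e 1) * S 0 1 x -
        fderiv ℝ (fderiv ℝ η) x (e 1) (e 0) * S 1 0 x +
        fderiv ℝ (fderiv ℝ η) x (e 0) (e 0) * S 1 1 x) = 0 := by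
    intro η hη hc hs
    have h2 : ContDiff ℝ 2 η := contDiff_infty.1 hη 2
    have hη1 : ContDiff ℝ (⊤ : ℕ∞) (fderiv ℝ η) := hη.fderiv_right (by simp)
    have hη2 : ContDiff ℝ (⊤ : ℕ∞) (fderiv ℝ (fderiv ℝ η)) := hη1.fderiv_right (by simp)
    have hsymm : ∀ x ξ ζ, fderiv ℝ (fderiv ℝ η) x ξ ζ = fderiv ℝ (fderiv ℝ η) x ζ ξ := fun x ξ ζ =>
      second_derivative_symmetric (fun y => ((hη.differentiable (by simp)) y).hasFDerivAt)
        ((hη1.differentiable (by simp)) x).hasFDerivAt ξ ζ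
    have hsymm3 : ∀ x ξ ζ, fderiv ℝ (fderiv ℝ (fderiv ℝ η)) x ξ ζ =
        fderiv ℝ (fderiv ℝ (fderiv ℝ η)) x ζ ξ := fun x ξ ζ =>
      second_derivative_symmetric (fun y => ((hη1.differentiable (by simp)) y).hasFDerivAt)
        ((hη2.differentiable (by simp)) x).hasFDerivAt ξ ζ
    have hthird : ∀ i j k x, fderiv ℝ (fun y => fderiv ℝ (fderiv ℝ η) y (e j) (e k)) x (e i) =
        fderiv ℝ (fderiv ℝ (fderiv ℝ η)) x (e i) (e j) (e k) := fun i j k x => by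
      have := ((((hη2.differentiable (by simp)) x).hasFDerivAt).apply_const (e j)).apply_const (e k)
      rw [this.fderiv]
      rfl
    have hij : ∀ i j, ContDiff ℝ (⊤ : ℕ∞) (fun x => fderiv ℝ (fderiv ℝ η) x (e i) (e j)) :=
      fun i j => (hη2.clm_apply contDiff_const).clm_apply contDiff_const
    have key : ∀ i j k l, ∫ x in Ω, fderiv ℝ (fderiv ℝ η) x (e k) (e l) • g i j x =
        -∫ x in Ω, fderiv ℝ (fderiv ℝ (fderiv ℝ η)) x (e i) (e k) (e l) * v j x := by
      intro i j k l
      obtain ⟨-, a2, a3⟩ := hsecond h2 hc k l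
      simpa only [hthird, smul_eq_mul] using hg i j _ (hij k l) a2 (a3.trans hs)
    have hga : ∫ x in Ω, (fderiv ℝ (fderiv ℝ η) x (e 1) (e 1) * g 0 0 x -
        fderiv ℝ (fderiv ℝ η) x (e 0) (e 1) * g 1 0 x -
        fderiv ℝ (fderiv ℝ η) x (e 1) (e 0) * g 0 1 x +
        fderiv ℝ (fderiv ℝ η) x (e 0) (e 0) * g 1 1 x) = 0 := by
      rw [hsplit h2 hc (k := fun i j => g j i) fun i j => hgi j i, key, key, key, key]
      simp only [hsymm3 _ (e 1) (e 0)]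
      ring
    rw [← hga]
    refine integral_congr_ae ?_
    filter_upwards [hS] with x hx
    have e00 := hx 0 0
    have e01 := hx 0 1
    have e10 := hx 1 0
    have e11 := hx 1 1
    rw [hsymm x (e 1) (e 0)]
    linear_combination (-1 / 2 : ℝ) * fderiv ℝ (fderiv ℝ η) x (e 1) (e 1) * e00 +
      (1 / 2 : ℝ) * fderiv ℝ (fderiv ℝ η) x (e 0) (e 1) * (e01 + e10) -
      (1 / 2 : ℝ) * fderiv ℝ (fderiv ℝ η) x (e 0) (e 0) * e11
  obtain ⟨η', h1, -, -, h4⟩ := exists_smooth_approximation hΩ (k := 2) one_le_two hη hc hs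
  have hlim : ∀ i j i' j', Filter.Tendsto
      (fun n => ∫ x in Ω, fderiv ℝ (fderiv ℝ (η' n)) x (e i) (e j) • S i' j' x) Filter.atTop
      (𝓝 (∫ x in Ω, fderiv ℝ (fderiv ℝ η) x (e i) (e j) • S i' j' x)) := by
    intro i j i' j'
    obtain ⟨a1, a2, -⟩ := hsecond hη hc i j
    obtain ⟨C, hC⟩ := a2.exists_bound_of_continuous a1
    refine tendsto_integral_smul_of_uniform (hSi i' j') (fun n => (hsecond
      (contDiff_infty.1 (h1 n).1 2) (h1 n).2.1 i j).1) hC fun ε hε => ?_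
    filter_upwards [h4 le_rfl ε hε] with n hn x
    have he : ∀ i, ‖e i‖ = 1 := fun i => by simp [e]
    rw [← sub_apply, ← sub_apply]
    refine (ContinuousLinearMap.le_opNorm₂ _ _ _).trans ?_
    rw [he, he, mul_one, mul_one]
    exact hn x
  rw [hsplit hη hc hSi]
  refine tendsto_nhds_unique ((((hlim 1 1 0 0).sub (hlim 0 1 0 1)).sub (hlim 1 0 1 0)).add
    (hlim 0 0 1 1)) (tendsto_const_nhds.congr fun n => ?_)
  have h2 : ContDiff ℝ 2 (η' n) := contDiff_infty.1 (h1 n).1 2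
  rw [← hsplit h2 (h1 n).2.1 hSi]
  exact (hsmooth (h1 n).1 (h1 n).2.1 (h1 n).2.2).symm

end WeakProducts

end DevelopableShell

end

/-! ### Test functions in the ruled coordinates -/

noncomputable section

namespace DevelopableShell

section Line

open scoped Convolution
open ContinuousLinearMap (lsmul)

/-- The test functions `s ↦ ρ (σ - s)`, with `ρ` a mollifier. -/
def lineTest (ε : ℝ) (hε : 0 < ε) (n : ℕ) (σ s : ℝ) : ℝ :=
  (bumpSeq ℝ ε hε n).normed volume (σ - s)

variable {ε : ℝ} {hε : 0 < ε} {n : ℕ} {σ : ℝ}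

theorem contDiff_lineTest : ContDiff ℝ (⊤ : ℕ∞) (lineTest ε hε n σ) :=
  (bumpSeq ℝ ε hε n).contDiff_normed.comp (contDiff_const.sub contDiff_id)

theorem tsupport_lineTest_subset :
    tsupport (lineTest ε hε n σ) ⊆ Metric.closedBall σ (bumpSeq ℝ ε hε n).rOut := by
  refine closure_minimal (fun s hs => ?_) Metric.isClosed_closedBall
  have h1 : σ - s ∈ tsupport ((bumpSeq ℝ ε hε n).normed volume) := subset_tsupport _ hs
  rw [ContDiffBump.tsupport_normed_eq, mem_closedBall_zero_iff] at h1
  rwa [Metric.mem_closedBall, dist_comm, dist_eq_norm]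

theorem hasCompactSupport_lineTest : HasCompactSupport (lineTest ε hε n σ) :=
  HasCompactSupport.of_support_subset_isCompact (isCompact_closedBall σ _)
    ((subset_tsupport _).trans tsupport_lineTest_subset)

/-- A function annihilated by the second derivatives of the mollifiers with rational centres is
affine, because its mollifications are; so it vanishes if its initial data do. -/
theorem eq_zero_of_integral_lineTest {g : ℝ → ℝ} {c d : ℝ} (hg : ContinuousOn g (Icc c d))
    (htest : ∀ n, ∀ σ : ℚ, (σ : ℝ) ∈ Ioo (c + ε) (d - ε) →
      ∫ s in Ioo c d, deriv (deriv (lineTest ε hε n σ)) s * g s = 0)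
    (h0 : (0 : ℝ) ∈ Ioo (c + ε) (d - ε)) (hg0 : g 0 = 0) (hg1 : HasDerivAt g 0 0) {s : ℝ}
    (hs : s ∈ Ioo (c + ε) (d - ε)) : g s = 0 := by
  set U := Ioo (c + ε) (d - ε) with hU
  have hUcd : U ⊆ Ioo c d := Ioo_subset_Ioo (by linarith) (by linarith)
  set G := (Ioo c d).indicator g with hG
  have hGi : Integrable G := by
    rw [hG, integrable_indicator_iff measurableSet_Ioo]
    exact (hg.integrableOn_Icc).mono_set Ioo_subset_Icc_self
  have hGl : LocallyIntegrable G := hGi.locallyIntegrable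
  set ρ : ℕ → ℝ → ℝ := fun n => (bumpSeq ℝ ε hε n).normed volume with hρ
  have hρs : ∀ n, ContDiff ℝ (⊤ : ℕ∞) (ρ n) := fun n => (bumpSeq ℝ ε hε n).contDiff_normed
  have hρc : ∀ n, HasCompactSupport (ρ n) := fun n => (bumpSeq ℝ ε hε n).hasCompactSupport_normed
  have hρs1 : ∀ n, ContDiff ℝ (⊤ : ℕ∞) (deriv (ρ n)) := fun n =>
    (contDiff_infty_iff_deriv.1 (hρs n)).2
  have hρs2 : ∀ n, ContDiff ℝ (⊤ : ℕ∞) (deriv (deriv (ρ n))) := fun n =>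
    (contDiff_infty_iff_deriv.1 (hρs1 n)).2
  have hd1 : ∀ n x, HasDerivAt (ρ n ⋆[lsmul ℝ ℝ] G) ((deriv (ρ n) ⋆[lsmul ℝ ℝ] G) x) x := fun n x =>
    (hρc n).hasDerivAt_convolution_left _ ((hρs n).of_le (by simp)) hGl x
  have hd2 : ∀ n x, HasDerivAt (deriv (ρ n) ⋆[lsmul ℝ ℝ] G)
      ((deriv (deriv (ρ n)) ⋆[lsmul ℝ ℝ] G) x) x := fun n x =>
    (hρc n).deriv.hasDerivAt_convolution_left _ ((hρs1 n).of_le (by simp)) hGl x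
  have hcont : ∀ n, Continuous (deriv (deriv (ρ n)) ⋆[lsmul ℝ ℝ] G) := fun n =>
    ((hρc n).deriv.deriv.contDiff_convolution_left (n := 0) _ ((hρs2 n).of_le (by simp))
      hGl).continuous
  have hdt : ∀ n σ s, deriv (deriv (lineTest ε hε n σ)) s = deriv (deriv (ρ n)) (σ - s) := by
    intro n σ s
    have h1 : deriv (lineTest ε hε n σ) = fun s => -deriv (ρ n) (σ - s) :=
      funext fun s => deriv_comp_const_sub (f := ρ n) σ s
    rw [h1, deriv.fun_neg, deriv_comp_const_sub, neg_neg]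
  have hzero : ∀ n, ∀ x ∈ U, (deriv (deriv (ρ n)) ⋆[lsmul ℝ ℝ] G) x = 0 := by
    intro n
    have hrat : U ∩ range ((↑) : ℚ → ℝ) ⊆ {x | (deriv (deriv (ρ n)) ⋆[lsmul ℝ ℝ] G) x = 0} := by
      rintro _ ⟨hx, σ, rfl⟩
      rw [mem_ofPred_eq, convolution_lsmul_swap, ← htest n σ hx,
        ← integral_indicator measurableSet_Ioo]
      refine integral_congr_ae (Filter.Eventually.of_forall fun s => ?_)
      by_cases hs : s ∈ Ioo c d <;> simp [hG, hs, hdt]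
    have hcl : IsClosed {x | (deriv (deriv (ρ n)) ⋆[lsmul ℝ ℝ] G) x = 0} :=
      isClosed_eq (hcont n) continuous_const
    exact (Rat.isDenseEmbedding_coe_real.dense.open_subset_closure_inter isOpen_Ioo).trans
      (hcl.closure_subset_iff.2 hrat)
  have haff : ∀ n, ∀ x ∈ U, (ρ n ⋆[lsmul ℝ ℝ] G) x =
      (ρ n ⋆[lsmul ℝ ℝ] G) 0 + x * (deriv (ρ n) ⋆[lsmul ℝ ℝ] G) 0 := by
    intro n x hx
    have h1 : ∀ y ∈ U, (deriv (ρ n) ⋆[lsmul ℝ ℝ] G) y = (deriv (ρ n) ⋆[lsmul ℝ ℝ] G) 0 :=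
      fun y hy => isOpen_Ioo.is_const_of_deriv_eq_zero isPreconnected_Ioo
        (fun z _ => (hd2 n z).differentiableAt.differentiableWithinAt)
        (fun z hz => by rw [(hd2 n z).deriv]; exact hzero n z hz) hy h0
    set A := (deriv (ρ n) ⋆[lsmul ℝ ℝ] G) 0
    have h2 : ∀ z, HasDerivAt (fun z => (ρ n ⋆[lsmul ℝ ℝ] G) z - z * A)
        ((deriv (ρ n) ⋆[lsmul ℝ ℝ] G) z - 1 * A) z := fun z =>
      (hd1 n z).sub ((hasDerivAt_id z).mul_const A)
    have h3 := isOpen_Ioo.is_const_of_deriv_eq_zero isPreconnected_Ioo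
      (fun z _ => (h2 z).differentiableAt.differentiableWithinAt)
      (fun z hz => by rw [(h2 z).deriv, h1 z hz]; simp) hx h0
    linarith
  have hlim : ∀ x ∈ U, Filter.Tendsto (fun n => (ρ n ⋆[lsmul ℝ ℝ] G) x) Filter.atTop (𝓝 (g x)) := by
    intro x hx
    have hGx : G x = g x := indicator_of_mem (hUcd hx) g
    have hev : G =ᶠ[𝓝 x] g := by
      filter_upwards [isOpen_Ioo.mem_nhds (hUcd hx)] with y hy using indicator_of_mem hy g
    have hGc : ContinuousAt G x :=
      (hg.continuousAt (Icc_mem_nhds (hUcd hx).1 (hUcd hx).2)).congr hev.symm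
    rw [← hGx, Metric.tendsto_nhds]
    intro δ hδ
    obtain ⟨r, hr, h⟩ := Metric.continuousAt_iff.1 hGc (δ / 2) (half_pos hδ)
    filter_upwards [(tendsto_bumpSeq_rOut (E := ℝ) hε).eventually (gt_mem_nhds hr)] with n hn
    refine (ContDiffBump.dist_normed_convolution_le hGi.aestronglyMeasurable
      fun y hy => ?_).trans_lt (half_lt_self hδ)
    exact (h ((Metric.mem_ball.1 hy).trans hn)).le
  have hprop : ∀ x ∈ U, x * g s = s * g x := by
    intro x hx
    have l1 := ((hlim s hs).sub (hlim 0 h0)).const_mul x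
    have l2 := ((hlim x hx).sub (hlim 0 h0)).const_mul s
    rw [hg0, sub_zero] at l1 l2
    refine tendsto_nhds_unique l1 (l2.congr fun n => ?_)
    rw [haff n s hs, haff n x hx]
    ring
  have hsl := (hasDerivAt_iff_tendsto_slope.1 hg1).const_mul s
  rw [mul_zero] at hsl
  refine tendsto_nhds_unique (tendsto_const_nhds.congr' ?_) hsl
  filter_upwards [self_mem_nhdsWithin, mem_nhdsWithin_of_mem_nhds (isOpen_Ioo.mem_nhds h0)]
    with x hx0 hx
  have hx0' : x ≠ 0 := hx0
  rw [slope_def_field, hg0, sub_zero, sub_zero, ← mul_div_assoc, ← hprop x hx]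
  field_simp

end Line

end DevelopableShell

end

noncomputable section

namespace DevelopableShell

theorem contDiffOn_succ_of_hasFDerivAt {F : Type} [NormedAddCommGroup F] [NormedSpace ℝ F]
    {Ω : Set E2} (hΩ : IsOpen Ω) {k : ℕ} {f : E2 → F} {f' : E2 → E2 →L[ℝ] F}
    (hf : ∀ x ∈ Ω, HasFDerivAt f (f' x) x) (hf' : ContDiffOn ℝ k f' Ω) :
    ContDiffOn ℝ (k + 1 : ℕ) f Ω := by
  rw [Nat.cast_add, Nat.cast_one, contDiffOn_succ_iff_fderiv_of_isOpen hΩ]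
  refine ⟨fun x hx => (hf x hx).differentiableAt.differentiableWithinAt, by simp,
    hf'.congr fun x hx => (hf x hx).fderiv⟩

namespace DevelopableSurface

variable {D : DevelopableSurface}

theorem height_eq_inner {x : E2} (hx : x ∈ D.Ω) :
    D.height x = inner ℝ (x - D.foot x) (D.N (D.time x)) := by
  rw [sub_foot hx, real_inner_smul_left, real_inner_self_eq_norm_sq,
    D.norm_N (Ioo_subset_Icc_self (time_mem hx))]
  ring

theorem Γ_mem {t : ℝ} (ht : t ∈ Ioo 0 D.T) : D.Γ t ∈ D.Ω := by
  rw [← D.Φ_zero]; exact D.Φ_mem (D.zero_mem_M ht)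

section Coordinates

variable (hu : ContDiffOn ℝ 3 D.u D.Ω) (hH : D.MeanCurvatureAwayFromZero)
include hu

theorem contDiffOn_a (i j : Fin 2) : ContDiffOn ℝ 1 (D.a i j) D.Ω :=
  ((contDiffOn_normal hu).of_le (by norm_num)).inner ℝ
    (((contDiffOn_fderiv_fderiv_u hu).clm_apply contDiffOn_const).clm_apply contDiffOn_const)

theorem contDiffOn_tr : ContDiffOn ℝ 1 D.tr D.Ω := (contDiffOn_a hu 0 0).add (contDiffOn_a hu 1 1)

include hH

/-- The curvature is recovered from the mean curvature at two points of the segment. -/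
theorem continuousOn_κ : ContinuousOn D.κ (Ioo 0 D.T) := by
  intro t₀ ht₀
  refine ContinuousAt.continuousWithinAt ?_
  have ht₀' := Ioo_subset_Icc_self ht₀
  set s := D.sPlus t₀ / 2 with hs
  have hs0 : 0 < s := half_pos (D.sPlus_pos t₀ ht₀')
  have hM : (s, t₀) ∈ D.M := ⟨ht₀, by
    have := D.sMinus_pos t₀ ht₀'
    exact ⟨by simp only; linarith, half_lt_self (D.sPlus_pos t₀ ht₀')⟩⟩
  have htr : ∀ x ∈ D.Ω, ContinuousAt D.tr x := fun x hx => (hasFDerivAt_tr hu hx).continuousAt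
  have h1 : ContinuousAt (fun t => D.tr (D.Γ t)) t₀ :=
    ContinuousAt.comp (f := D.Γ) (htr _ (Γ_mem ht₀)) (D.hasDerivAt_Γ ht₀).continuousAt
  have h2 : ContinuousAt (fun t => D.tr (D.Φ s t)) t₀ :=
    ContinuousAt.comp (f := fun t => D.Φ s t) (htr _ (D.Φ_mem hM))
      ((D.continuousOn_Φ_right s).continuousAt (D.Icc_mem_nhds ht₀))
  have h3 : ContinuousAt (fun t => (1 - D.tr (D.Γ t) / D.tr (D.Φ s t)) / s) t₀ :=
    (continuousAt_const.sub (h1.div h2 (tr_ne_zero hH (D.Φ_mem hM)))).div_const s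
  refine h3.congr ?_
  filter_upwards [D.eventually_mem_M hM] with t ht
  rw [← jacobian_eq hu hH ht, mul_div_cancel_right₀ _ (tr_ne_zero hH (D.Φ_mem ht))]
  field_simp
  ring

theorem contDiffOn_tangent : ContDiffOn ℝ 1 D.tangent (Ioo 0 D.T) := by
  rw [show (1 : WithTop ℕ∞) = 0 + 1 from (zero_add 1).symm,
    contDiffOn_succ_iff_deriv_of_isOpen isOpen_Ioo]
  refine ⟨fun t ht => (hasDerivAt_tangent hu hH ht).differentiableAt.differentiableWithinAt,
    by simp, ?_⟩
  rw [contDiffOn_zero]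
  exact ((continuousOn_κ hu hH).smul (D.continuousOn_N.mono Ioo_subset_Icc_self)).congr
    fun t ht => (hasDerivAt_tangent hu hH ht).deriv

/-- The time gains one order from its own gradient, twice. -/
theorem contDiffOn_time : ContDiffOn ℝ 2 D.time D.Ω := by
  have hmaps : MapsTo D.time D.Ω (Ioo 0 D.T) := fun x hx => time_mem hx
  have hfm : MapsTo D.foot D.Ω D.Ω := fun x hx => foot_mem hx
  have key : ∀ k : ℕ, k ≤ 1 → ContDiffOn ℝ k D.time D.Ω → ContDiffOn ℝ k D.foot D.Ω →
      ContDiffOn ℝ k (fun x => (D.tr x / D.tr (D.foot x)) • innerSL ℝ (D.tangent (D.time x)))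
        D.Ω := by
    intro k hk h1 h2
    have hk' : (k : WithTop ℕ∞) ≤ 1 := by exact_mod_cast hk
    have htr := (contDiffOn_tr hu).of_le hk'
    exact (htr.div (htr.comp h2 hfm) fun x hx => tr_ne_zero hH (foot_mem hx)).smul
      ((innerSL ℝ : E2 →L[ℝ] E2 →L[ℝ] ℝ).contDiff.comp_contDiffOn
        (((contDiffOn_tangent hu hH).of_le hk').comp h1 hmaps))
  have c0 := key 0 zero_le_one (contDiffOn_zero.2 (continuousOn_time hu hH))
    (contDiffOn_zero.2 (continuousOn_foot hu hH))
  have t1 := contDiffOn_succ_of_hasFDerivAt isOpen_Ω (fun x hx => hasFDerivAt_time hu hH hx) c0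
  have f1 := contDiffOn_succ_of_hasFDerivAt (k := 0) isOpen_Ω
    (fun x hx => hasFDerivAt_foot hu hH hx)
    (((ContinuousLinearMap.smulRightL ℝ E2 E2).isBoundedBilinearMap.contDiff.comp_contDiffOn
      (c0.prodMk (((contDiffOn_tangent hu hH).of_le (by simp)).comp
        (contDiffOn_zero.2 (continuousOn_time hu hH)) hmaps))))
  exact contDiffOn_succ_of_hasFDerivAt isOpen_Ω (fun x hx => hasFDerivAt_time hu hH hx)
    (key 1 le_rfl t1 f1)

theorem contDiffOn_height : ContDiffOn ℝ 2 D.height D.Ω := by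
  have hmaps : MapsTo D.time D.Ω (Ioo 0 D.T) := fun x hx => time_mem hx
  have hd : ∀ x ∈ D.Ω, HasFDerivAt D.height (innerSL ℝ (D.N (D.time x))) x := by
    intro x hx
    have h1 := (hasFDerivAt_id x).sub (hasFDerivAt_foot hu hH hx)
    have h2 := (D.hasDerivAt_N (hasDerivAt_tangent hu hH (time_mem hx))).hasFDerivAt.comp x
      (hasFDerivAt_time hu hH hx)
    have h3 : D.height =ᶠ[𝓝 x] fun y => inner ℝ (y - D.foot y) (D.N (D.time y)) := by
      filter_upwards [isOpen_Ω.mem_nhds hx] with y hy using height_eq_inner hy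
    refine ((h1.inner ℝ h2).congr_of_eventuallyEq h3).congr_fderiv ?_
    ext ξ
    have h4 : inner ℝ (D.N (D.time x)) (D.tangent (D.time x)) = (0 : ℝ) := by
      rw [real_inner_comm, D.inner_tangent_N]
    simp [fderivInnerCLM_apply, sub_foot hx, inner_sub_left,
      real_inner_smul_right, h4, D.inner_tangent_N, real_inner_comm]
  have h5 : ContDiffOn ℝ 1 (fun x => innerSL ℝ (D.N (D.time x))) D.Ω :=
    ((innerSL ℝ : E2 →L[ℝ] E2 →L[ℝ] ℝ).comp perpL).contDiff.comp_contDiffOn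
      ((contDiffOn_tangent hu hH).comp ((contDiffOn_time hu hH).of_le one_le_two) hmaps)
  exact contDiffOn_succ_of_hasFDerivAt (k := 1) isOpen_Ω hd h5

end Coordinates

/-- The test function `α(t) β(s)` in the ruled coordinates. -/
def ruledTest (D : DevelopableSurface) (α β : ℝ → ℝ) (x : E2) : ℝ :=
  open Classical in if x ∈ D.Ω then α (D.time x) * β (D.height x) else 0

section RuledTest

variable {α β : ℝ → ℝ} (hα : ContDiff ℝ (⊤ : ℕ∞) α) (hβ : ContDiff ℝ (⊤ : ℕ∞) β)

theorem ruledTest_Φ {s t : ℝ} (h : (s, t) ∈ D.M) : D.ruledTest α β (D.Φ s t) = α t * β s := by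
  rw [ruledTest, if_pos (D.Φ_mem h), time_Φ h, height_Φ h]

theorem continuousOn_Φ : ContinuousOn (fun q : ℝ × ℝ => D.Φ q.1 q.2) D.M := by
  have h2 : MapsTo (Prod.snd : ℝ × ℝ → ℝ) D.M (Icc 0 D.T) := fun q hq => Ioo_subset_Icc_self hq.1
  exact (D.continuousOn_Γ.comp continuousOn_snd h2).add
    (continuousOn_fst.smul (D.continuousOn_N.comp continuousOn_snd h2))

theorem tsupport_ruledTest {c d c' d' : ℝ} (hbox : Icc c d ×ˢ Icc c' d' ⊆ D.M)
    (hα : tsupport α ⊆ Icc c' d') (hβ : tsupport β ⊆ Icc c d) :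
    HasCompactSupport (D.ruledTest α β) ∧ tsupport (D.ruledTest α β) ⊆ D.Ω := by
  set K := (fun q : ℝ × ℝ => D.Φ q.1 q.2) '' (Icc c d ×ˢ Icc c' d') with hK
  have hKc : IsCompact K := (isCompact_Icc.prod isCompact_Icc).image_of_continuousOn
    (continuousOn_Φ.mono hbox)
  have hKΩ : K ⊆ D.Ω := image_mono hbox
  have hs : Function.support (D.ruledTest α β) ⊆ K := by
    intro x hx
    rw [Function.mem_support, ruledTest] at hx
    split_ifs at hx with hxΩ
    · exact ⟨(D.height x, D.time x), ⟨hβ (subset_tsupport _ (right_ne_zero_of_mul hx)),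
        hα (subset_tsupport _ (left_ne_zero_of_mul hx))⟩, Φ_param hxΩ⟩
    · exact absurd rfl hx
  exact ⟨HasCompactSupport.of_support_subset_isCompact hKc hs,
    (closure_minimal hs hKc.isClosed).trans hKΩ⟩

variable (hu : ContDiffOn ℝ 3 D.u D.Ω) (hH : D.MeanCurvatureAwayFromZero)
include hα hβ hu hH

theorem contDiff_ruledTest (hs : tsupport (D.ruledTest α β) ⊆ D.Ω) :
    ContDiff ℝ 2 (D.ruledTest α β) := by
  rw [contDiff_iff_contDiffAt]
  intro x
  by_cases hx : x ∈ D.Ω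
  · have h1 : ContDiffAt ℝ 2 (fun x => α (D.time x) * β (D.height x)) x :=
      ((contDiff_infty.1 hα 2).contDiffAt.comp x
        ((contDiffOn_time hu hH).contDiffAt (isOpen_Ω.mem_nhds hx))).mul
      ((contDiff_infty.1 hβ 2).contDiffAt.comp x
        ((contDiffOn_height hu hH).contDiffAt (isOpen_Ω.mem_nhds hx)))
    refine h1.congr_of_eventuallyEq ?_
    filter_upwards [isOpen_Ω.mem_nhds hx] with y hy
    rw [ruledTest, if_pos hy]
  · have h1 : D.ruledTest α β =ᶠ[𝓝 x] fun _ => 0 := by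
      filter_upwards [(isClosed_tsupport _).isOpen_compl.mem_nhds fun h => hx (hs h)] with y hy
      exact image_eq_zero_of_notMem_tsupport hy
    exact contDiffAt_const.congr_of_eventuallyEq h1

/-- The second derivative of `α(t) β(s)` that enters the double curl of `f a`. -/
theorem cofactor_ruledTest (hs : tsupport (D.ruledTest α β) ⊆ D.Ω) {s t : ℝ} (h : (s, t) ∈ D.M)
    (c : ℝ) :
    fderiv ℝ (fderiv ℝ (D.ruledTest α β)) (D.Φ s t) (e 1) (e 1) * (c * D.a 0 0 (D.Φ s t)) -
      fderiv ℝ (fderiv ℝ (D.ruledTest α β)) (D.Φ s t) (e 0) (e 1) * (c * D.a 0 1 (D.Φ s t)) -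
      fderiv ℝ (fderiv ℝ (D.ruledTest α β)) (D.Φ s t) (e 1) (e 0) * (c * D.a 1 0 (D.Φ s t)) +
      fderiv ℝ (fderiv ℝ (D.ruledTest α β)) (D.Φ s t) (e 0) (e 0) * (c * D.a 1 1 (D.Φ s t)) =
    c * D.tr (D.Φ s t) * (α t * deriv (deriv β) s) := by
  have h2 := contDiff_ruledTest hα hβ hu hH hs
  have h3 : ContDiff ℝ 1 (fderiv ℝ (D.ruledTest α β)) := h2.fderiv_right (m := 1) (by norm_num)
  have hline : ∀ σ, HasDerivAt (fun σ => D.ruledTest α β (D.Φ σ t))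
      (fderiv ℝ (D.ruledTest α β) (D.Φ σ t) (D.N t)) σ := fun σ =>
    ((h2.differentiable (by norm_num)) _).hasFDerivAt.comp_hasDerivAt σ (D.hasDerivAt_Φ_left σ t)
  have hline2 : HasDerivAt (fun σ => fderiv ℝ (D.ruledTest α β) (D.Φ σ t) (D.N t))
      (fderiv ℝ (fderiv ℝ (D.ruledTest α β)) (D.Φ s t) (D.N t) (D.N t)) s :=
    (((h3.differentiable one_ne_zero) _).hasFDerivAt.apply_const (D.N t)).comp_hasDerivAt s
      (D.hasDerivAt_Φ_left s t)
  have hβ1 : Differentiable ℝ β := hβ.differentiable (by simp)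
  have hβ2 : Differentiable ℝ (deriv β) :=
    (contDiff_infty_iff_deriv.1 hβ).2.differentiable (by simp)
  have hI : ∀ σ ∈ Ioo (-D.sMinus t) (D.sPlus t),
      fderiv ℝ (D.ruledTest α β) (D.Φ σ t) (D.N t) = α t * deriv β σ := by
    intro σ hσ
    refine (hline σ).unique (((hβ1 σ).hasDerivAt.const_mul (α t)).congr_of_eventuallyEq ?_)
    filter_upwards [isOpen_Ioo.mem_nhds hσ] with τ hτ
    exact ruledTest_Φ ⟨h.1, hτ⟩
  have hNN : fderiv ℝ (fderiv ℝ (D.ruledTest α β)) (D.Φ s t) (D.N t) (D.N t) =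
      α t * deriv (deriv β) s := by
    refine hline2.unique (((hβ2 s).hasDerivAt.const_mul (α t)).congr_of_eventuallyEq ?_)
    filter_upwards [isOpen_Ioo.mem_nhds h.2] with τ hτ
    exact hI τ hτ
  rw [← hNN, a_eq hu h, a_eq hu h, a_eq hu h, a_eq hu h, vec_eq (D.N t)]
  simp only [map_add, map_smul, add_apply, smul_apply, smul_eq_mul, PlanarChart.N, perp_zero_apply,
    perp_one_apply]
  ring

end RuledTest

end DevelopableSurface

end DevelopableShell

end

/-! ### Change of variables to the ruled coordinates -/

noncomputable section

namespace DevelopableShell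

/-- The plane with its coordinates, as a pair. -/
def planeEquiv : E2 ≃ᵐ ℝ × ℝ :=
  (MeasurableEquiv.toLp 2 (Fin 2 → ℝ)).symm.trans MeasurableEquiv.finTwoArrow

theorem measurePreserving_planeEquiv : MeasurePreserving planeEquiv volume volume :=
  (volume_preserving_finTwoArrow ℝ).comp (PiLp.volume_preserving_ofLp (Fin 2))

namespace DevelopableSurface

variable {D : DevelopableSurface}

theorem injOn_Φ : InjOn (fun q : ℝ × ℝ => D.Φ q.1 q.2) D.M := by
  intro q hq q' hq' h
  have h1 := time_Φ (D := D) (s := q.1) (t := q.2) hq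
  have h2 := time_Φ (D := D) (s := q'.1) (t := q'.2) hq'
  have h3 := height_Φ (D := D) (s := q.1) (t := q.2) hq
  have h4 := height_Φ (D := D) (s := q'.1) (t := q'.2) hq'
  simp only at h
  rw [h] at h1 h3
  exact Prod.ext (h3.symm.trans h4) (h1.symm.trans h2)

theorem image_coordinates :
    (fun q : ℝ × ℝ => planeEquiv (D.Φ q.1 q.2)) '' D.M = planeEquiv.symm ⁻¹' D.Ω := by
  rw [← planeEquiv.image_eq_preimage_symm, PlanarChart.Ω, image_image]

variable (hu : ContDiffOn ℝ 3 D.u D.Ω) (hH : D.MeanCurvatureAwayFromZero)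
include hu hH

/-- The Jacobian is `1` on the curve and vanishes nowhere on the segment. -/
theorem jacobian_pos {s t : ℝ} (h : (s, t) ∈ D.M) : 0 < 1 - s * D.κ t := by
  by_contra hneg
  -- otherwise it vanishes at the point `1 / κ` of the segment
  have h1 : 1 < s * D.κ t :=
    lt_of_le_of_ne (by linarith) fun h' => jacobian_ne_zero hu hH h (by linarith)
  have h2 : (s * D.κ t)⁻¹ ∈ Icc (0 : ℝ) 1 :=
    ⟨by positivity, inv_le_one_of_one_le₀ h1.le⟩
  refine jacobian_ne_zero hu hH (D.smul_mem_M h h2) ?_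
  rw [mul_assoc, inv_mul_cancel₀ (by positivity), sub_self]

/-- The ruled coordinates have Jacobian determinant `1 - s κ`, up to sign. -/
theorem hasFDerivAt_coordinates {q : ℝ × ℝ} (h : q ∈ D.M) : ∃ L : ℝ × ℝ →L[ℝ] ℝ × ℝ,
    HasFDerivAt (fun q : ℝ × ℝ => planeEquiv (D.Φ q.1 q.2)) L q ∧ |L.det| = 1 - q.1 * D.κ q.2 := by
  obtain ⟨s, t⟩ := q
  have hτ := hasDerivAt_tangent hu hH h.1
  have h1 : HasFDerivAt (fun q : ℝ × ℝ => D.Γ q.2) _ (s, t) :=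
    (D.hasDerivAt_Γ h.1).hasFDerivAt.comp (s, t) hasFDerivAt_snd
  have h2 : HasFDerivAt (fun q : ℝ × ℝ => D.N q.2) _ (s, t) :=
    (D.hasDerivAt_N hτ).hasFDerivAt.comp (s, t) hasFDerivAt_snd
  have h3 := h1.add ((hasFDerivAt_fst (𝕜 := ℝ) (p := (s, t))).smul h2)
  have h4 := ((EuclideanSpace.proj 0 : E2 →L[ℝ] ℝ).hasFDerivAt.comp (s, t) h3).prodMk
    ((EuclideanSpace.proj 1 : E2 →L[ℝ] ℝ).hasFDerivAt.comp (s, t) h3)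
  refine ⟨_, h4, ?_⟩
  have hn := norm_sq_e2 (D.tangent t)
  rw [D.norm_tangent (Ioo_subset_Icc_self h.1)] at hn
  rw [← abs_of_pos (jacobian_pos hu hH h), ContinuousLinearMap.det,
    ← LinearMap.det_toMatrix (Module.Basis.finTwoProd ℝ), Matrix.det_fin_two]
  rw [← abs_neg (1 - s * D.κ t)]
  congr 1
  simp [LinearMap.toMatrix_apply, PlanarChart.N]
  linear_combination (1 - s * D.κ t) * hn

/-- Change of variables `x = Φ(s,t)`. -/
theorem integral_ruled (F : E2 → ℝ) :
    ∫ x in D.Ω, F x = ∫ q in D.M, (1 - q.1 * D.κ q.2) * F (D.Φ q.1 q.2) := by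
  choose! L hL hdet using fun q (hq : q ∈ D.M) => hasFDerivAt_coordinates hu hH hq
  have h1 := measurePreserving_planeEquiv.symm.setIntegral_preimage_emb
    planeEquiv.symm.measurableEmbedding F D.Ω
  have hinj : InjOn (fun q : ℝ × ℝ => planeEquiv (D.Φ q.1 q.2)) D.M := fun q hq q' hq' h =>
    injOn_Φ hq hq' (planeEquiv.injective h)
  rw [← h1, ← image_coordinates, integral_image_eq_integral_abs_det_fderiv_smul volume
    D.isOpen_M.measurableSet (fun q hq => (hL q hq).hasFDerivWithinAt) hinj]
  refine setIntegral_congr_fun D.isOpen_M.measurableSet fun q hq => ?_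
  simp [hdet q hq]

theorem integrableOn_ruled_iff {F : E2 → ℝ} :
    IntegrableOn F D.Ω ↔ IntegrableOn (fun q => (1 - q.1 * D.κ q.2) * F (D.Φ q.1 q.2)) D.M := by
  choose! L hL hdet using fun q (hq : q ∈ D.M) => hasFDerivAt_coordinates hu hH hq
  have h1 := measurePreserving_planeEquiv.symm.integrableOn_comp_preimage
    planeEquiv.symm.measurableEmbedding (f := F) (s := D.Ω)
  have hinj : InjOn (fun q : ℝ × ℝ => planeEquiv (D.Φ q.1 q.2)) D.M := fun q hq q' hq' h =>
    injOn_Φ hq hq' (planeEquiv.injective h)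
  rw [← h1, ← image_coordinates, integrableOn_image_iff_integrableOn_abs_det_fderiv_smul volume
    D.isOpen_M.measurableSet (fun q hq => (hL q hq).hasFDerivWithinAt) hinj]
  refine integrableOn_congr_fun (fun q hq => ?_) D.isOpen_M.measurableSet
  simp [hdet q hq]

end DevelopableSurface

end DevelopableShell

end

/-! ### Uniqueness of normalized solutions -/

noncomputable section

namespace DevelopableShell

namespace DevelopableSurface

variable {D : DevelopableSurface}

theorem IsRegular.integrableOn_mul_a {m : ℕ} {L : ℝ} (hD : D.IsRegular m L) {f : E2 → ℝ}
    (hf : IntegrableOn f D.Ω) (i j : Fin 2) : IntegrableOn (fun x => f x * D.a i j x) D.Ω := by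
  obtain ⟨-, C, -, hC⟩ := hD.family_a (ι := Unit) i j
  refine hf.mul_bdd (c := C) ?_ ?_
  · exact (contDiffOn_a hD.contDiffOn i j).continuousOn.aestronglyMeasurable
      isOpen_Ω.measurableSet
  · filter_upwards [ae_mem_Ω] with x hx
    simpa using (hC ()).1 x hx

section Homogeneous

variable {m : ℕ} {L : ℝ} (hD : D.IsRegular m L) {f : E2 → ℝ} (hf : IntegrableOn f D.Ω)
  {g : Fin 2 → Fin 2 → E2 → ℝ} {v : Fin 2 → E2 → ℝ} (hgi : ∀ i j, IntegrableOn (g i j) D.Ω)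
  (hg : ∀ i j, ∀ η : E2 → ℝ, ContDiff ℝ (⊤ : ℕ∞) η → HasCompactSupport η → tsupport η ⊆ D.Ω →
    ∫ x in D.Ω, η x * g i j x = -∫ x in D.Ω, fderiv ℝ η x (e i) * v j x)
  (hS : ∀ᵐ x ∂(volume.restrict D.Ω), ∀ i j, g i j x + g j i x = 2 * (f x * D.a i j x))

include hD hf in
/-- On a fixed segment the weight `tr (Γ t)` is constant: the Jacobian and the mean curvature
compensate each other. -/
theorem integrableOn_ruled_moment :
    IntegrableOn (fun q : ℝ × ℝ => f (D.Φ q.1 q.2) * D.tr (D.Γ q.2)) D.M := by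
  have h1 : IntegrableOn (fun x => f x * D.tr x) D.Ω := by
    refine ((hD.integrableOn_mul_a hf 0 0).add (hD.integrableOn_mul_a hf 1 1)).congr
      (Filter.Eventually.of_forall fun x => ?_)
    simp [tr, mul_add]
  refine ((integrableOn_ruled_iff hD.contDiffOn hD.curved).1 h1).congr_fun (fun q hq => ?_)
    D.isOpen_M.measurableSet
  simp only
  rw [← jacobian_eq hD.contDiffOn hD.curved (s := q.1) hq]
  ring

include hD hf hgi hg hS

/-- The compatibility condition for `f a`, tested with `α(t) β(s)`. -/
theorem integral_ruled_moment {α β : ℝ → ℝ} (hα : ContDiff ℝ (⊤ : ℕ∞) α)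
    (hβ : ContDiff ℝ (⊤ : ℕ∞) β) {c d c' d' : ℝ} (hbox : Icc c d ×ˢ Icc c' d' ⊆ D.M)
    (hαs : tsupport α ⊆ Icc c' d') (hβs : tsupport β ⊆ Icc c d) :
    ∫ q in D.M, f (D.Φ q.1 q.2) * D.tr (D.Γ q.2) * (α q.2 * deriv (deriv β) q.1) = 0 := by
  obtain ⟨hc, hs⟩ := tsupport_ruledTest hbox hαs hβs
  have hu := hD.contDiffOn
  have hH := hD.curved
  have h1 := integral_cofactor_eq_zero isOpen_Ω (S := fun i j x => f x * D.a i j x)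
    (fun i j => hD.integrableOn_mul_a hf i j) hgi hg hS
    (contDiff_ruledTest hα hβ hu hH hs) hc hs
  rw [integral_ruled hu hH] at h1
  rw [← h1]
  refine setIntegral_congr_fun D.isOpen_M.measurableSet fun q hq => ?_
  rw [cofactor_ruledTest hα hβ hu hH hs (s := q.1) hq, ← jacobian_eq hu hH (s := q.1) hq]
  ring

/-- On almost every segment `∂²f/∂s² = 0` holds in the weak sense, for one test function at a
time. -/
theorem ae_integral_lineTest {ε : ℝ} (hε : 0 < ε) (n : ℕ) {σ c d c' d' : ℝ}
    (hσ : σ ∈ Ioo (c + ε) (d - ε)) (hbox : Icc c d ×ˢ Icc c' d' ⊆ D.M) :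
    ∀ᵐ t, t ∈ Ioo c' d' →
      ∫ s in Ioo c d, deriv (deriv (lineTest ε hε n σ)) s * f (D.Φ s t) = 0 := by
  set β := lineTest ε hε n σ with hβ
  have hβs : tsupport β ⊆ Ioo c d := by
    refine tsupport_lineTest_subset.trans fun s hs => ?_
    rw [Real.closedBall_eq_Icc] at hs
    have := bumpSeq_rOut_lt (E := ℝ) hε n
    exact ⟨by linarith [hs.1, hσ.1], by linarith [hs.2, hσ.2]⟩
  have hβ0 : ∀ s, s ∉ Ioo c d → deriv (deriv β) s = 0 := fun s hs =>
    image_eq_zero_of_notMem_tsupport fun h =>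
      hs (hβs ((tsupport_deriv_subset (f := β)) ((tsupport_deriv_subset (f := deriv β)) h)))
  have hβsm : ContDiff ℝ (⊤ : ℕ∞) β := contDiff_lineTest
  have hβ2 : Continuous (deriv (deriv β)) :=
    (contDiff_infty_iff_deriv.1 (contDiff_infty_iff_deriv.1 hβsm).2).2.continuous
  obtain ⟨C, hC⟩ := (hasCompactSupport_lineTest (hε := hε) (n := n) (σ := σ)).deriv.deriv
    |>.exists_bound_of_continuous hβ2
  have hboxM : Ioo c d ×ˢ Ioo c' d' ⊆ D.M :=
    (prod_mono Ioo_subset_Icc_self Ioo_subset_Icc_self).trans hbox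
  set K : ℝ × ℝ → ℝ := fun q => f (D.Φ q.1 q.2) * D.tr (D.Γ q.2) * deriv (deriv β) q.1 with hK
  have hKi : IntegrableOn K (Ioo c d ×ˢ Ioo c' d') := by
    refine ((integrableOn_ruled_moment hD hf).mono_set hboxM).mul_bdd (c := C)
      (hβ2.comp continuous_fst).aestronglyMeasurable (Filter.Eventually.of_forall fun q => hC q.1)
  have hKi' : Integrable K ((volume.restrict (Ioo c d)).prod (volume.restrict (Ioo c' d'))) := by
    rwa [Measure.prod_restrict]
  have h2 := isOpen_Ioo.ae_eq_zero_of_integral_contDiff_smul_eq_zero (U := Ioo c' d')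
    (f := fun t => ∫ s in Ioo c d, K (s, t)) (μ := volume)
    (IntegrableOn.locallyIntegrableOn hKi'.integral_prod_right) ?_
  · filter_upwards [h2] with t ht htm
    have h3 := ht htm
    simp only [hK] at h3
    have htT : t ∈ Ioo 0 D.T :=
      (hboxM (mk_mem_prod (a := σ) ⟨by linarith [hσ.1], by linarith [hσ.2]⟩ htm)).1
    have h4 : (fun s => f (D.Φ s t) * D.tr (D.Γ t) * deriv (deriv β) s) =
        fun s => D.tr (D.Γ t) * (deriv (deriv β) s * f (D.Φ s t)) := by ext s; ring
    rw [h4, integral_const_mul] at h3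
    exact (mul_eq_zero.1 h3).resolve_left (tr_ne_zero hD.curved (Γ_mem htT))
  · intro α hα hαc hαs
    have h3 := integral_ruled_moment hD hf hgi hg hS hα hβsm hbox
      (hαs.trans Ioo_subset_Icc_self) (hβs.trans Ioo_subset_Icc_self)
    have hα0 : ∀ t, t ∉ Ioo c' d' → α t = 0 := fun t ht =>
      image_eq_zero_of_notMem_tsupport fun h => ht (hαs h)
    obtain ⟨A, hA⟩ := hαc.exists_bound_of_continuous hα.continuous
    have h4 : Integrable (fun q => K q * α q.2)
        ((volume.restrict (Ioo c d)).prod (volume.restrict (Ioo c' d'))) :=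
      hKi'.mul_bdd (c := A) (hα.continuous.comp continuous_snd).aestronglyMeasurable
        (Filter.Eventually.of_forall fun q => hA q.2)
    rw [setIntegral_eq_of_subset_of_forall_sdiff_eq_zero D.isOpen_M.measurableSet hboxM,
      Measure.volume_eq_prod, ← Measure.prod_restrict] at h3
    · rw [← setIntegral_eq_integral_of_forall_compl_eq_zero (s := Ioo c' d')
        fun t ht => by rw [hα0 t ht, zero_smul], ← h3]
      have h5 : (fun q : ℝ × ℝ => f (D.Φ q.1 q.2) * D.tr (D.Γ q.2) *
          (α q.2 * deriv (deriv β) q.1)) = fun q => K q * α q.2 := by ext q; simp only [hK]; ring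
      rw [h5, integral_prod_symm _ h4]
      refine integral_congr_ae (Filter.Eventually.of_forall fun t => ?_)
      simp only [smul_eq_mul]
      rw [integral_mul_const, mul_comm]
    · rintro q ⟨-, hq⟩
      by_cases h5 : q.1 ∈ Ioo c d
      · rw [hα0 q.2 fun h6 => hq ⟨h5, h6⟩]; ring
      · rw [hβ0 q.1 h5]; ring

/-- An infinitesimal bending whose normal component has vanishing initial data on the segments has
no normal component. -/
theorem ae_eq_zero_of_initial (hinit : ∀ᵐ t ∂(volume.restrict (Ioo 0 D.T)),
      ContinuousOn (fun s => f (D.Φ s t)) (Ioo (-D.sMinus t) (D.sPlus t)) ∧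
      f (D.Φ 0 t) = 0 ∧ HasDerivAt (fun s => f (D.Φ s t)) 0 0) :
    ∀ᵐ x ∂(volume.restrict D.Ω), f x = 0 := by
  have hinit' := (ae_restrict_iff' measurableSet_Ioo).1 hinit
  -- countably many boxes and test functions suffice
  have hboxes : ∀ᵐ t, ∀ ε c d c' d' : ℚ, ∀ hε : (0 : ℝ) < ε, ∀ n : ℕ, ∀ σ : ℚ,
      (σ : ℝ) ∈ Ioo (c + ε : ℝ) (d - ε) → Icc (c : ℝ) d ×ˢ Icc (c' : ℝ) d' ⊆ D.M →
      t ∈ Ioo (c' : ℝ) d' →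
      ∫ s in Ioo (c : ℝ) d, deriv (deriv (lineTest ε hε n σ)) s * f (D.Φ s t) = 0 := by
    simp only [ae_all_iff]
    intro ε c d c' d' hε n σ hσ hbox
    exact ae_integral_lineTest hD hf hgi hg hS hε n hσ hbox
  have hseg : ∀ᵐ t, ∀ s, (s, t) ∈ D.M → f (D.Φ s t) = 0 := by
    filter_upwards [hinit', hboxes] with t ht hb s hst
    have htT := hst.1
    obtain ⟨hc, h0, h1⟩ := ht htT
    have hm : -D.sMinus t < min s 0 :=
      lt_min hst.2.1 (neg_lt_zero.2 (D.sMinus_pos t (Ioo_subset_Icc_self htT)))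
    have hp : max s 0 < D.sPlus t :=
      max_lt hst.2.2 (D.sPlus_pos t (Ioo_subset_Icc_self htT))
    obtain ⟨c, hc1, hc2⟩ := exists_rat_btwn hm
    obtain ⟨d, hd1, hd2⟩ := exists_rat_btwn hp
    have hcd : (c : ℝ) < d := hc2.trans ((min_le_max).trans_lt hd1)
    obtain ⟨ε, hε, hε'⟩ := exists_rat_btwn (lt_min (sub_pos.2 hc2) (sub_pos.2 hd1))
    have hε1 := hε'.trans_le (min_le_left _ _)
    have hε2 := hε'.trans_le (min_le_right _ _)
    have hcM : ((c : ℝ), t) ∈ D.M := ⟨htT, hc1, hcd.trans hd2⟩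
    have hdM : ((d : ℝ), t) ∈ D.M := ⟨htT, hc1.trans hcd, hd2⟩
    obtain ⟨l, r, hlr, hsub⟩ := mem_nhds_iff_exists_Ioo_subset.1
      ((D.eventually_mem_M hcM).and (D.eventually_mem_M hdM))
    obtain ⟨c', hc'1, hc'2⟩ := exists_rat_btwn hlr.1
    obtain ⟨d', hd'1, hd'2⟩ := exists_rat_btwn hlr.2
    have hbox : Icc (c : ℝ) d ×ˢ Icc (c' : ℝ) d' ⊆ D.M := by
      rintro ⟨σ, τ⟩ ⟨hσ, hτ⟩
      obtain ⟨h2, h3⟩ := hsub ⟨hc'1.trans_le hτ.1, hτ.2.trans_lt hd'2⟩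
      exact ⟨h2.1, h2.2.1.trans_le hσ.1, hσ.2.trans_lt h3.2.2⟩
    refine eq_zero_of_integral_lineTest (ε := ε) (hε := hε) (c := c) (d := d)
      (g := fun s => f (D.Φ s t))
      (hc.mono fun σ hσ => ⟨hc1.trans_le hσ.1, hσ.2.trans_lt hd2⟩)
      (fun n σ hσ => hb ε c d c' d' hε n σ hσ hbox ⟨hc'2, hd'1⟩) ?_ h0 h1 ?_
    · exact ⟨by linarith [min_le_right s 0], by linarith [le_max_right s 0]⟩
    · exact ⟨by linarith [min_le_left s 0], by linarith [le_max_left s 0]⟩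
  have hq : ∀ᵐ q : ℝ × ℝ, ∀ s, (s, q.2) ∈ D.M → f (D.Φ s q.2) = 0 :=
    Measure.quasiMeasurePreserving_snd.ae hseg
  have hint : ∫ x in D.Ω, |f x| = 0 := by
    rw [integral_ruled hD.contDiffOn hD.curved]
    refine setIntegral_eq_zero_of_ae_eq_zero ?_
    filter_upwards [hq] with q hq' hqM
    rw [hq' q.1 hqM, abs_zero, mul_zero]
  rw [integral_eq_zero_iff_of_nonneg (fun x => abs_nonneg _) hf.abs] at hint
  filter_upwards [hint] with x hx using abs_eq_zero.1 hx

end Homogeneous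

end DevelopableSurface

end DevelopableShell

end

noncomputable section

namespace DevelopableShell

section Rigid

variable {Ω : Set E2} (hΩ : IsOpen Ω) {v : Fin 2 → E2 → ℝ} {g : Fin 2 → Fin 2 → E2 → ℝ}

/-- Weak partial derivatives are unique. -/
theorem ae_eq_of_weak_partial {g g' v : E2 → ℝ} {ξ : E2} (hΩ : IsOpen Ω) (hg : IntegrableOn g Ω)
    (hg' : IntegrableOn g' Ω)
    (h : ∀ η : E2 → ℝ, ContDiff ℝ (⊤ : ℕ∞) η → HasCompactSupport η → tsupport η ⊆ Ω →
      ∫ x in Ω, η x * g x = -∫ x in Ω, fderiv ℝ η x ξ * v x)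
    (h' : ∀ η : E2 → ℝ, ContDiff ℝ (⊤ : ℕ∞) η → HasCompactSupport η → tsupport η ⊆ Ω →
      ∫ x in Ω, η x * g' x = -∫ x in Ω, fderiv ℝ η x ξ * v x) :
    ∀ᵐ x ∂(volume.restrict Ω), g x = g' x := by
  have h1 := hΩ.ae_eq_zero_of_integral_contDiff_smul_eq_zero (μ := volume.restrict Ω)
    (f := fun x => g x - g' x) ((hg.sub hg').locallyIntegrable.locallyIntegrableOn _) ?_
  · filter_upwards [h1, ae_restrict_mem hΩ.measurableSet] with x hx hxΩ using sub_eq_zero.1 (hx hxΩ)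
  · intro η hη hc hs
    simp only [smul_sub]
    rw [integral_sub (integrableOn_smul_of_hasCompactSupport hg hη.continuous hc)
      (integrableOn_smul_of_hasCompactSupport hg' hη.continuous hc)]
    exact sub_eq_zero.2 ((h η hη hc hs).trans (h' η hη hc hs).symm)

theorem fderiv_apply_test {η : E2 → ℝ} (hη : ContDiff ℝ (⊤ : ℕ∞) η) (hc : HasCompactSupport η)
    (hs : tsupport η ⊆ Ω) (ξ : E2) : ContDiff ℝ (⊤ : ℕ∞) (fun x => fderiv ℝ η x ξ) ∧
      HasCompactSupport (fun x => fderiv ℝ η x ξ) ∧ tsupport (fun x => fderiv ℝ η x ξ) ⊆ Ω :=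
  ⟨(hη.fderiv_right (m := (⊤ : ℕ∞)) (by simp)).clm_apply contDiff_const, hc.fderiv_apply ℝ ξ,
    (tsupport_fderiv_apply_subset ℝ ξ).trans hs⟩

theorem fderiv_fderiv_test_symm {η : E2 → ℝ} (hη : ContDiff ℝ (⊤ : ℕ∞) η) (x ξ ζ : E2) :
    fderiv ℝ (fun y => fderiv ℝ η y ξ) x ζ = fderiv ℝ (fun y => fderiv ℝ η y ζ) x ξ := by
  have h1 : DifferentiableAt ℝ (fderiv ℝ η) x :=
    (hη.fderiv_right (m := (⊤ : ℕ∞)) (by simp)).differentiable (by simp) x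
  rw [(h1.hasFDerivAt.apply_const ξ).fderiv, (h1.hasFDerivAt.apply_const ζ).fderiv]
  exact ((contDiff_infty.1 hη 2).contDiffAt.isSymmSndFDerivAt (by simp)) ζ ξ

/-- A function with mean zero and vanishing weak partial derivatives is zero. -/
theorem ae_eq_zero_of_partials_zero (hΩ : IsOpen Ω) (hconn : IsConnected Ω) {r : E2 → ℝ}
    (hvol : volume Ω ≠ ⊤) (hr : IntegrableOn r Ω)
    (h : ∀ i, ∀ η : E2 → ℝ, ContDiff ℝ (⊤ : ℕ∞) η → HasCompactSupport η → tsupport η ⊆ Ω →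
      ∫ x in Ω, fderiv ℝ η x (e i) * r x = 0) (hmean : ∫ x in Ω, r x = 0) :
    ∀ᵐ x ∂(volume.restrict Ω), r x = 0 := by
  obtain ⟨c, hc⟩ := ae_const_of_weak_gradient_zero hΩ hconn hr (fun η hη hcs hs ξ => by
    have h1 : ∀ i, Integrable (fun x => fderiv ℝ η x (e i) * r x) (volume.restrict Ω) := fun i =>
      integrableOn_smul_of_hasCompactSupport hr (fderiv_apply_test hη hcs hs _).1.continuous
        (fderiv_apply_test hη hcs hs _).2.1
    have h2 : (fun x => fderiv ℝ η x ξ • r x) = fun x =>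
        ξ 0 * (fderiv ℝ η x (e 0) * r x) + ξ 1 * (fderiv ℝ η x (e 1) * r x) := by
      ext x
      conv_lhs => rw [vec_eq ξ]
      simp only [map_add, map_smul, smul_eq_mul]
      ring
    rw [h2, integral_add ((h1 0).const_mul _) ((h1 1).const_mul _), integral_const_mul,
      integral_const_mul, h 0 η hη hcs hs, h 1 η hη hcs hs]
    simp)
  rw [integral_congr_ae hc, integral_const, measureReal_restrict_apply_univ, smul_eq_mul] at hmean
  have hpos : 0 < volume.real Ω :=
    ENNReal.toReal_pos (hΩ.measure_pos volume hconn.nonempty).ne' hvol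
  filter_upwards [hc] with x hx
  rw [hx]; exact (mul_eq_zero.1 hmean).resolve_left hpos.ne'

include hΩ in
/-- Infinitesimal rigid displacements are affine; the mean of the rotation and of the displacement
determine them. -/
theorem ae_eq_zero_of_skew (hconn : IsConnected Ω) (hvol : volume Ω ≠ ⊤)
    (hv : ∀ j, IntegrableOn (v j) Ω) (hgi : ∀ i j, IntegrableOn (g i j) Ω)
    (hg : ∀ i j, ∀ η : E2 → ℝ, ContDiff ℝ (⊤ : ℕ∞) η → HasCompactSupport η → tsupport η ⊆ Ω →
      ∫ x in Ω, η x * g i j x = -∫ x in Ω, fderiv ℝ η x (e i) * v j x)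
    (hskew : ∀ᵐ x ∂(volume.restrict Ω), ∀ i j, g i j x + g j i x = 0)
    (hrot : ∫ x in Ω, (g 0 1 x - g 1 0 x) = 0) (hmean : ∀ j, ∫ x in Ω, v j x = 0) (j : Fin 2) :
    ∀ᵐ x ∂(volume.restrict Ω), v j x = 0 := by
  have hdiag : ∀ i, ∀ η : E2 → ℝ, ContDiff ℝ (⊤ : ℕ∞) η → HasCompactSupport η → tsupport η ⊆ Ω →
      ∫ x in Ω, fderiv ℝ η x (e i) * v i x = 0 := by
    intro i η hη hc hs
    rw [← neg_eq_zero, ← hg i i η hη hc hs]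
    refine integral_eq_zero_of_ae ?_
    filter_upwards [hskew] with x hx
    have : g i i x = 0 := by linarith [hx i i]
    simp [this]
  -- the rotation `g 0 1` is constant, since its weak gradient vanishes
  have hr : ∀ᵐ x ∂(volume.restrict Ω), g 0 1 x = 0 := by
    refine ae_eq_zero_of_partials_zero hΩ hconn hvol (hgi 0 1) (fun i η hη hc hs => ?_) ?_
    · obtain ⟨t1, t2, t3⟩ := fderiv_apply_test hη hc hs (e 0)
      obtain ⟨s1, s2, s3⟩ := fderiv_apply_test hη hc hs (e 1)
      fin_cases i
      · have h1 : ∫ x in Ω, fderiv ℝ η x (e 0) * g 0 1 x =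
            -∫ x in Ω, fderiv ℝ η x (e 0) * g 1 0 x := by
          rw [← integral_neg]
          refine integral_congr_ae ?_
          filter_upwards [hskew] with x hx
          have : g 0 1 x = -g 1 0 x := by linarith [hx 0 1]
          rw [this]; ring
        refine h1.trans ?_
        rw [hg 1 0 _ t1 t2 t3, neg_neg]
        simp only [fderiv_fderiv_test_symm hη _ (e 0) (e 1)]
        exact hdiag 0 _ s1 s2 s3
      · refine (hg 0 1 _ s1 s2 s3).trans ?_
        simp only [fderiv_fderiv_test_symm hη _ (e 1) (e 0)]
        rw [hdiag 1 _ t1 t2 t3, neg_zero]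
    · have h1 : ∫ x in Ω, (g 0 1 x - g 1 0 x) = ∫ x in Ω, 2 * g 0 1 x := by
        refine integral_congr_ae ?_
        filter_upwards [hskew] with x hx
        linarith [hx 0 1]
      rw [h1, integral_const_mul] at hrot
      linarith
  have hzero : ∀ i j, ∀ᵐ x ∂(volume.restrict Ω), g i j x = 0 := by
    intro i j
    filter_upwards [hskew, hr] with x hx hx1
    fin_cases i <;> fin_cases j
    · exact (by linarith [hx 0 0] : g 0 0 x = 0)
    · exact hx1
    · exact (by linarith [hx 0 1] : g 1 0 x = 0)
    · exact (by linarith [hx 1 1] : g 1 1 x = 0)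
  refine ae_eq_zero_of_partials_zero hΩ hconn hvol (hv j) (fun i η hη hc hs => ?_) (hmean j)
  rw [← neg_eq_zero, ← hg i j η hη hc hs]
  refine integral_eq_zero_of_ae ?_
  filter_upwards [hzero i j] with x hx
  simp [hx]

end Rigid

theorem HasWeakGradient.sub {F : Type} [NormedAddCommGroup F] [NormedSpace ℝ F] {Ω : Set E2}
    {W W' : E2 → F} {G G' : E2 → E2 →L[ℝ] F}
    (h : HasWeakGradient Ω W G) (h' : HasWeakGradient Ω W' G') :
    HasWeakGradient Ω (fun x => W x - W' x) (fun x => G x - G' x) := by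
  refine ⟨h.integrable.sub h'.integrable, h.integrable_grad.sub h'.integrable_grad,
    fun η hη hc hs ξ => ?_⟩
  obtain ⟨t1, t2, t3⟩ := fderiv_apply_test hη hc hs ξ
  simp only [sub_apply, smul_sub]
  have hG : ∀ {G : E2 → E2 →L[ℝ] F}, IntegrableOn G Ω → IntegrableOn (fun x => η x • G x ξ) Ω :=
    fun hG => integrableOn_smul_of_hasCompactSupport (hG.apply_continuousLinearMap ξ)
      hη.continuous hc
  rw [integral_sub (hG h.integrable_grad) (hG h'.integrable_grad),
    integral_sub (integrableOn_smul_of_hasCompactSupport h.integrable t1.continuous t2)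
      (integrableOn_smul_of_hasCompactSupport h'.integrable t1.continuous t2),
    h.by_parts η hη hc hs, h'.by_parts η hη hc hs]
  abel

end DevelopableShell

end

noncomputable section

namespace DevelopableShell

namespace DevelopableSurface

variable {D : DevelopableSurface}

section Components

variable (hu : ContDiffOn ℝ 3 D.u D.Ω)
include hu

theorem inner_tanPart_normal (w : E2 → E3) {x : E2} (hx : x ∈ D.Ω) :
    inner ℝ (D.tanPart w x) (D.normal x) = (0 : ℝ) := by
  rw [tanPart, inner_sub_left, real_inner_smul_left, inner_normal_self hu hx, mul_one, normalPart,
    sub_self]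

/-- Derivatives of the frame vectors `∂ⱼu` are normal. -/
theorem inner_tanPart_fderiv_fderiv_u (w : E2 → E3) {x : E2} (hx : x ∈ D.Ω) (ξ ζ : E2) :
    inner ℝ (D.tanPart w x) (fderiv ℝ (fun y => fderiv ℝ D.u y ζ) x ξ) = (0 : ℝ) := by
  rw [(hasFDerivAt_fderiv_u_apply hu hx ζ).fderiv, ContinuousLinearMap.flip_apply,
    fderiv_fderiv_u_eq hu hx, real_inner_smul_right, inner_tanPart_normal hu w hx, mul_zero]

/-- A vector field on the surface is determined by `w'` and by `w · n`. -/
theorem eq_of_pullback_eq {w w' : E2 → E3} {x : E2} (hx : x ∈ D.Ω)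
    (hp : ∀ j, D.pullback w x j = D.pullback w' x j) (hn : D.normalPart w x = D.normalPart w' x) :
    w x = w' x := by
  have h1 : ∀ w : E2 → E3, w x = D.tanPart w x + D.normalPart w x • D.normal x := fun w => by
    rw [tanPart, sub_add_cancel]
  rw [h1 w, h1 w', hn, frame_expansion hu hx (D.tanPart w x),
    frame_expansion hu hx (D.tanPart w' x), inner_tanPart_normal hu w hx,
    inner_tanPart_normal hu w' hx]
  have h2 := hp 0
  have h3 := hp 1
  simp only [pullback, PiLp.toLp_apply, Matrix.cons_val_zero, Matrix.cons_val_one] at h2 h3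
  rw [h2, h3]

theorem norm_fderiv_u_e {x : E2} (hx : x ∈ D.Ω) (j : Fin 2) : ‖fderiv ℝ D.u x (e j)‖ = 1 := by
  have h := inner_u hu x hx (e j) (e j)
  rw [real_inner_self_eq_norm_sq, inner_e2] at h
  have h2 : ‖fderiv ℝ D.u x (e j)‖ ^ 2 = 1 := by rw [h]; fin_cases j <;> simp
  exact (pow_eq_one_iff_of_nonneg (norm_nonneg _) two_ne_zero).1 h2

theorem integrableOn_inner_fderiv_u {W : E2 → E3} (hW : IntegrableOn W D.Ω) (j : Fin 2) :
    IntegrableOn (fun x => (inner ℝ (W x) (fderiv ℝ D.u x (e j)) : ℝ)) D.Ω := by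
  have hc : ContinuousOn (fun x => fderiv ℝ D.u x (e j)) D.Ω :=
    (contDiffOn_fderiv_u hu).continuousOn.clm_apply continuousOn_const
  refine hW.norm.mono' (hW.aestronglyMeasurable.inner
    (hc.aestronglyMeasurable isOpen_Ω.measurableSet)) ?_
  filter_upwards [ae_mem_Ω] with x hx
  exact (norm_inner_le_norm _ _).trans_eq (by rw [norm_fderiv_u_e hu hx, mul_one])

end Components

/-- Normalized solutions are unique. -/
theorem IsRegular.ae_eq_of_isNormalized {m : ℕ} {L : ℝ} (hD : D.IsRegular m L)
    {B : E2 → E2 → E2 → ℝ} {w w' : E2 → E3} (hw : D.IsWeakSolution B w) (hwn : D.IsNormalized w)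
    (hw' : D.IsWeakSolution B w') (hwn' : D.IsNormalized w') :
    w' =ᵐ[volume.restrict D.Ω] w := by
  have hu := hD.contDiffOn
  obtain ⟨G, hG, hGe⟩ := hw.equation
  obtain ⟨G', hG', hGe'⟩ := hw'.equation
  obtain ⟨H, hH, hH0⟩ := hwn.skew_mean
  obtain ⟨H', hH', hH0'⟩ := hwn'.skew_mean
  have hU := hG.sub hG'
  have hP := hH.sub hH'
  have : IsFiniteMeasure (volume.restrict D.Ω) := isFiniteMeasure_restrict.2 D.volume_Ω_ne_top
  set f : E2 → ℝ := fun x => D.normalPart w x - D.normalPart w' x with hf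
  have hfi : IntegrableOn f D.Ω :=
    (hw.bounded.integrable le_top).sub (hw'.bounded.integrable le_top)
  set v : Fin 2 → E2 → ℝ := fun j x => D.pullback w x j - D.pullback w' x j with hv
  have hvU : ∀ j x, v j x = inner ℝ (D.tanPart w x - D.tanPart w' x) (fderiv ℝ D.u x (e j)) := by
    intro j x
    rw [inner_sub_left]
    fin_cases j <;> simp [hv, pullback]
  set g : Fin 2 → Fin 2 → E2 → ℝ := fun i j x =>
    inner ℝ ((G x - G' x) (e i)) (fderiv ℝ D.u x (e j)) with hg
  have hgi : ∀ i j, IntegrableOn (g i j) D.Ω := fun i j =>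
    integrableOn_inner_fderiv_u hu (hU.integrable_grad.apply_continuousLinearMap (e i)) j
  have hvi : ∀ j, IntegrableOn (v j) D.Ω := fun j =>
    (integrableOn_inner_fderiv_u hu hU.integrable j).congr
      (Filter.Eventually.of_forall fun x => (hvU j x).symm)
  have hgv : ∀ i j, ∀ η : E2 → ℝ, ContDiff ℝ (⊤ : ℕ∞) η → HasCompactSupport η →
      tsupport η ⊆ D.Ω → ∫ x in D.Ω, η x * g i j x = -∫ x in D.Ω, fderiv ℝ η x (e i) * v j x := by
    intro i j η hη hc hs
    rw [hU.inner_by_parts isOpen_Ω (Z := fun y => fderiv ℝ D.u y (e j))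
      (((contDiffOn_fderiv_u hu).of_le one_le_two).clm_apply contDiffOn_const) hη hc hs]
    congr 1
    refine setIntegral_congr_fun isOpen_Ω.measurableSet fun x hx => ?_
    rw [hvU, inner_sub_left (D.tanPart w x) _ (fderiv ℝ (fun y => fderiv ℝ D.u y (e j)) x (e i)),
      inner_tanPart_fderiv_fderiv_u hu w hx, inner_tanPart_fderiv_fderiv_u hu w' hx, sub_zero,
      mul_zero, add_zero]
  have hS : ∀ᵐ x ∂(volume.restrict D.Ω), ∀ i j, g i j x + g j i x = 2 * (f x * D.a i j x) := by
    filter_upwards [hGe, hGe', ae_mem_Ω] with x h1 h2 hx i j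
    have h3 : D.secondForm x (e i) (e j) = -D.a i j x := by
      rw [secondForm_eq_sum hu hx]
      fin_cases i <;> fin_cases j <;> simp [a_symm hu hx 1 0]
    have h4 := (h1 (e i) (e j)).trans (h2 (e i) (e j)).symm
    rw [h3] at h4
    simp only [hg, hf, sub_apply, inner_sub_left]
    linear_combination 2 * h4
  have hinit : ∀ᵐ t ∂(volume.restrict (Ioo 0 D.T)),
      ContinuousOn (fun s => f (D.Φ s t)) (Ioo (-D.sMinus t) (D.sPlus t)) ∧
      f (D.Φ 0 t) = 0 ∧ HasDerivAt (fun s => f (D.Φ s t)) 0 0 := by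
    filter_upwards [hwn.initial, hwn'.initial] with t h1 h2
    refine ⟨h1.1.sub h2.1, ?_, ?_⟩
    · simp only [hf, h1.2.1, h2.2.1, sub_zero]
    · exact (h1.2.2.sub h2.2.2).congr_deriv (sub_zero 0)
  have hf0 := ae_eq_zero_of_initial hD hfi hgi hgv hS hinit
  have hskew : ∀ᵐ x ∂(volume.restrict D.Ω), ∀ i j, g i j x + g j i x = 0 := by
    filter_upwards [hS, hf0] with x h1 h2 i j
    rw [h1, h2]; ring
  have hcomp : ∀ i j, IntegrableOn (fun x => (H x - H' x) (e i) j) D.Ω := fun i j =>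
    (dx j).integrable_comp (hP.integrable_grad.apply_continuousLinearMap (e i))
  -- `g` is also the weak gradient in the normalization of the mean rotation
  have hHg : ∀ i j, ∀ᵐ x ∂(volume.restrict D.Ω), (H x - H' x) (e i) j = g i j x := fun i j =>
    ae_eq_of_weak_partial (v := v j) isOpen_Ω (hcomp i j) (hgi i j) (fun η hη hc hs => by
      have h1 := congrArg (dx j) (hP.by_parts η hη hc hs (e i))
      obtain ⟨t1, t2, -⟩ := fderiv_apply_test hη hc hs (e i)
      rw [map_neg, ← ContinuousLinearMap.integral_comp_comm _
        (integrableOn_smul_of_hasCompactSupport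
          (hP.integrable_grad.apply_continuousLinearMap (e i)) hη.continuous hc),
        ← ContinuousLinearMap.integral_comp_comm _
        (integrableOn_smul_of_hasCompactSupport hP.integrable t1.continuous t2)] at h1
      simpa using h1) (hgv i j)
  have hrot : ∫ x in D.Ω, (g 0 1 x - g 1 0 x) = 0 := by
    have hi : ∀ {A : E2 → E2 →L[ℝ] E2}, IntegrableOn A D.Ω →
        IntegrableOn (fun x => A x (e 0) 1 - A x (e 1) 0) D.Ω := fun hA =>
      ((dx 1).integrable_comp (hA.apply_continuousLinearMap (e 0))).sub
        ((dx 0).integrable_comp (hA.apply_continuousLinearMap (e 1)))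
    have h1 := integral_sub (hi hH.integrable_grad) (hi hH'.integrable_grad)
    rw [hH0, hH0', sub_zero] at h1
    rw [← h1]
    refine integral_congr_ae ?_
    filter_upwards [hHg 0 1, hHg 1 0] with x h2 h3
    rw [← h2, ← h3]
    simp only [sub_apply, PiLp.sub_apply]
    ring
  have hmean : ∀ j, ∫ x in D.Ω, v j x = 0 := by
    intro j
    have h1 := (dx j).integral_comp_comm hP.integrable
    rw [integral_sub hH.integrable hH'.integrable, hwn.mean, hwn'.mean, sub_zero, map_zero] at h1
    exact h1
  have hv0 := ae_eq_zero_of_skew isOpen_Ω D.lipschitz_domain.isConnected D.volume_Ω_ne_top hvi hgi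
    hgv hskew hrot hmean
  filter_upwards [hv0 0, hv0 1, hf0, ae_mem_Ω] with x h0 h1 h2 hx
  refine (eq_of_pullback_eq hu hx (fun j => ?_) (sub_eq_zero.1 h2)).symm
  fin_cases j
  · exact sub_eq_zero.1 h0
  · exact sub_eq_zero.1 h1

end DevelopableSurface

end DevelopableShell

end

/-! ### Conclusion -/

theorem proposition3p2 (k : ℕ) (hk : 1 ≤ k) (D : DevelopableSurface)
    (hS : D.IsOfClass (k + 2)) (hH : D.MeanCurvatureAwayFromZero) :
    ∃ C : ℝ≥0, ∀ φ ψ : E2 → E3, MemCk (k + 1) D.Ω φ → MemCk (k + 1) D.Ω ψ →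
      ∃ w : E2 → E3,
        (D.IsWeakSolution (DevelopableSurface.symProd φ ψ) w ∧ D.IsNormalized w) ∧
        (∀ w' : E2 → E3,
          D.IsWeakSolution (DevelopableSurface.symProd φ ψ) w' → D.IsNormalized w' →
            w' =ᵐ[volume.restrict D.Ω] w) ∧
        MemCk k D.Ω (D.tanPart w) ∧ MemCk (k - 1) D.Ω (D.normalPart w) ∧
        ckNorm k D.Ω (D.tanPart w) + ckNorm (k - 1) D.Ω (D.normalPart w) ≤
          C * ckNorm (k + 1) D.Ω φ * ckNorm (k + 1) D.Ω ψ := by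
  obtain ⟨m, rfl⟩ : ∃ m, k = m + 1 := ⟨k - 1, by omega⟩
  obtain ⟨L, hD⟩ := DevelopableSurface.exists_isRegular (m := m) hS hH
  have hΩ : IsOpen D.Ω := DevelopableSurface.isOpen_Ω
  -- All pairs of data are treated at once, so that the constants do not depend on the pair.
  let ι : Type := {p : (E2 → E3) × (E2 → E3) // MemCk (m + 2) D.Ω p.1 ∧ MemCk (m + 2) D.Ω p.2}
  obtain ⟨w, hw, ⟨hN, A, hA, hAw⟩, -, A', hA', hAw'⟩ := hD.exists_solution (ι := ι)
    (φ := fun p => p.1.1) (ψ := fun p => p.1.2)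
    (N := fun p => (ckNorm (m + 2) D.Ω p.1.1).toReal)
    (M := fun p => (ckNorm (m + 2) D.Ω p.1.2).toReal)
    ⟨fun _ => ENNReal.toReal_nonneg, 1, zero_le_one, fun p => by
      rw [one_mul]; exact p.2.1.ckBound hΩ⟩
    ⟨fun _ => ENNReal.toReal_nonneg, 1, zero_le_one, fun p => by
      rw [one_mul]; exact p.2.2.ckBound hΩ⟩
  refine ⟨(m + 3 : ℕ) * A.toNNReal + (m + 2 : ℕ) * A'.toNNReal, fun φ ψ hφ hψ => ?_⟩
  let p : ι := ⟨(φ, ψ), hφ, hψ⟩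
  have h1 := mul_nonneg hA (hN p)
  have h2 := mul_nonneg hA' (hN p)
  have hprod : ∀ {A : ℝ}, 0 ≤ A → ENNReal.ofReal (A * ((ckNorm (m + 2) D.Ω φ).toReal *
      (ckNorm (m + 2) D.Ω ψ).toReal)) =
      A.toNNReal * (ckNorm (m + 2) D.Ω φ * ckNorm (m + 2) D.Ω ψ) := fun hA => by
    rw [ENNReal.ofReal_mul hA, ENNReal.ofReal_mul ENNReal.toReal_nonneg,
      ENNReal.ofReal_toReal hφ.2.ne, ENNReal.ofReal_toReal hψ.2.ne]
    rfl
  refine ⟨w p, hw p, fun w' hw' hwn' => hD.ae_eq_of_isNormalized (hw p).1 (hw p).2 hw' hwn',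
    (hAw p).memCk hΩ h1, (hAw' p).memCk hΩ h2, ?_⟩
  have h3 := (hAw p).ckNorm_le h1
  have h4 := (hAw' p).ckNorm_le h2
  simp only [p] at h3 h4
  rw [hprod hA] at h3
  rw [hprod hA'] at h4
  refine (add_le_add h3 h4).trans_eq ?_
  push_cast
  ring
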